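/- Let $n\ge 0$ and let $H,F:\mathbb R^n\times\mathbb R^n\times\mathbb R\to\mathbb R$, written $(x,p,u)\mapsto H(x,p,u)$, be $C^1$ functions such that $G=H$ and $G=F$ both satisfy: (H1) for each $R>0$ there is $K_R>0$ with $|G(x,p,u)|\le K_R$ and $|D_pG(x,p,u)|\le K_R(1+|x|)$ for all $x\in\mathbb R^n$, $|p|<R$, $u\in\mathbb R$; (H2) $\lim_{|p|\to\infty}\ \inf_{x\in\mathbb R^n,\,u\in\mathbb R} G(x,p,u)/|p|=+\infty$; (H3) $p\mapsto G(x,p,u)$ is convex for all $(x,u)$; (H4) there is $C>0$ with $|\partial_uG(x,p,u)|\le C$ for all $(x,p,u)$. Suppose moreover that, for all $(x,p,u)$, (H5) $D_xH\cdot D_pF-D_pH\cdot D_xF+(p\cdot D_pF)\,\partial_uH-(p\cdot D_pH)\,\partial_uF+(\partial_uF)\,H-(\partial_uH)\,F=0.$ For $G\in\{H,F\}$ and a bounded Lipschitz function $\varphi$ on $\mathbb R^n$ (that is, $\varphi\in\mathrm{Lip}(\mathbb R^n)\cap BUC(\mathbb R^n)$), consider the Cauchy problem $$u_t+G(x,Du,u)=0\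 \text{ in }\mathbb R^n\times(0,\infty),\qquad u(\cdot,0)=\varphi .$$ A function $u$ on $\mathbb R^n\times[0,\infty)$ is a viscosity subsolution (supersolution) of it if $u(\cdot,0)\le\varphi$ ($\ge\varphi$) and, for each $\psi\in C^1(\mathbb R^n\times(0,\infty))$ and each $(x_0,t_0)\in\mathbb R^n\times(0,\infty)$ such that $u(x_0,t_0)=\psi(x_0,t_0)$ and $u-\psi$ has a strict maximum (minimum) over $\mathbb R^n\times(0,\infty)$ at $(x_0,t_0)$, one has $\psi_t(x_0,t_0)+G(x_0,D\psi(x_0,t_0),\psi(x_0,t_0))\le 0$ ($\ge 0$). A Lipschitz viscosity solution is a function that is both and that is Lipschitz on $\mathbb R^n\times[0,T]$ for every $T>0$. Then for $G\in\{H,F\}$ and every $\varphi\in\mathrm{Lip}(\mathbb R^n)\cap BUC(\mathbb R^n)$ there is exactly one Lipschitz viscosity solution $u$ on $\mathbb R^n\times[0,\infty)$; the Lax–Oleinik semigroup $S_G(t)\varphi:=u(\cdot,t)$, $t\ge0$, maps $\mathrm{Lip}(\mathbb R^n)\cap BUC(\mathbb R^n)$ into itself; and the two semigroups commute: $$S_H(\lambda)\big(S_F(\mu)\varphi\big)(x)=S_F(\mu)\big(S_H(\lambda)\varphi\big)(x)\qquad\text{for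 all }\varphi\in\mathrm{Lip}(\mathbb R^n)\cap BUC(\mathbb R^n),\ x\in\mathbb R^n,\ \lambda,\mu\ge0 .$$ -/

import Mathlib

open Set

noncomputable section

namespace ContactHJ

/-- `ℝⁿ` with its Euclidean norm. -/
abbrev Eucl (n : ℕ) : Type := EuclideanSpace ℝ (Fin n)

variable {n : ℕ}

/-- The partial gradient `D_x H(x,p,u)`. -/
def gradX (H : Eucl n → Eucl n → ℝ → ℝ) (x p : Eucl n) (u : ℝ) : Eucl n :=
  gradient (fun y => H y p u) x

/-- The partial gradient `D_p H(x,p,u)`. -/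
def gradP (H : Eucl n → Eucl n → ℝ → ℝ) (x p : Eucl n) (u : ℝ) : Eucl n :=
  gradient (fun q => H x q u) p

/-- The partial derivative `∂H/∂u (x,p,u)`. -/
def derivU (H : Eucl n → Eucl n → ℝ → ℝ) (x p : Eucl n) (u : ℝ) : ℝ :=
  deriv (fun v => H x p v) u

/-- The assumptions on one contact Hamiltonian: `H` is `C¹`, bounded for bounded `p` with
`D_p H` of at most linear growth in `x`, superlinear in `p` uniformly in `(x,u)`, convex in `p`,
and with bounded derivative in `u`. -/
structure IsContactHamiltonian (H : Eucl n → Eucl n → ℝ → ℝ) : Prop where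
  contDiff : ContDiff ℝ 1 (fun z : Eucl n × Eucl n × ℝ => H z.1 z.2.1 z.2.2)
  bounds : ∀ R : ℝ, 0 < R → ∃ K : ℝ, 0 < K ∧ ∀ x p : Eucl n, ∀ u : ℝ, ‖p‖ < R →
    |H x p u| ≤ K ∧ ‖gradP H x p u‖ ≤ K * (1 + ‖x‖)
  superlinear : ∀ M : ℝ, ∃ R : ℝ, 0 < R ∧ ∀ x p : Eucl n, ∀ u : ℝ, R < ‖p‖ →
    M ≤ H x p u / ‖p‖
  convex : ∀ (x : Eucl n) (u : ℝ), ConvexOn ℝ univ (fun p => H x p u)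
  lipU : ∃ C : ℝ, 0 < C ∧ ∀ (x p : Eucl n) (u : ℝ), |derivU H x p u| ≤ C

/-- The Jacobi commutation identity for `H` and `F`. -/
def JacobiCommute (H F : Eucl n → Eucl n → ℝ → ℝ) : Prop :=
  ∀ (x p : Eucl n) (u : ℝ),
    inner ℝ (gradX H x p u) (gradP F x p u) - inner ℝ (gradP H x p u) (gradX F x p u)
      + inner ℝ p (gradP F x p u) * derivU H x p u
      - inner ℝ p (gradP H x p u) * derivU F x p u
      + derivU F x p u * H x p u - derivU H x p u * F x p u = 0

/-- `Lip(ℝⁿ) ∩ BUC(ℝⁿ)`. -/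
def IsLipBUC (φ : Eucl n → ℝ) : Prop :=
  (∃ K : NNReal, LipschitzWith K φ) ∧ UniformContinuous φ ∧ ∃ C : ℝ, ∀ x, |φ x| ≤ C

/-- Viscosity subsolutions of `u_t + H(x,Du,u) = 0` in `ℝⁿ × (0,∞)`, `u(·,0) = φ`; only the
values `u x t` with `t ≥ 0` matter. -/
def IsViscositySubsolution (H : Eucl n → Eucl n → ℝ → ℝ) (φ : Eucl n → ℝ)
    (u : Eucl n → ℝ → ℝ) : Prop :=
  (∀ ψ : Eucl n × ℝ → ℝ, ContDiffOn ℝ 1 ψ (univ ×ˢ Ioi 0) →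
    ∀ (x₀ : Eucl n) (t₀ : ℝ), 0 < t₀ → u x₀ t₀ = ψ (x₀, t₀) →
    (∀ (x : Eucl n) (t : ℝ), 0 < t → (x, t) ≠ (x₀, t₀) →
      u x t - ψ (x, t) < u x₀ t₀ - ψ (x₀, t₀)) →
    deriv (fun t => ψ (x₀, t)) t₀
      + H x₀ (gradient (fun x => ψ (x, t₀)) x₀) (ψ (x₀, t₀)) ≤ 0) ∧
  ∀ x, u x 0 ≤ φ x

/-- Viscosity supersolutions of `u_t + H(x,Du,u) = 0` in `ℝⁿ × (0,∞)`, `u(·,0) = φ`. -/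
def IsViscositySupersolution (H : Eucl n → Eucl n → ℝ → ℝ) (φ : Eucl n → ℝ)
    (u : Eucl n → ℝ → ℝ) : Prop :=
  (∀ ψ : Eucl n × ℝ → ℝ, ContDiffOn ℝ 1 ψ (univ ×ˢ Ioi 0) →
    ∀ (x₀ : Eucl n) (t₀ : ℝ), 0 < t₀ → u x₀ t₀ = ψ (x₀, t₀) →
    (∀ (x : Eucl n) (t : ℝ), 0 < t → (x, t) ≠ (x₀, t₀) →
      u x₀ t₀ - ψ (x₀, t₀) < u x t - ψ (x, t)) →
    0 ≤ deriv (fun t => ψ (x₀, t)) t₀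
      + H x₀ (gradient (fun x => ψ (x, t₀)) x₀) (ψ (x₀, t₀))) ∧
  ∀ x, φ x ≤ u x 0

/-- Lipschitz viscosity solutions of the Cauchy problem; the Lipschitz constant on
`ℝⁿ × [0,T]` may depend on `T`. -/
structure IsLipViscositySolution (H : Eucl n → Eucl n → ℝ → ℝ) (φ : Eucl n → ℝ)
    (u : Eucl n → ℝ → ℝ) : Prop where
  sub : IsViscositySubsolution H φ u
  super : IsViscositySupersolution H φ u
  lip : ∀ T : ℝ, 0 < T → ∃ K : NNReal,
    LipschitzOnWith K (fun z : Eucl n × ℝ => u z.1 z.2) (univ ×ˢ Icc 0 T)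

/-- The Cauchy problem for `H` has, for every datum in `Lip ∩ BUC`, exactly one Lipschitz
viscosity solution on `ℝⁿ × [0,∞)`. -/
def WellPosed (H : Eucl n → Eucl n → ℝ → ℝ) : Prop :=
  ∀ φ : Eucl n → ℝ, IsLipBUC φ →
    (∃ u, IsLipViscositySolution H φ u) ∧
    ∀ u v, IsLipViscositySolution H φ u → IsLipViscositySolution H φ v →
      ∀ (x : Eucl n) (t : ℝ), 0 ≤ t → u x t = v x t

open Classical in
/-- The Lax–Oleinik semigroup: `S_H(t)[φ](x) = u(x,t)`, where `u` is the Lipschitz viscosity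
solution with initial datum `φ` (and `0` if there is none). -/
def laxOleinik (H : Eucl n → Eucl n → ℝ → ℝ) (t : ℝ) (φ : Eucl n → ℝ) : Eucl n → ℝ :=
  fun x => if h : ∃ u, IsLipViscositySolution H φ u then h.choose x t else 0

end ContactHJ

end

/-! Commutation is proved by showing that each semigroup preserves the subsolutions of the other
equation. If `w` solves the equation for `H`, put `W(·, t) = S_F(σ) w(·, t)`. Once `W` is known to
be a subsolution for `H`, comparison with the solution issued from `W(·, 0) = S_F(σ) φ` gives
`S_F(σ) S_H(t) φ ≤ S_H(t) S_F(σ) φ`. The Jacobi identity is symmetric in the two Hamiltonians, so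
the opposite inequality follows by exchanging roles.

Since the Hamiltonians are only `C¹`, their contact flow need not be well defined, and
characteristics are replaced by a discrete scheme: `step F h` is an inf-convolution whose cost is a
Legendre transform of `F`. The truncation `‖p‖ ≤ h⁻¹` makes the cost a maximum over a compact set;
the term `h / 2 * ‖p‖ ^ 2` makes the maximizing covector unique, hence continuous in the data.
Optimal steps have bounded speed and momentum uniformly in `h` (`exists_schemeBounds`), so values
converge along an ultrafilter of step sizes. The limit is a Lipschitz viscosity solution: the
supersolution property comes from following optimal steps backwards (`schemeLimit_backward`), the
subsolution property from following straight lines forwards (`schemeLimit_forward`). The latter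
yields an inequality for subgradients only, and convexity in `p` upgrades it to the viscosity
inequality (`isLocalSub_of_proxSubgradient`). Uniqueness is a doubling argument (`comparison`) and
identifies the limit with `laxOleinik`.

The Jacobi identity acts at the level of one step. A subgradient `(p, q)` after a step from `y` to
`x` forces `p` to be the maximizing covector, and pulls back exactly to `(p + h D_xF, q) / (1 - h
∂_uF)` at `y` (`subgradient_step`). This is a discrete contact flow, along which the identity says
that `H` after the step equals `(1 - h ∂_uF)` times `H` before it, up to `o(h)`
(`eventually_hamiltonian_step`). The inequality `q + H ≤ 0` therefore survives all iterations with a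
total error that vanishes with `h` (`iterate_subgradient`), and it passes to the limit on proximal
subgradients, which are stable under perturbation of minima (`schemeLimit_param_proxSubgradient`).
-/

namespace ContactHJ

open Filter Topology Metric

/-! ### Derivatives and growth bounds of a contact Hamiltonian. -/

section

variable {n : ℕ}

/-- The linear form `(α, β, γ) ↦ ⟪a, α⟫ + ⟪b, β⟫ + c γ`. -/
noncomputable def jetForm (a b : Eucl n) (c : ℝ) : (Eucl n × Eucl n × ℝ) →L[ℝ] ℝ :=
  (innerSL ℝ a).comp (ContinuousLinearMap.fst ℝ _ _)
    + (innerSL ℝ b).comp ((ContinuousLinearMap.fst ℝ _ _).comp (ContinuousLinearMap.snd ℝ _ _))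
    + c • (ContinuousLinearMap.snd ℝ _ _).comp (ContinuousLinearMap.snd ℝ _ _)

@[simp] lemma jetForm_apply (a b : Eucl n) (c : ℝ) (z : Eucl n × Eucl n × ℝ) :
    jetForm a b c z = inner ℝ a z.1 + inner ℝ b z.2.1 + c * z.2.2 := by
  simp [jetForm]

namespace IsContactHamiltonian

variable {H : Eucl n → Eucl n → ℝ → ℝ}

lemma continuous (hH : IsContactHamiltonian H) :
    Continuous (fun z : Eucl n × Eucl n × ℝ => H z.1 z.2.1 z.2.2) :=
  hH.contDiff.continuous

lemma hasFDerivAt_fderiv (hH : IsContactHamiltonian H) (z : Eucl n × Eucl n × ℝ) :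
    HasFDerivAt (fun z : Eucl n × Eucl n × ℝ => H z.1 z.2.1 z.2.2)
      (fderiv ℝ (fun z : Eucl n × Eucl n × ℝ => H z.1 z.2.1 z.2.2) z) z :=
  ((hH.contDiff.differentiable one_ne_zero) z).hasFDerivAt

lemma hasFDerivAt_x (hH : IsContactHamiltonian H) (x p : Eucl n) (u : ℝ) :
    HasFDerivAt (fun y => H y p u)
      ((fderiv ℝ (fun z : Eucl n × Eucl n × ℝ => H z.1 z.2.1 z.2.2) (x, p, u)).comp
        ((ContinuousLinearMap.id ℝ _).prod 0)) x :=
  HasFDerivAt.comp (f := fun y => (y, p, u)) x (hH.hasFDerivAt_fderiv (x, p, u))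
    ((hasFDerivAt_id x).prodMk (hasFDerivAt_const (p, u) x))

lemma hasFDerivAt_p (hH : IsContactHamiltonian H) (x p : Eucl n) (u : ℝ) :
    HasFDerivAt (fun q => H x q u)
      ((fderiv ℝ (fun z : Eucl n × Eucl n × ℝ => H z.1 z.2.1 z.2.2) (x, p, u)).comp
        ((0 : Eucl n →L[ℝ] Eucl n).prod
          ((ContinuousLinearMap.id ℝ (Eucl n)).prod (0 : Eucl n →L[ℝ] ℝ)))) p :=
  HasFDerivAt.comp (f := fun q => (x, q, u)) p (hH.hasFDerivAt_fderiv (x, p, u))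
    ((hasFDerivAt_const x p).prodMk ((hasFDerivAt_id p).prodMk (hasFDerivAt_const u p)))

lemma hasDerivAt_u' (hH : IsContactHamiltonian H) (x p : Eucl n) (u : ℝ) :
    HasDerivAt (fun v => H x p v)
      (fderiv ℝ (fun z : Eucl n × Eucl n × ℝ => H z.1 z.2.1 z.2.2) (x, p, u) (0, 0, 1)) u :=
  HasFDerivAt.comp_hasDerivAt (f := fun v => (x, p, v)) u (hH.hasFDerivAt_fderiv (x, p, u))
    ((hasDerivAt_const u x).prodMk ((hasDerivAt_const u p).prodMk (hasDerivAt_id u)))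

lemma hasDerivAt_u (hH : IsContactHamiltonian H) (x p : Eucl n) (u : ℝ) :
    HasDerivAt (fun v => H x p v) (derivU H x p u) u :=
  (hH.hasDerivAt_u' x p u).differentiableAt.hasDerivAt

lemma hasGradientAt_p (hH : IsContactHamiltonian H) (x p : Eucl n) (u : ℝ) :
    HasGradientAt (fun q => H x q u) (gradP H x p u) p :=
  (hH.hasFDerivAt_p x p u).differentiableAt.hasGradientAt

/-- The hypotheses and the Jacobi identity speak of partial derivatives, the expansions along a step
need the joint one; this is the dictionary between them. -/
lemma fderiv_eq (hH : IsContactHamiltonian H) (x p : Eucl n) (u : ℝ) :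
    fderiv ℝ (fun z : Eucl n × Eucl n × ℝ => H z.1 z.2.1 z.2.2) (x, p, u)
      = jetForm (gradX H x p u) (gradP H x p u) (derivU H x p u) := by
  set L := fderiv ℝ (fun z : Eucl n × Eucl n × ℝ => H z.1 z.2.1 z.2.2) (x, p, u) with hL
  have hx : ∀ e, inner ℝ (gradX H x p u) e = L (e, 0, 0) := fun e => by
    have h1 := (hH.hasFDerivAt_x x p u).fderiv
    have h2 := (hH.hasFDerivAt_x x p u).differentiableAt.hasGradientAt.hasFDerivAt.fderiv
    rw [h1] at h2
    have h3 := DFunLike.congr_fun h2 e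
    simpa [gradX, hL, ← Prod.zero_eq_mk] using h3.symm
  have hp : ∀ e, inner ℝ (gradP H x p u) e = L (0, e, 0) := fun e => by
    have h1 := (hH.hasFDerivAt_p x p u).fderiv
    have h2 := (hH.hasGradientAt_p x p u).hasFDerivAt.fderiv
    rw [h1] at h2
    have h3 := DFunLike.congr_fun h2 e
    simpa [gradP] using h3.symm
  have hu : derivU H x p u = L (0, 0, 1) := (hH.hasDerivAt_u x p u).unique (hH.hasDerivAt_u' x p u)
  refine ContinuousLinearMap.ext fun z => ?_
  rw [jetForm_apply, hx, hp, hu]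
  have : z = (z.1, 0, 0) + (0, z.2.1, 0) + z.2.2 • ((0, 0, 1) : Eucl n × Eucl n × ℝ) := by
    ext <;> simp
  conv_lhs => rw [this]
  rw [map_add, map_add, map_smul, smul_eq_mul, mul_comm]

lemma hasStrictFDerivAt (hH : IsContactHamiltonian H) (x p : Eucl n) (u : ℝ) :
    HasStrictFDerivAt (fun z : Eucl n × Eucl n × ℝ => H z.1 z.2.1 z.2.2)
      (jetForm (gradX H x p u) (gradP H x p u) (derivU H x p u)) (x, p, u) := by
  rw [← hH.fderiv_eq]
  exact hH.contDiff.contDiffAt.hasStrictFDerivAt one_ne_zero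

lemma continuous_fderiv (hH : IsContactHamiltonian H) :
    Continuous (fderiv ℝ (fun z : Eucl n × Eucl n × ℝ => H z.1 z.2.1 z.2.2)) :=
  hH.contDiff.continuous_fderiv one_ne_zero

lemma continuous_derivU (hH : IsContactHamiltonian H) :
    Continuous (fun z : Eucl n × Eucl n × ℝ => derivU H z.1 z.2.1 z.2.2) := by
  have : (fun z : Eucl n × Eucl n × ℝ => derivU H z.1 z.2.1 z.2.2) = fun z =>
      fderiv ℝ (fun z : Eucl n × Eucl n × ℝ => H z.1 z.2.1 z.2.2) z (0, 0, 1) := by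
    ext ⟨x, p, u⟩
    rw [hH.fderiv_eq]
    simp
  rw [this]
  exact hH.continuous_fderiv.clm_apply continuous_const

lemma continuous_gradX (hH : IsContactHamiltonian H) :
    Continuous (fun z : Eucl n × Eucl n × ℝ => gradX H z.1 z.2.1 z.2.2) := by
  have : (fun z : Eucl n × Eucl n × ℝ => gradX H z.1 z.2.1 z.2.2) = fun z =>
      (InnerProductSpace.toDual ℝ (Eucl n)).symm
        ((fderiv ℝ (fun z : Eucl n × Eucl n × ℝ => H z.1 z.2.1 z.2.2) z).comp
          (ContinuousLinearMap.inl ℝ _ _)) := by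
    ext1 ⟨x, p, u⟩
    rw [hH.fderiv_eq, LinearIsometryEquiv.eq_symm_apply]
    ext e
    simp
  rw [this]
  exact (LinearIsometryEquiv.continuous _).comp (hH.continuous_fderiv.clm_comp continuous_const)

lemma continuous_gradP (hH : IsContactHamiltonian H) :
    Continuous (fun z : Eucl n × Eucl n × ℝ => gradP H z.1 z.2.1 z.2.2) := by
  have : (fun z : Eucl n × Eucl n × ℝ => gradP H z.1 z.2.1 z.2.2) = fun z =>
      (InnerProductSpace.toDual ℝ (Eucl n)).symm
        ((fderiv ℝ (fun z : Eucl n × Eucl n × ℝ => H z.1 z.2.1 z.2.2) z).comp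
          ((ContinuousLinearMap.inr ℝ _ _).comp (ContinuousLinearMap.inl ℝ _ _))) := by
    ext1 ⟨x, p, u⟩
    rw [hH.fderiv_eq, LinearIsometryEquiv.eq_symm_apply]
    ext e
    simp
  rw [this]
  exact (LinearIsometryEquiv.continuous _).comp (hH.continuous_fderiv.clm_comp continuous_const)

lemma exists_lipschitz_u (hH : IsContactHamiltonian H) :
    ∃ C : ℝ, 0 < C ∧ ∀ (x p : Eucl n) (u v : ℝ), |H x p u - H x p v| ≤ C * |u - v| := by
  obtain ⟨C, hC, h⟩ := hH.lipU
  refine ⟨C, hC, fun x p u v => ?_⟩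
  have := Convex.norm_image_sub_le_of_norm_hasDerivWithin_le (f := fun v => H x p v)
    (f' := fun v => derivU H x p v) (C := C) (s := univ) (x := v) (y := u)
    (fun w _ => (hH.hasDerivAt_u x p w).hasDerivWithinAt)
    (fun w _ => h x p w) convex_univ (mem_univ _) (mem_univ _)
  simpa [Real.norm_eq_abs] using this

lemma exists_bound (hH : IsContactHamiltonian H) (r : ℝ) :
    ∃ M : ℝ, 0 < M ∧ ∀ (x p : Eucl n) (u : ℝ), ‖p‖ ≤ r → |H x p u| ≤ M := by
  obtain ⟨M, hM, h⟩ := hH.bounds (|r| + 1) (by positivity)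
  exact ⟨M, hM, fun x p u hp => (h x p u (by linarith [le_abs_self r])).1⟩

/-- Superlinearity handles large `p` and boundedness handles the rest. The freedom in the slope `a`
is what later beats any fixed speed. -/
lemma exists_linear_lower (hH : IsContactHamiltonian H) (a : ℝ) :
    ∃ B : ℝ, 0 < B ∧ ∀ (x p : Eucl n) (u : ℝ), a * ‖p‖ - B ≤ H x p u := by
  obtain ⟨R, hR, h⟩ := hH.superlinear a
  obtain ⟨M, hM, hb⟩ := hH.exists_bound R
  refine ⟨M + |a| * R, by positivity, fun x p u => ?_⟩
  rcases le_or_gt ‖p‖ R with hp | hp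
  · have h1 := (abs_le.1 (hb x p u hp)).1
    have h2 : a * ‖p‖ ≤ |a| * R :=
      (mul_le_mul_of_nonneg_right (le_abs_self a) (norm_nonneg p)).trans
        (mul_le_mul_of_nonneg_left hp (abs_nonneg a))
    linarith
  · have hp0 : 0 < ‖p‖ := hR.trans hp
    have := (le_div_iff₀ hp0).1 (h x p u hp)
    have h3 : 0 ≤ |a| * R := by positivity
    linarith

lemma exists_lipschitz_p (hH : IsContactHamiltonian H) (r : ℝ) :
    ∃ K : ℝ, 0 < K ∧ ∀ (x p q : Eucl n) (u : ℝ), ‖p‖ ≤ r → ‖q‖ ≤ r →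
      |H x p u - H x q u| ≤ K * (1 + ‖x‖) * ‖p - q‖ := by
  obtain ⟨K, hK, h⟩ := hH.bounds (|r| + 1) (by positivity)
  refine ⟨K, hK, fun x p q u hp hq => ?_⟩
  have hr := le_abs_self r
  refine Convex.norm_image_sub_le_of_norm_hasFDerivWithin_le (f := fun v => H x v u)
    (f' := fun v => (InnerProductSpace.toDual ℝ (Eucl n)) (gradP H x v u)) (C := K * (1 + ‖x‖))
    (s := ball 0 (|r| + 1)) (x := q) (y := p)
    (fun w _ => (hH.hasGradientAt_p x w u).hasFDerivAt.hasFDerivWithinAt)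
    (fun w hw => ?_) (convex_ball _ _) (by simp; linarith) (by simp; linarith)
  rw [LinearIsometryEquiv.norm_map]
  exact (h x w u (by simpa using hw)).2

/-- A convex function lies above its tangent. Consequently `p` attains the Legendre transform at the
velocity `gradP H x p u`, which is how it is used. -/
lemma gradient_inequality (hH : IsContactHamiltonian H) (x p q : Eucl n) (u : ℝ) :
    H x p u + inner ℝ (gradP H x p u) (q - p) ≤ H x q u := by
  have hd : HasDerivAt (fun s : ℝ => H x (p + s • (q - p)) u)
      (inner ℝ (gradP H x p u) (q - p)) 0 := by
    have h0 : HasDerivAt (fun s : ℝ => p + s • (q - p)) (q - p) 0 := by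
      simpa using ((hasDerivAt_id (0 : ℝ)).smul_const (q - p)).const_add p
    have h1 : HasFDerivAt (fun q => H x q u)
        ((InnerProductSpace.toDual ℝ (Eucl n)) (gradP H x p u)) (p + (0 : ℝ) • (q - p)) := by
      simpa using (hH.hasGradientAt_p x p u).hasFDerivAt
    have h2 := h1.comp_hasDerivAt (0 : ℝ) h0
    rw [InnerProductSpace.toDual_apply_apply] at h2
    exact h2
  have hc : ConvexOn ℝ univ (fun s : ℝ => H x (p + s • (q - p)) u) := by
    have := (hH.convex x u).comp_affineMap (AffineMap.lineMap p q)
    rw [preimage_univ] at this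
    refine this.congr fun s _ => ?_
    simp [AffineMap.lineMap_apply, add_comm]
  have := hc.deriv_le_slope (x := 0) (y := 1) (mem_univ _) (mem_univ _) one_pos
    hd.differentiableAt
  rw [hd.deriv, slope_def_field] at this
  simp at this
  linarith

end IsContactHamiltonian

end

/-! ### One step of the discrete scheme. -/

section

variable {n : ℕ} {F : Eucl n → Eucl n → ℝ → ℝ}

/-- The regularized action of the covector `p` for a step of duration `h` from `y` to `x`. -/
noncomputable def stepAction (F : Eucl n → Eucl n → ℝ → ℝ) (h : ℝ) (x y : Eucl n) (u : ℝ)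
    (p : Eucl n) : ℝ :=
  inner ℝ p (x - y) - h * (F y p u + h / 2 * ‖p‖ ^ 2)

/-- The cost of a step of duration `h` from `y` to `x`: a truncated and regularized Legendre
transform of `F`. -/
noncomputable def stepCost (F : Eucl n → Eucl n → ℝ → ℝ) (h : ℝ) (x y : Eucl n) (u : ℝ) : ℝ :=
  sSup (stepAction F h x y u '' closedBall 0 h⁻¹)

/-- One step of duration `h` of the discrete Lax–Oleinik scheme. -/
noncomputable def step (F : Eucl n → Eucl n → ℝ → ℝ) (h : ℝ) (φ : Eucl n → ℝ) (x : Eucl n) : ℝ :=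
  ⨅ y, φ y + stepCost F h x y (φ y)

/-- The covector `p` realizes the cost of the step from `y` to `x`. -/
def IsCostMaximizer (F : Eucl n → Eucl n → ℝ → ℝ) (h : ℝ) (x y : Eucl n) (u : ℝ)
    (p : Eucl n) : Prop :=
  ‖p‖ ≤ h⁻¹ ∧ ∀ q : Eucl n, ‖q‖ ≤ h⁻¹ → stepAction F h x y u q ≤ stepAction F h x y u p

/-- The point `y` is optimal for the value at `x` of one step of the scheme. -/
def IsStepMinimizer (F : Eucl n → Eucl n → ℝ → ℝ) (h : ℝ) (φ : Eucl n → ℝ) (x y : Eucl n) :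
    Prop :=
  step F h φ x = φ y + stepCost F h x y (φ y)

/-- Bounded continuous functions. -/
def BddCont (φ : Eucl n → ℝ) : Prop := Continuous φ ∧ ∃ B : ℝ, ∀ x, |φ x| ≤ B

lemma continuous_stepAction (hF : IsContactHamiltonian F) (h : ℝ) :
    Continuous (fun z : (Eucl n × Eucl n × ℝ) × Eucl n =>
      stepAction F h z.1.1 z.1.2.1 z.1.2.2 z.2) := by
  have h1 : Continuous (fun z : (Eucl n × Eucl n × ℝ) × Eucl n => F z.1.2.1 z.2 z.1.2.2) :=
    hF.continuous.comp (by fun_prop :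
      Continuous (fun z : (Eucl n × Eucl n × ℝ) × Eucl n => (z.1.2.1, z.2, z.1.2.2)))
  unfold stepAction
  refine Continuous.sub (Continuous.inner (by fun_prop) (by fun_prop)) ?_
  exact continuous_const.mul (h1.add (by fun_prop))

lemma exists_costMaximizer (hF : IsContactHamiltonian F) {h : ℝ} (hh : 0 < h) (x y : Eucl n)
    (u : ℝ) : ∃ p, IsCostMaximizer F h x y u p := by
  have hc : Continuous (stepAction F h x y u) :=
    (continuous_stepAction hF h).comp (by fun_prop : Continuous fun p => ((x, y, u), p))
  obtain ⟨p, hp, hmax⟩ := (isCompact_closedBall (0 : Eucl n) h⁻¹).exists_isMaxOn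
    (nonempty_closedBall.2 (by positivity)) hc.continuousOn
  exact ⟨p, by simpa using hp, fun q hq => hmax (by simpa using hq)⟩

lemma IsCostMaximizer.stepCost_eq {h : ℝ} {x y : Eucl n} {u : ℝ} {p : Eucl n}
    (hp : IsCostMaximizer F h x y u p) : stepCost F h x y u = stepAction F h x y u p := by
  refine IsGreatest.csSup_eq ⟨mem_image_of_mem _ (by simpa using hp.1), ?_⟩
  rintro _ ⟨q, hq, rfl⟩
  exact hp.2 q (by simpa using hq)

lemma stepAction_le_stepCost (hF : IsContactHamiltonian F) {h : ℝ} (hh : 0 < h) (x y : Eucl n)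
    (u : ℝ) {p : Eucl n} (hp : ‖p‖ ≤ h⁻¹) : stepAction F h x y u p ≤ stepCost F h x y u := by
  obtain ⟨q, hq⟩ := exists_costMaximizer hF hh x y u
  exact hq.stepCost_eq ▸ hq.2 p hp

lemma stepCost_le (hF : IsContactHamiltonian F) {h : ℝ} (hh : 0 < h) {x y : Eucl n}
    {u c : ℝ} (hc : ∀ p : Eucl n, ‖p‖ ≤ h⁻¹ → stepAction F h x y u p ≤ c) :
    stepCost F h x y u ≤ c := by
  obtain ⟨q, hq⟩ := exists_costMaximizer hF hh x y u
  exact hq.stepCost_eq ▸ hc q hq.1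

lemma continuous_stepCost (hF : IsContactHamiltonian F) (h : ℝ) :
    Continuous (fun z : Eucl n × Eucl n × ℝ => stepCost F h z.1 z.2.1 z.2.2) :=
  (isCompact_closedBall (0 : Eucl n) h⁻¹).continuous_sSup
    (f := fun z : Eucl n × Eucl n × ℝ => stepAction F h z.1 z.2.1 z.2.2)
    (continuous_stepAction hF h)

lemma stepCost_lipschitz_u (hF : IsContactHamiltonian F) {h C : ℝ} (hh : 0 < h)
    (hC : ∀ (x p : Eucl n) (u v : ℝ), |F x p u - F x p v| ≤ C * |u - v|) (x y : Eucl n)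
    (u v : ℝ) : |stepCost F h x y u - stepCost F h x y v| ≤ h * C * |u - v| := by
  have key : ∀ u v, stepCost F h x y u ≤ stepCost F h x y v + h * C * |u - v| := fun u v => by
    refine stepCost_le hF hh fun p hp => ?_
    have h1 := stepAction_le_stepCost hF hh x y v hp
    have h2 := mul_le_mul_of_nonneg_left (abs_le.1 (hC y p u v)).1 hh.le
    simp only [stepAction] at h1 ⊢
    linarith
  rw [abs_le]
  constructor
  · have := key v u
    rw [abs_sub_comm] at this
    linarith
  · linarith [key u v]

lemma stepCost_lipschitz_x (hF : IsContactHamiltonian F) {h : ℝ} (hh : 0 < h) (x x' y : Eucl n)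
    (u : ℝ) : stepCost F h x y u ≤ stepCost F h x' y u + h⁻¹ * ‖x - x'‖ := by
  refine stepCost_le hF hh fun p hp => ?_
  have h1 := stepAction_le_stepCost hF hh x' y u hp
  have h2 : inner ℝ p (x - y) = inner ℝ p (x' - y) + inner ℝ p (x - x') := by
    rw [← inner_add_right]; congr 1; abel
  have h3 := (real_inner_le_norm p (x - x')).trans
    (mul_le_mul_of_nonneg_right hp (norm_nonneg (x - x')))
  simp only [stepAction] at h1 ⊢
  linarith

/-- Testing the supremum with the covector of length `r` along `x - y`. Long jumps are thus
expensive, at any rate `r` admitted by the truncation. -/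
lemma le_stepCost (hF : IsContactHamiltonian F) {h r M : ℝ} (hh : 0 < h) (hh1 : h ≤ 1)
    (hr : 0 ≤ r) (hrh : r ≤ h⁻¹) (hM : ∀ (x p : Eucl n) (u : ℝ), ‖p‖ ≤ r → |F x p u| ≤ M)
    (x y : Eucl n) (u : ℝ) : r * ‖x - y‖ - h * (M + r ^ 2) ≤ stepCost F h x y u := by
  have key : ∀ p : Eucl n, ‖p‖ ≤ r → inner ℝ p (x - y) = r * ‖x - y‖ →
      r * ‖x - y‖ - h * (M + r ^ 2) ≤ stepCost F h x y u := fun p hp hpi => by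
    refine le_trans ?_ (stepAction_le_stepCost hF hh x y u (hp.trans hrh))
    rw [stepAction, hpi]
    have h1 := (abs_le.1 (hM y p u hp)).2
    have h2 : ‖p‖ ^ 2 ≤ r ^ 2 := pow_le_pow_left₀ (norm_nonneg p) hp 2
    have h3 : h / 2 * ‖p‖ ^ 2 ≤ r ^ 2 := by nlinarith [sq_nonneg ‖p‖]
    have := mul_le_mul_of_nonneg_left (add_le_add h1 h3) hh.le
    linarith
  by_cases hxy : x - y = 0
  · exact key 0 (by simpa using hr) (by simp [hxy])
  · have hpos : 0 < ‖x - y‖ := norm_pos_iff.2 hxy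
    refine key ((r / ‖x - y‖) • (x - y)) ?_ ?_
    · rw [norm_smul, Real.norm_eq_abs, abs_of_nonneg (by positivity)]
      field_simp
      exact le_rfl
    · rw [real_inner_smul_left, real_inner_self_eq_norm_sq]
      field_simp

/-- A jump of speed at most `a` gains at most `h * a * ‖p‖` from the pairing, and the lower bound of
slope `a` for `F` absorbs it; so such jumps cost `O(h)`. -/
lemma stepCost_le_of_norm_le (hF : IsContactHamiltonian F) {h a B : ℝ} (hh : 0 < h)
    (hB : ∀ (x p : Eucl n) (u : ℝ), a * ‖p‖ - B ≤ F x p u) {x y : Eucl n} (u : ℝ)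
    (hxy : ‖x - y‖ ≤ h * a) : stepCost F h x y u ≤ h * B := by
  refine stepCost_le hF hh fun p _ => ?_
  have h1 := (real_inner_le_norm p (x - y)).trans
    (mul_le_mul_of_nonneg_left hxy (norm_nonneg p))
  have h2 := mul_le_mul_of_nonneg_left (hB y p u) hh.le
  have h3 : 0 ≤ h * (h / 2 * ‖p‖ ^ 2) := by positivity
  rw [stepAction]
  linarith

lemma tendsto_cocompact_add_stepCost (hF : IsContactHamiltonian F) {h : ℝ} (hh : 0 < h)
    (hh1 : h ≤ 1) {φ : Eucl n → ℝ} (hφ : BddCont φ) (x : Eucl n) :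
    Tendsto (fun y => φ y + stepCost F h x y (φ y)) (cocompact (Eucl n)) atTop := by
  obtain ⟨B, hB⟩ := hφ.2
  obtain ⟨M, -, hM⟩ := hF.exists_bound 1
  have h1 : 1 ≤ h⁻¹ := (one_le_inv₀ hh).2 hh1
  have h2 : Tendsto (fun y : Eucl n => ‖y‖ + (-‖x‖ - B - h * (M + 1 ^ 2)))
      (cocompact (Eucl n)) atTop :=
    tendsto_atTop_add_const_right _ _ (tendsto_norm_cocompact_atTop (E := Eucl n))
  refine tendsto_atTop_mono (fun y => ?_) h2
  have h3 := norm_sub_norm_le y x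
  rw [norm_sub_rev] at h3
  have h4 := le_stepCost hF hh hh1 zero_le_one h1 hM x y (φ y)
  have h5 := (abs_le.1 (hB y)).1
  linarith

lemma continuous_add_stepCost (hF : IsContactHamiltonian F) (h : ℝ) {φ : Eucl n → ℝ}
    (hφ : Continuous φ) (x : Eucl n) : Continuous (fun y => φ y + stepCost F h x y (φ y)) := by
  have h1 : Continuous fun y : Eucl n => (x, y, φ y) :=
    continuous_const.prodMk (continuous_id.prodMk hφ)
  have h2 := (continuous_stepCost hF h).comp h1
  simp only [Function.comp_def] at h2
  exact Continuous.add hφ h2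

lemma exists_stepMinimizer (hF : IsContactHamiltonian F) {h : ℝ} (hh : 0 < h) (hh1 : h ≤ 1)
    {φ : Eucl n → ℝ} (hφ : BddCont φ) (x : Eucl n) :
    ∃ y, IsStepMinimizer F h φ x y ∧
      ∀ z, φ y + stepCost F h x y (φ y) ≤ φ z + stepCost F h x z (φ z) := by
  obtain ⟨y, hy⟩ := (continuous_add_stepCost hF h hφ.1 x).exists_forall_le
    (tendsto_cocompact_add_stepCost hF hh hh1 hφ x)
  have hbdd : BddBelow (range fun z => φ z + stepCost F h x z (φ z)) :=
    ⟨φ y + stepCost F h x y (φ y), by rintro _ ⟨z, rfl⟩; exact hy z⟩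
  exact ⟨y, le_antisymm (ciInf_le hbdd y) (le_ciInf hy), hy⟩

lemma step_le (hF : IsContactHamiltonian F) {h : ℝ} (hh : 0 < h) (hh1 : h ≤ 1)
    {φ : Eucl n → ℝ} (hφ : BddCont φ) (x y : Eucl n) :
    step F h φ x ≤ φ y + stepCost F h x y (φ y) := by
  obtain ⟨z, hz, hmin⟩ := exists_stepMinimizer hF hh hh1 hφ x
  exact hz ▸ hmin y

lemma step_lipschitz (hF : IsContactHamiltonian F) {h : ℝ} (hh : 0 < h) (hh1 : h ≤ 1)
    {φ : Eucl n → ℝ} (hφ : BddCont φ) (x x' : Eucl n) :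
    |step F h φ x - step F h φ x'| ≤ h⁻¹ * ‖x - x'‖ := by
  have key : ∀ x x', step F h φ x ≤ step F h φ x' + h⁻¹ * ‖x - x'‖ := fun x x' => by
    obtain ⟨z, hz, -⟩ := exists_stepMinimizer hF hh hh1 hφ x'
    have h1 := step_le hF hh hh1 hφ x z
    have h2 := stepCost_lipschitz_x hF hh x x' z (φ z)
    rw [IsStepMinimizer] at hz
    linarith
  rw [abs_le]
  constructor
  · have := key x' x
    rw [norm_sub_rev] at this
    linarith
  · linarith [key x x']

lemma step_bddCont (hF : IsContactHamiltonian F) {h : ℝ} (hh : 0 < h) (hh1 : h ≤ 1)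
    {φ : Eucl n → ℝ} (hφ : BddCont φ) : BddCont (step F h φ) := by
  obtain ⟨B₀, -, hB₀⟩ := hF.exists_linear_lower 0
  obtain ⟨M, -, hM⟩ := hF.exists_bound 0
  obtain ⟨B, hB⟩ := hφ.2
  constructor
  · refine (LipschitzWith.of_dist_le_mul (K := ⟨h⁻¹, by positivity⟩) fun x y => ?_).continuous
    rw [Real.dist_eq, dist_eq_norm]
    exact step_lipschitz hF hh hh1 hφ x y
  · refine ⟨B + h * (|B₀| + |M|), fun x => abs_le.2 ⟨?_, ?_⟩⟩
    · obtain ⟨y, hy, -⟩ := exists_stepMinimizer hF hh hh1 hφ x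
      have h1 := le_stepCost hF hh hh1 le_rfl (by positivity) hM x y (φ y)
      have h2 := (abs_le.1 (hB y)).1
      have h3 : h * M ≤ h * (|B₀| + |M|) :=
        mul_le_mul_of_nonneg_left (by linarith [le_abs_self M, abs_nonneg B₀]) hh.le
      rw [IsStepMinimizer] at hy
      rw [hy]
      nlinarith
    · have h1 := step_le hF hh hh1 hφ x x
      have h2 := stepCost_le_of_norm_le hF hh hB₀ (φ x) (x := x) (y := x) (by simp)
      have h3 : h * B₀ ≤ h * (|B₀| + |M|) :=
        mul_le_mul_of_nonneg_left (by linarith [le_abs_self B₀, abs_nonneg M]) hh.le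
      linarith [(abs_le.1 (hB x)).2]

/-- The minimizer for one datum competes for the other. The dependence of the cost on `u` spoils
exact nonexpansiveness by the factor `1 + h * C`, whose powers stay below an exponential of the
elapsed time. -/
lemma step_nonexpansive (hF : IsContactHamiltonian F) {h C : ℝ} (hh : 0 < h) (hh1 : h ≤ 1)
    (hC : ∀ (x p : Eucl n) (u v : ℝ), |F x p u - F x p v| ≤ C * |u - v|) (hC0 : 0 ≤ C)
    {φ ψ : Eucl n → ℝ} (hφ : BddCont φ) (hψ : BddCont ψ) {D : ℝ}
    (hD : ∀ x, |φ x - ψ x| ≤ D) (x : Eucl n) :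
    |step F h φ x - step F h ψ x| ≤ (1 + h * C) * D := by
  have key : ∀ {φ ψ : Eucl n → ℝ}, BddCont φ → BddCont ψ → (∀ x, |φ x - ψ x| ≤ D) →
      step F h φ x ≤ step F h ψ x + (1 + h * C) * D := fun {φ ψ} hφ hψ hD => by
    obtain ⟨z, hz, -⟩ := exists_stepMinimizer hF hh hh1 hψ x
    have h1 := step_le hF hh hh1 hφ x z
    have h2 := (abs_le.1 (stepCost_lipschitz_u hF hh hC x z (φ z) (ψ z))).2
    have h3 := mul_le_mul_of_nonneg_left (hD z) (mul_nonneg hh.le hC0)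
    have h4 := (abs_le.1 (hD z)).2
    rw [IsStepMinimizer] at hz
    linarith
  rw [abs_le]
  constructor
  · linarith [key hψ hφ (fun x => by rw [abs_sub_comm]; exact hD x)]
  · linarith [key hφ hψ hD]

lemma iterate_step_bddCont (hF : IsContactHamiltonian F) {h : ℝ} (hh : 0 < h) (hh1 : h ≤ 1)
    {φ : Eucl n → ℝ} (hφ : BddCont φ) (k : ℕ) : BddCont ((step F h)^[k] φ) := by
  induction k with
  | zero => exact hφ
  | succ k ih =>
    rw [Function.iterate_succ_apply']
    exact step_bddCont hF hh hh1 ih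

lemma iterate_step_nonexpansive (hF : IsContactHamiltonian F) {h C : ℝ} (hh : 0 < h)
    (hh1 : h ≤ 1) (hC : ∀ (x p : Eucl n) (u v : ℝ), |F x p u - F x p v| ≤ C * |u - v|)
    (hC0 : 0 ≤ C) {φ ψ : Eucl n → ℝ} (hφ : BddCont φ) (hψ : BddCont ψ) {D : ℝ} (hD0 : 0 ≤ D)
    (hD : ∀ x, |φ x - ψ x| ≤ D) (k : ℕ) (x : Eucl n) :
    |(step F h)^[k] φ x - (step F h)^[k] ψ x| ≤ Real.exp (C * (k * h)) * D := by
  induction k generalizing x with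
  | zero => simpa using hD x
  | succ k ih =>
    rw [Function.iterate_succ_apply', Function.iterate_succ_apply']
    refine (step_nonexpansive hF hh hh1 hC hC0 (iterate_step_bddCont hF hh hh1 hφ k)
      (iterate_step_bddCont hF hh hh1 hψ k) ih x).trans ?_
    have h1 : 1 + h * C ≤ Real.exp (h * C) := by linarith [Real.add_one_le_exp (h * C)]
    have h2 : Real.exp (C * ((k + 1 : ℕ) * h)) = Real.exp (h * C) * Real.exp (C * (k * h)) := by
      rw [← Real.exp_add]; push_cast; ring_nf
    rw [h2, mul_assoc]
    exact mul_le_mul_of_nonneg_right h1 (by positivity)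

end

/-! ### Bounds on the scheme that are uniform in the step size. -/

section

variable {n : ℕ} {F : Eucl n → Eucl n → ℝ → ℝ}

/-- Bounds, with a constant `c` not depending on the step `h`, on the `k`-th iterate of the
scheme. -/
structure SchemeBounds (F : Eucl n → Eucl n → ℝ → ℝ) (h c : ℝ) (φ : Eucl n → ℝ) (k : ℕ) :
    Prop where
  time : ∀ x, |(step F h)^[k + 1] φ x - (step F h)^[k] φ x| ≤ c * h
  space : ∀ x y, |(step F h)^[k] φ x - (step F h)^[k] φ y| ≤ c * (‖x - y‖ + h)
  speed : ∀ x y, IsStepMinimizer F h ((step F h)^[k] φ) x y → ‖x - y‖ ≤ c * h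
  momentum : ∀ x y p, IsStepMinimizer F h ((step F h)^[k] φ) x y →
    IsCostMaximizer F h x y ((step F h)^[k] φ y) p → ‖p‖ ≤ c

/-- A function whose oscillation at scale `h` is at most `c h` is `c`-Lipschitz up to an error
`c h`. -/
lemma sub_le_of_sub_le_at_scale {f : Eucl n → ℝ} {h c : ℝ} (hh : 0 < h) (hc : 0 ≤ c)
    (hf : ∀ x y, ‖x - y‖ ≤ h → f x - f y ≤ c * h) (x y : Eucl n) :
    f x - f y ≤ c * (‖x - y‖ + h) := by
  have key : ∀ N : ℕ, ∀ x y : Eucl n, ‖x - y‖ ≤ (N + 1) * h → f x - f y ≤ c * ((N + 1) * h) := by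
    intro N
    induction N with
    | zero => intro x y hxy; simpa using hf x y (by simpa using hxy)
    | succ N ih =>
      intro x y hxy
      push_cast at hxy ⊢
      have hN : (0 : ℝ) < N + 1 + 1 := by positivity
      set z := y + ((N + 1 : ℝ) / (N + 1 + 1)) • (x - y) with hz
      have h1 : ‖x - z‖ ≤ h := by
        have : x - z = (1 / (N + 1 + 1 : ℝ)) • (x - y) := by
          have h0 : (1 / (N + 1 + 1 : ℝ)) = 1 - (N + 1 : ℝ) / (N + 1 + 1) := by field_simp; ring
          rw [h0, sub_smul, one_smul, hz]; abel
        rw [this, norm_smul, Real.norm_eq_abs, abs_of_pos (by positivity), div_mul_eq_mul_div,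
          one_mul, div_le_iff₀ hN]
        linarith
      have h2 : ‖z - y‖ ≤ (N + 1) * h := by
        have : z - y = ((N + 1 : ℝ) / (N + 1 + 1)) • (x - y) := by rw [hz]; abel
        rw [this, norm_smul, Real.norm_eq_abs, abs_of_pos (by positivity), div_mul_eq_mul_div,
          div_le_iff₀ hN]
        have := mul_le_mul_of_nonneg_left hxy (by positivity : (0 : ℝ) ≤ N + 1)
        linarith
      have := hf x z h1
      have := ih z y h2
      linarith
  have h1 := key ⌊‖x - y‖ / h⌋₊ x y (by
    have := (Nat.lt_floor_add_one (‖x - y‖ / h)).le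
    rwa [div_le_iff₀ hh] at this)
  refine h1.trans (mul_le_mul_of_nonneg_left ?_ hc)
  have := Nat.floor_le (a := ‖x - y‖ / h) (by positivity)
  rw [le_div_iff₀ hh] at this
  linarith

/-- Standing still costs `O(h)`, which bounds the step above; charging jumps at rate `K` cancels
what a `K`-Lipschitz datum could gain by moving, which bounds it below. -/
lemma step_sub_le (hF : IsContactHamiltonian F) {K : ℝ} (hK : 0 ≤ K) :
    ∃ c : ℝ, 0 < c ∧ ∀ h : ℝ, 0 < h → h ≤ 1 → K ≤ h⁻¹ → ∀ φ : Eucl n → ℝ, BddCont φ →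
      (∀ x y, |φ x - φ y| ≤ K * ‖x - y‖) → ∀ x, |step F h φ x - φ x| ≤ c * h := by
  obtain ⟨M, hM0, hM⟩ := hF.exists_bound K
  obtain ⟨B, hB0, hB⟩ := hF.exists_linear_lower 0
  refine ⟨M + K ^ 2 + B, by positivity, fun h hh hh1 hKh φ hφ hlip x => ?_⟩
  obtain ⟨y, hy, -⟩ := exists_stepMinimizer hF hh hh1 hφ x
  have h1 := step_le hF hh hh1 hφ x x
  have h2 := stepCost_le_of_norm_le hF hh hB (φ x) (x := x) (y := x) (by simp)
  have h3 := le_stepCost hF hh hh1 hK hKh hM x y (φ y)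
  have h4 := (abs_le.1 (hlip x y)).2
  have h5 : 0 ≤ h * (M + K ^ 2) := by positivity
  have h6 : 0 ≤ h * B := by positivity
  rw [IsStepMinimizer] at hy
  rw [abs_le]
  constructor <;> linarith

/-- The four bounds are obtained in a chain. Control of one time step gives the time bound; time
bound and cheap jumps of unit speed give the space bound; a cost rate exceeding the space constant
gives the speed bound; superlinearity of `F` at a slope exceeding the speed gives the momentum
bound. -/
theorem exists_schemeBounds (hF : IsContactHamiltonian F) (K T : ℝ) :
    ∃ c h₀ : ℝ, 0 < c ∧ 0 < h₀ ∧ h₀ ≤ 1 ∧ ∀ h : ℝ, 0 < h → h ≤ h₀ → ∀ φ : Eucl n → ℝ,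
      BddCont φ → (∀ x y, |φ x - φ y| ≤ K * ‖x - y‖) → ∀ k : ℕ, k * h ≤ T →
        SchemeBounds F h c φ k := by
  obtain ⟨C, hC0, hC⟩ := hF.exists_lipschitz_u
  obtain ⟨c₁, hc₁, hstep⟩ := step_sub_le hF (abs_nonneg K)
  set C₁ := Real.exp (C * T) * c₁ with hC₁
  have hC₁0 : 0 < C₁ := by positivity
  obtain ⟨B₁, hB₁0, hB₁⟩ := hF.exists_linear_lower 1
  set C₂ := B₁ + C₁ with hC₂
  have hC₂0 : 0 < C₂ := by positivity
  obtain ⟨M₂, hM₂0, hM₂⟩ := hF.exists_bound (C₂ + 1)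
  set V := C₁ + C₂ + M₂ + (C₂ + 1) ^ 2 with hV
  have hV0 : 0 < V := by positivity
  obtain ⟨M₀, hM₀0, hM₀⟩ := hF.exists_bound 0
  obtain ⟨B₃, hB₃0, hB₃⟩ := hF.exists_linear_lower (V + 1)
  -- For such small `h` the test momenta of length `|K|` and `C₂ + 1` used below fall inside the
  -- truncation ball.
  refine ⟨C₁ + C₂ + V + (M₀ + B₃), (max 1 (|K| + C₂ + 1))⁻¹, by positivity, by positivity,
    inv_le_one_of_one_le₀ (le_max_left _ _), fun h hh hh₀ φ hφ hlip k hk => ?_⟩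
  have hinv : max 1 (|K| + C₂ + 1) ≤ h⁻¹ := by
    rw [le_inv_comm₀ (by positivity) hh]; exact hh₀
  have hh1 : h ≤ 1 := hh₀.trans (inv_le_one_of_one_le₀ (le_max_left _ _))
  have hKh : |K| ≤ h⁻¹ := le_trans (by linarith) ((le_max_right _ _).trans hinv)
  have hC₂h : C₂ + 1 ≤ h⁻¹ :=
    le_trans (by linarith [abs_nonneg K]) ((le_max_right _ _).trans hinv)
  have hlip' : ∀ x y, |φ x - φ y| ≤ |K| * ‖x - y‖ := fun x y =>
    (hlip x y).trans (mul_le_mul_of_nonneg_right (le_abs_self K) (norm_nonneg _))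
  have hbc := iterate_step_bddCont hF hh hh1 hφ k
  have htime : ∀ x, |(step F h)^[k + 1] φ x - (step F h)^[k] φ x| ≤ C₁ * h := fun x => by
    -- Consecutive iterates are the same number of iterations applied to `step F h φ` and to `φ`, so
    -- the time increment at the initial instant propagates.
    rw [Function.iterate_succ_apply]
    refine (iterate_step_nonexpansive hF hh hh1 hC hC0.le (step_bddCont hF hh hh1 hφ) hφ
      (by positivity) (hstep h hh hh1 hKh φ hφ hlip') k x).trans ?_
    rw [hC₁, mul_assoc]
    refine mul_le_mul_of_nonneg_right (Real.exp_le_exp.2 ?_) (by positivity)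
    exact mul_le_mul_of_nonneg_left hk hC0.le
  have hspace : ∀ x y, (step F h)^[k] φ x - (step F h)^[k] φ y ≤ C₂ * (‖x - y‖ + h) := by
    refine sub_le_of_sub_le_at_scale hh hC₂0.le fun x y hxy => ?_
    have h1 := (abs_le.1 (htime x)).1
    have h2 := step_le hF hh hh1 hbc x y
    have h3 := stepCost_le_of_norm_le hF hh hB₁ ((step F h)^[k] φ y) (x := x) (y := y)
      (by simpa using hxy)
    rw [← Function.iterate_succ_apply' (step F h)] at h2
    rw [hC₂]
    linarith
  have hspeed : ∀ x y, IsStepMinimizer F h ((step F h)^[k] φ) x y → ‖x - y‖ ≤ V * h := by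
    intro x y hy
    have h1 := (abs_le.1 (htime x)).2
    rw [IsStepMinimizer, ← Function.iterate_succ_apply' (step F h)] at hy
    -- The rate `C₂ + 1` exceeds by one the rate `C₂` at which the iterate can decrease, leaving a
    -- surplus `‖x - y‖` that must be `O(h)`.
    have h2 := le_stepCost hF hh hh1 (by positivity) hC₂h hM₂ x y ((step F h)^[k] φ y)
    have h3 := hspace x y
    rw [hV]
    linarith
  have hmom : ∀ x y p, IsStepMinimizer F h ((step F h)^[k] φ) x y →
      IsCostMaximizer F h x y ((step F h)^[k] φ y) p → ‖p‖ ≤ M₀ + B₃ := by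
    intro x y p hy hp
    have h1 := hspeed x y hy
    have h2 := le_stepCost hF hh hh1 le_rfl (by positivity) hM₀ x y ((step F h)^[k] φ y)
    rw [hp.stepCost_eq, stepAction] at h2
    have h3 := (real_inner_le_norm p (x - y)).trans
      (mul_le_mul_of_nonneg_left h1 (norm_nonneg p))
    have h4 : 0 ≤ h * (h / 2 * ‖p‖ ^ 2) := by positivity
    -- The pairing contributes at most `V * h * ‖p‖`, and the slope `V + 1` leaves a surplus `h *
    -- ‖p‖`.
    have h5 := mul_le_mul_of_nonneg_left (hB₃ y p ((step F h)^[k] φ y)) hh.le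
    have h6 : h * ‖p‖ ≤ h * (M₀ + B₃) := by linarith
    exact le_of_mul_le_mul_left h6 hh
  refine ⟨fun x => (htime x).trans ?_, fun x y => ?_, fun x y hy => (hspeed x y hy).trans ?_,
    fun x y p hy hp => (hmom x y p hy hp).trans ?_⟩
  · exact mul_le_mul_of_nonneg_right (by linarith) hh.le
  · have h1 : C₂ * (‖x - y‖ + h) ≤ (C₁ + C₂ + V + (M₀ + B₃)) * (‖x - y‖ + h) :=
      mul_le_mul_of_nonneg_right (by linarith) (by positivity)
    rw [abs_le]
    constructor
    · have := hspace y x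
      rw [norm_sub_rev] at this
      linarith
    · linarith [hspace x y]
  · exact mul_le_mul_of_nonneg_right (by linarith) hh.le
  · linarith

lemma abs_iterate_sub_le {h c T : ℝ} {φ : Eucl n → ℝ}
    (H : ∀ k : ℕ, k * h ≤ T → SchemeBounds F h c φ k) (hh : 0 < h) {k l : ℕ} (hkl : k ≤ l)
    (hl : l * h ≤ T) (x : Eucl n) :
    |(step F h)^[l] φ x - (step F h)^[k] φ x| ≤ c * ((l - k) * h) := by
  induction l, hkl using Nat.le_induction with
  | base => simp
  | succ l hkl ih =>
    push_cast at hl ⊢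
    have hl' : l * h ≤ T := by linarith
    have h1 := ih hl'
    have h2 := (H l hl').time x
    have := abs_sub_le ((step F h)^[l + 1] φ x) ((step F h)^[l] φ x) ((step F h)^[k] φ x)
    linarith

end

/-! ### The limit of the scheme and its forward and backward inequalities. -/

section

variable {n : ℕ} {F : Eucl n → Eucl n → ℝ → ℝ}

/-- An ultrafilter of step sizes converging to `0` from the right. -/
noncomputable def stepUltrafilter : Ultrafilter ℝ := Ultrafilter.of (𝓝[>] (0 : ℝ))

lemma stepUltrafilter_le : (stepUltrafilter : Filter ℝ) ≤ 𝓝[>] (0 : ℝ) := Ultrafilter.of_le _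

lemma eventually_stepUltrafilter {P : ℝ → Prop} {h₀ : ℝ} (hh₀ : 0 < h₀)
    (hP : ∀ h, 0 < h → h ≤ h₀ → P h) : ∀ᶠ h in (stepUltrafilter : Filter ℝ), P h := by
  refine stepUltrafilter_le ?_
  filter_upwards [Ioc_mem_nhdsGT hh₀] with h hh using hP h hh.1 hh.2

lemma tendsto_id_stepUltrafilter : Tendsto (fun h : ℝ => h) stepUltrafilter (𝓝 0) :=
  (tendsto_id.mono_left nhdsWithin_le_nhds).mono_left stepUltrafilter_le

lemma exists_tendsto_of_eventually_mem {X Y : Type*} [TopologicalSpace Y] (U : Ultrafilter X)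
    {f : X → Y} {K : Set Y} (hK : IsCompact K) (hf : ∀ᶠ h in (U : Filter X), f h ∈ K) :
    ∃ y ∈ K, Tendsto f U (𝓝 y) := by
  obtain ⟨y, hy, h⟩ := hK.ultrafilter_le_nhds (U.map f) (le_principal_iff.2 hf)
  exact ⟨y, hy, h⟩

/-- The value at `(x, t)` of the scheme with step `h` and initial datum `φ`. -/
noncomputable def schemeValue (F : Eucl n → Eucl n → ℝ → ℝ) (φ : Eucl n → ℝ) (x : Eucl n)
    (t h : ℝ) : ℝ :=
  (step F h)^[⌊t / h⌋₊] φ x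

/-- The limit of the scheme as the step tends to `0`. -/
noncomputable def schemeLimit (F : Eucl n → Eucl n → ℝ → ℝ) (φ : Eucl n → ℝ) (x : Eucl n)
    (t : ℝ) : ℝ :=
  limUnder (stepUltrafilter : Filter ℝ) (schemeValue F φ x t)

lemma abs_iterate_sub_iterate_le {h c T : ℝ} {φ : Eucl n → ℝ}
    (H : ∀ k : ℕ, k * h ≤ T → SchemeBounds F h c φ k) (hh : 0 < h) {k l : ℕ}
    (hk : k * h ≤ T) (hl : l * h ≤ T) (x y : Eucl n) :
    |(step F h)^[l] φ x - (step F h)^[k] φ y| ≤ c * (‖x - y‖ + h + |(l : ℝ) * h - k * h|) := by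
  rcases le_total k l with hkl | hkl
  · have h1 := abs_iterate_sub_le H hh hkl hl x
    have h2 := (H k hk).space x y
    have h3 : |(l : ℝ) * h - k * h| = (l - k) * h := by
      rw [← sub_mul, abs_of_nonneg]
      exact mul_nonneg (sub_nonneg.2 (by exact_mod_cast hkl)) hh.le
    rw [h3]
    have := abs_sub_le ((step F h)^[l] φ x) ((step F h)^[k] φ x) ((step F h)^[k] φ y)
    linarith
  · have h1 := abs_iterate_sub_le H hh hkl hk y
    have h2 := (H l hl).space x y
    have h3 : |(l : ℝ) * h - k * h| = (k - l) * h := by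
      rw [abs_sub_comm, ← sub_mul, abs_of_nonneg]
      exact mul_nonneg (sub_nonneg.2 (by exact_mod_cast hkl)) hh.le
    rw [h3]
    have := abs_sub_le ((step F h)^[l] φ x) ((step F h)^[l] φ y) ((step F h)^[k] φ y)
    rw [abs_sub_comm] at h1
    linarith

lemma floor_mul_le {h t : ℝ} (hh : 0 < h) (ht : 0 ≤ t) : (⌊t / h⌋₊ : ℝ) * h ≤ t := by
  have := Nat.floor_le (a := t / h) (by positivity)
  rwa [le_div_iff₀ hh] at this

lemma lt_floor_mul_add {h t : ℝ} (hh : 0 < h) : t < (⌊t / h⌋₊ : ℝ) * h + h := by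
  have := Nat.lt_floor_add_one (t / h)
  rw [div_lt_iff₀ hh] at this
  linarith

lemma abs_schemeValue_sub_le {h c T : ℝ} {φ : Eucl n → ℝ}
    (H : ∀ k : ℕ, k * h ≤ T → SchemeBounds F h c φ k) (hc : 0 ≤ c) (hh : 0 < h) {s t : ℝ}
    (hs : s ∈ Icc 0 T) (ht : t ∈ Icc 0 T) (x y : Eucl n) :
    |schemeValue F φ x t h - schemeValue F φ y s h| ≤ c * (‖x - y‖ + |t - s| + 2 * h) := by
  have h1 := floor_mul_le hh hs.1
  have h2 := floor_mul_le hh ht.1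
  have h3 := lt_floor_mul_add (t := s) hh
  have h4 := lt_floor_mul_add (t := t) hh
  refine (abs_iterate_sub_iterate_le H hh (h1.trans hs.2) (h2.trans ht.2) x y).trans ?_
  refine mul_le_mul_of_nonneg_left ?_ hc
  have : |(⌊t / h⌋₊ : ℝ) * h - ⌊s / h⌋₊ * h| ≤ |t - s| + h := by
    rw [abs_le]
    constructor <;> linarith [neg_abs_le (t - s), le_abs_self (t - s)]
  linarith

section Limit

variable {φ : Eucl n → ℝ} {K : ℝ}

/-- The values stay in a compact interval, so the ultrafilter gives a limit at every point at once.
Convergence of the whole family is not needed, since uniqueness of solutions identifies the limit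
later. -/
lemma tendsto_schemeLimit (hF : IsContactHamiltonian F) (hφ : BddCont φ)
    (hlip : ∀ x y, |φ x - φ y| ≤ K * ‖x - y‖) (x : Eucl n) {t : ℝ} (ht : 0 ≤ t) :
    Tendsto (schemeValue F φ x t) stepUltrafilter (𝓝 (schemeLimit F φ x t)) := by
  obtain ⟨c, h₀, hc, hh₀, -, H⟩ := exists_schemeBounds hF K t
  have : ∀ᶠ h in (stepUltrafilter : Filter ℝ),
      schemeValue F φ x t h ∈ closedBall (φ x) (c * (t + 2 * h₀)) := by
    refine eventually_stepUltrafilter hh₀ fun h hh hhh => ?_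
    have h1 := abs_schemeValue_sub_le (H h hh hhh φ hφ hlip) hc.le hh ⟨le_rfl, ht⟩
      ⟨ht, le_rfl⟩ x x
    have h2 : schemeValue F φ x 0 h = φ x := by simp [schemeValue]
    rw [h2, sub_zero, abs_of_nonneg ht, sub_self, norm_zero, zero_add] at h1
    rw [mem_closedBall, Real.dist_eq]
    exact h1.trans (mul_le_mul_of_nonneg_left (by linarith) hc.le)
  obtain ⟨y, -, hy⟩ := exists_tendsto_of_eventually_mem _ (isCompact_closedBall _ _) this
  exact tendsto_nhds_limUnder ⟨y, hy⟩

lemma schemeLimit_zero (F : Eucl n → Eucl n → ℝ → ℝ) (φ : Eucl n → ℝ) (x : Eucl n) :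
    schemeLimit F φ x 0 = φ x := by
  have : schemeValue F φ x 0 = fun _ => φ x := by ext; simp [schemeValue]
  rw [schemeLimit, this]
  exact tendsto_const_nhds.limUnder_eq

lemma exists_schemeLimit_lipschitz (hF : IsContactHamiltonian F) (K T : ℝ) :
    ∃ c : ℝ, 0 < c ∧ ∀ φ : Eucl n → ℝ, BddCont φ → (∀ x y, |φ x - φ y| ≤ K * ‖x - y‖) →
      ∀ x y : Eucl n, ∀ s ∈ Icc 0 T, ∀ t ∈ Icc 0 T,
        |schemeLimit F φ x t - schemeLimit F φ y s| ≤ c * (‖x - y‖ + |t - s|) := by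
  obtain ⟨c, h₀, hc, hh₀, -, H⟩ := exists_schemeBounds hF K T
  refine ⟨c, hc, fun φ hφ hlip x y s hs t ht => ?_⟩
  have h1 := ((tendsto_schemeLimit hF hφ hlip x ht.1).sub
    (tendsto_schemeLimit hF hφ hlip y hs.1)).abs
  have h2 : Tendsto (fun h : ℝ => c * (‖x - y‖ + |t - s| + 2 * h)) stepUltrafilter
      (𝓝 (c * (‖x - y‖ + |t - s| + 2 * 0))) :=
    ((tendsto_id_stepUltrafilter.const_mul 2).const_add _).const_mul c
  rw [mul_zero, add_zero] at h2
  refine le_of_tendsto_of_tendsto h1 h2 (eventually_stepUltrafilter hh₀ fun h hh hhh => ?_)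
  exact abs_schemeValue_sub_le (H h hh hhh φ hφ hlip) hc.le hh hs ht x y

/-- The Legendre transform of `F` is upper semicontinuous in `(x, u)`. -/
lemma eventually_inner_sub_le (hF : IsContactHamiltonian F) {x v : Eucl n} {u c ε : ℝ}
    (hc : ∀ p, inner ℝ p v - F x p u ≤ c) (hε : 0 < ε) :
    ∀ᶠ z : Eucl n × ℝ in 𝓝 (x, u), ∀ p, inner ℝ p v - F z.1 p z.2 ≤ c + ε := by
  -- With slope `‖v‖ + 1` the expression is at most `B - ‖p‖`, hence below `c` once `‖p‖ > B - c`;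
  -- only a compact set of `p` remains.
  obtain ⟨B, hB0, hB⟩ := hF.exists_linear_lower (‖v‖ + 1)
  have h1 : ∀ᶠ z : Eucl n × ℝ in 𝓝 (x, u), ∀ p ∈ closedBall (0 : Eucl n) (B - c),
      inner ℝ p v - F z.1 p z.2 ≤ c + ε := by
    refine (isCompact_closedBall _ _).eventually_forall_of_forall_eventually fun p _ => ?_
    have hcont : Continuous (fun w : (Eucl n × ℝ) × Eucl n => F w.1.1 w.2 w.1.2) := by
      have h2 : Continuous (fun w : (Eucl n × ℝ) × Eucl n => (w.1.1, w.2, w.1.2)) := by fun_prop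
      have h3 := hF.continuous.comp h2
      simpa only [Function.comp_def] using h3
    have hcont' : Continuous (fun w : (Eucl n × ℝ) × Eucl n => inner ℝ w.2 v - F w.1.1 w.2 w.1.2) :=
      (continuous_snd.inner continuous_const).sub hcont
    have h4 := hcont'.tendsto ((x, u), p)
    filter_upwards [h4.eventually (Iio_mem_nhds (show inner ℝ p v - F x p u < c + ε by
      linarith [hc p]))] with w hw
    exact le_of_lt hw
  filter_upwards [h1] with z hz p
  rcases le_or_gt ‖p‖ (B - c) with hp | hp
  · exact hz p (by simpa using hp)
  · have h2 := real_inner_le_norm p v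
    have h3 := hB z.1 p z.2
    linarith

/-- Moving with constant velocity `v` is admissible in the scheme. Near the base point each step
costs at most `h * (c + ε)` by semicontinuity of the Legendre transform, and the costs add up over a
time `τ`. -/
theorem schemeLimit_forward (hF : IsContactHamiltonian F) (hφ : BddCont φ)
    (hlip : ∀ x y, |φ x - φ y| ≤ K * ‖x - y‖) {x v : Eucl n} {t c : ℝ} (ht : 0 ≤ t)
    (hc : ∀ p, inner ℝ p v - F x p (schemeLimit F φ x t) ≤ c) {ε : ℝ} (hε : 0 < ε) :
    ∃ τ₀ : ℝ, 0 < τ₀ ∧ ∀ τ, 0 < τ → τ < τ₀ →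
      schemeLimit F φ (x + τ • v) (t + τ) ≤ schemeLimit F φ x t + τ * (c + ε) := by
  set u₀ := schemeLimit F φ x t with hu₀
  obtain ⟨c₀, h₀, hc₀, hh₀, hh₀1, H⟩ := exists_schemeBounds hF K (t + 1)
  obtain ⟨δ, hδ, hloc⟩ := Metric.eventually_nhds_iff.1 (eventually_inner_sub_le hF hc hε)
  -- The values along the path must stay within `δ` of `u₀`. One third is spent on the motion, one
  -- on the discretization term `c₀ * h`, and one on the convergence of the scheme.
  obtain ⟨τ₀, hτ₀, hτ₀1, hτ₀v, hτ₀c⟩ : ∃ τ₀ : ℝ, 0 < τ₀ ∧ τ₀ ≤ 1 ∧ τ₀ * ‖v‖ < δ ∧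
      c₀ * (τ₀ * ‖v‖ + τ₀) < δ / 3 := by
    have h0 : ∀ᶠ τ : ℝ in 𝓝[>] 0, 0 < τ := self_mem_nhdsWithin
    have h1 : ∀ᶠ τ : ℝ in 𝓝[>] 0, τ ≤ 1 :=
      nhdsWithin_le_nhds (Iic_mem_nhds one_pos)
    have h2 : ∀ᶠ τ : ℝ in 𝓝[>] 0, τ * ‖v‖ < δ := by
      have : Tendsto (fun τ : ℝ => τ * ‖v‖) (𝓝 0) (𝓝 (0 * ‖v‖)) := by
        exact (continuous_id.mul continuous_const).tendsto _
      exact nhdsWithin_le_nhds (this.eventually (Iio_mem_nhds (by simpa using hδ)))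
    have h3 : ∀ᶠ τ : ℝ in 𝓝[>] 0, c₀ * (τ * ‖v‖ + τ) < δ / 3 := by
      have hcont : Continuous (fun τ : ℝ => c₀ * (τ * ‖v‖ + τ)) := by fun_prop
      exact nhdsWithin_le_nhds ((hcont.tendsto 0).eventually
        (Iio_mem_nhds (by simpa using hδ)))
    obtain ⟨τ, hτ1, hτ2, hτ3, hτ4⟩ := (h0.and (h1.and (h2.and h3))).exists
    exact ⟨τ, hτ1, hτ2, hτ3, hτ4⟩
  refine ⟨τ₀, hτ₀, fun τ hτ hττ₀ => ?_⟩
  have hlim : Tendsto (fun h => schemeValue F φ x t h + (τ * (c + ε) + h * |c + ε|)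
      + c₀ * (h * ‖v‖ + 3 * h)) stepUltrafilter
      (𝓝 (u₀ + (τ * (c + ε) + 0 * |c + ε|) + c₀ * (0 * ‖v‖ + 3 * 0))) := by
    have hid := tendsto_id_stepUltrafilter
    exact ((tendsto_schemeLimit hF hφ hlip x ht).add ((hid.mul_const _).const_add _)).add
      (((hid.mul_const _).add (hid.const_mul _)).const_mul _)
  simp only [zero_mul, mul_zero, add_zero] at hlim
  refine le_of_tendsto_of_tendsto
    (tendsto_schemeLimit hF hφ hlip (x + τ • v) (by linarith : 0 ≤ t + τ)) hlim ?_
  have hev1 : ∀ᶠ h in (stepUltrafilter : Filter ℝ), |schemeValue F φ x t h - u₀| < δ / 3 := by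
    have := Metric.tendsto_nhds.1 (tendsto_schemeLimit hF hφ hlip x ht) (δ / 3) (by positivity)
    simpa only [Real.dist_eq] using this
  have hev2 : ∀ᶠ h in (stepUltrafilter : Filter ℝ), c₀ * h < δ / 3 :=
    ((tendsto_id_stepUltrafilter.const_mul c₀).eventually (Iio_mem_nhds (by simpa using hδ)))
  have hev3 : ∀ᶠ h in (stepUltrafilter : Filter ℝ), 0 < h ∧ h ≤ h₀ :=
    eventually_stepUltrafilter hh₀ fun h h1 h2 => ⟨h1, h2⟩
  filter_upwards [hev1, hev2, hev3] with h hh1 hh2 ⟨hh, hhh₀⟩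
  have HB := H h hh hhh₀ φ hφ hlip
  have hle1 : h ≤ 1 := hhh₀.trans hh₀1
  set k := ⌊t / h⌋₊ with hk
  set j := ⌊τ / h⌋₊ with hj
  have hkt : k * h ≤ t := floor_mul_le hh ht
  have hjτ : j * h ≤ τ := floor_mul_le hh hτ.le
  have hkt' : t < k * h + h := lt_floor_mul_add hh
  have hjτ' : τ < j * h + h := lt_floor_mul_add hh
  have claim : ∀ i : ℕ, i ≤ j →
      (step F h)^[k + i] φ (x + (i * h) • v) ≤ (step F h)^[k] φ x + i * h * (c + ε) := by
    intro i
    induction i with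
    | zero => intro _; simp
    | succ i ih =>
      intro hi
      have hi' : i ≤ j := by omega
      have hiR : (i : ℝ) * h ≤ τ := le_trans
        (mul_le_mul_of_nonneg_right (by exact_mod_cast hi') hh.le) hjτ
      have hih0 : 0 ≤ (i : ℝ) * h := by positivity
      have h1 := ih hi'
      have hbc := iterate_step_bddCont hF hh hle1 hφ (k + i)
      have h2 := step_le hF hh hle1 hbc (x + (((i + 1 : ℕ) : ℝ) * h) • v) (x + (i * h) • v)
      rw [← Function.iterate_succ_apply' (step F h)] at h2
      have hnear := abs_iterate_sub_iterate_le HB hh (k := k) (l := k + i) (by linarith)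
        (by push_cast; linarith) (x + (i * h) • v) x
      have hn1 : ‖x + (i * h) • v - x‖ ≤ τ₀ * ‖v‖ := by
        rw [add_sub_cancel_left, norm_smul, Real.norm_eq_abs, abs_of_nonneg hih0]
        exact mul_le_mul_of_nonneg_right (by linarith) (norm_nonneg v)
      have hn2 : |((k + i : ℕ) : ℝ) * h - k * h| = i * h := by
        push_cast; rw [add_mul, add_sub_cancel_left, abs_of_nonneg hih0]
      rw [hn2] at hnear
      have hval : |(step F h)^[k + i] φ (x + (i * h) • v) - u₀| < δ := by
        have h3 : c₀ * (‖x + (i * h) • v - x‖ + h + i * h)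
            ≤ c₀ * (τ₀ * ‖v‖ + τ₀) + c₀ * h := by
          rw [← mul_add]
          exact mul_le_mul_of_nonneg_left (by linarith) hc₀.le
        have h4 := abs_sub_le ((step F h)^[k + i] φ (x + (i * h) • v)) ((step F h)^[k] φ x) u₀
        have h5 : |(step F h)^[k] φ x - u₀| < δ / 3 := hh1
        linarith
      have hcost : stepCost F h (x + (((i + 1 : ℕ) : ℝ) * h) • v) (x + (i * h) • v)
          ((step F h)^[k + i] φ (x + (i * h) • v)) ≤ h * (c + ε) := by
        refine stepCost_le hF hh fun p _ => ?_
        have h6 : x + (((i + 1 : ℕ) : ℝ) * h) • v - (x + (i * h) • v) = h • v := by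
          push_cast; rw [add_mul, add_smul, one_mul]; abel
        have h7 := hloc (y := (x + (i * h) • v, (step F h)^[k + i] φ (x + (i * h) • v))) (by
          rw [Prod.dist_eq, dist_eq_norm, Real.dist_eq]
          exact max_lt (hn1.trans_lt hτ₀v) hval) p
        have h8 := mul_le_mul_of_nonneg_left h7 hh.le
        have h9 : 0 ≤ h * (h / 2 * ‖p‖ ^ 2) := by positivity
        rw [stepAction, h6, real_inner_smul_right]
        simp only at h8
        linarith
      rw [← add_assoc]
      push_cast at h2 hcost ⊢
      linarith
  have hfin := claim j le_rfl
  -- Floors are not additive: the path ends at index `k + j` and at the point for time `j * h`, both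
  -- of which miss the target by `O(h)`.
  have hidx := abs_iterate_sub_iterate_le HB hh (k := k + j) (l := ⌊(t + τ) / h⌋₊)
    (by push_cast; linarith) ((floor_mul_le hh (by linarith)).trans (by linarith))
    (x + τ • v) (x + (j * h) • v)
  have hf1 := floor_mul_le (t := t + τ) hh (by linarith)
  have hf2 := lt_floor_mul_add (t := t + τ) hh
  have hidx2 : |(⌊(t + τ) / h⌋₊ : ℝ) * h - ((k + j : ℕ) : ℝ) * h| ≤ 2 * h := by
    push_cast
    rw [abs_le]
    constructor <;> linarith
  have hidx3 : ‖x + τ • v - (x + (j * h) • v)‖ ≤ h * ‖v‖ := by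
    have : x + τ • v - (x + (j * h) • v) = (τ - j * h) • v := by rw [sub_smul]; abel
    rw [this, norm_smul, Real.norm_eq_abs, abs_of_nonneg (by linarith)]
    exact mul_le_mul_of_nonneg_right (by linarith) (norm_nonneg v)
  have hidx4 : c₀ * (‖x + τ • v - (x + (j * h) • v)‖ + h
      + |(⌊(t + τ) / h⌋₊ : ℝ) * h - ((k + j : ℕ) : ℝ) * h|) ≤ c₀ * (h * ‖v‖ + 3 * h) :=
    mul_le_mul_of_nonneg_left (by linarith) hc₀.le
  have hjc : j * h * (c + ε) ≤ τ * (c + ε) + h * |c + ε| := by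
    have h1 : (j * h - τ) * (c + ε) ≤ h * |c + ε| := by
      refine (le_abs_self _).trans ?_
      rw [abs_mul]
      refine mul_le_mul_of_nonneg_right ?_ (abs_nonneg _)
      rw [abs_le]; constructor <;> linarith
    linarith
  have := (abs_le.1 hidx).2
  change (step F h)^[⌊(t + τ) / h⌋₊] φ (x + τ • v) ≤ (step F h)^[k] φ x + _ + _
  linarith

/-- Follow the optimal steps backwards from `(x, t)`. In each of them any fixed `p` is a competitor
in the supremum defining the cost, which bounds the cost below; the speed bound confines the path.
The bound `V` is chosen before `p` and `ε`, as the viscosity argument requires. -/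
theorem schemeLimit_backward (hF : IsContactHamiltonian F) (hφ : BddCont φ)
    (hlip : ∀ x y, |φ x - φ y| ≤ K * ‖x - y‖) (x : Eucl n) {t : ℝ} (ht : 0 < t) :
    ∃ V : ℝ, 0 < V ∧ ∀ p : Eucl n, ∀ ε : ℝ, 0 < ε → ∃ τ₀ : ℝ, 0 < τ₀ ∧ ∀ τ, 0 < τ → τ < τ₀ →
      ∃ y, ‖x - y‖ ≤ V * τ ∧ schemeLimit F φ y (t - τ) + inner ℝ p (x - y)
        - τ * (F x p (schemeLimit F φ x t) + ε) ≤ schemeLimit F φ x t := by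
  set u₀ := schemeLimit F φ x t with hu₀
  obtain ⟨c₀, h₀, hc₀, hh₀, hh₀1, H⟩ := exists_schemeBounds hF K t
  refine ⟨c₀, hc₀, fun p ε hε => ?_⟩
  have hcont : Continuous (fun w : Eucl n × ℝ => F w.1 p w.2) := by
    have h2 : Continuous (fun w : Eucl n × ℝ => (w.1, p, w.2)) := by fun_prop
    have h3 := hF.continuous.comp h2
    simpa only [Function.comp_def] using h3
  obtain ⟨δ, hδ, hloc⟩ := Metric.eventually_nhds_iff.1 ((hcont.tendsto (x, u₀)).eventually
    (Iio_mem_nhds (show F x p u₀ < F x p u₀ + ε / 2 by linarith)))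
  set τ₀ := min t (min (δ / (2 * c₀)) (δ / (3 * (c₀ * (c₀ + 1))))) with hτ₀
  refine ⟨τ₀, by positivity, fun τ hτ hττ₀ => ?_⟩
  have hτt : τ < t := hττ₀.trans_le (min_le_left _ _)
  have hτ1 : c₀ * τ < δ := by
    have : τ < δ / (2 * c₀) := hττ₀.trans_le ((min_le_right _ _).trans (min_le_left _ _))
    rw [lt_div_iff₀ (by positivity)] at this
    nlinarith
  have hτ2 : c₀ * (c₀ * τ + τ) < δ / 3 := by
    have : τ < δ / (3 * (c₀ * (c₀ + 1))) :=
      hττ₀.trans_le ((min_le_right _ _).trans (min_le_right _ _))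
    rw [lt_div_iff₀ (by positivity)] at this
    linarith
  have hev1 : ∀ᶠ h in (stepUltrafilter : Filter ℝ), |schemeValue F φ x t h - u₀| < δ / 3 := by
    have := Metric.tendsto_nhds.1 (tendsto_schemeLimit hF hφ hlip x ht.le) (δ / 3) (by positivity)
    simpa only [Real.dist_eq] using this
  have hev2 : ∀ᶠ h in (stepUltrafilter : Filter ℝ), c₀ * h < δ / 3 :=
    ((tendsto_id_stepUltrafilter.const_mul c₀).eventually (Iio_mem_nhds (by simpa using hδ)))
  have hev3 : ∀ᶠ h in (stepUltrafilter : Filter ℝ), 0 < h ∧ h ≤ h₀ :=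
    eventually_stepUltrafilter hh₀ fun h h1 h2 => ⟨h1, h2⟩
  have hev4 : ∀ᶠ h in (stepUltrafilter : Filter ℝ), h / 2 * ‖p‖ ^ 2 < ε / 2 :=
    (((tendsto_id_stepUltrafilter.div_const 2).mul_const (‖p‖ ^ 2)).eventually
      (Iio_mem_nhds (by simpa using hε)))
  have hev5 : ∀ᶠ h in (stepUltrafilter : Filter ℝ), ‖p‖ ≤ h⁻¹ := by
    refine eventually_stepUltrafilter (h₀ := (‖p‖ + 1)⁻¹) (by positivity) fun h h1 h2 => ?_
    have : ‖p‖ + 1 ≤ h⁻¹ := by rwa [le_inv_comm₀ (by positivity) h1]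
    linarith
  have hev : ∀ᶠ h in (stepUltrafilter : Filter ℝ), ∃ y, ‖x - y‖ ≤ c₀ * τ ∧
      (step F h)^[⌊t / h⌋₊ - ⌊τ / h⌋₊] φ y + inner ℝ p (x - y)
        - ⌊τ / h⌋₊ * h * (F x p u₀ + ε) ≤ schemeValue F φ x t h := by
    filter_upwards [hev1, hev2, hev3, hev4, hev5] with h hh1 hh2 ⟨hh, hhh₀⟩ hh4 hph
    have HB := H h hh hhh₀ φ hφ hlip
    have hle1 : h ≤ 1 := hhh₀.trans hh₀1
    set k := ⌊t / h⌋₊ with hk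
    set j := ⌊τ / h⌋₊ with hj
    have hjk : j ≤ k := Nat.floor_mono (div_le_div_of_nonneg_right hτt.le hh.le)
    have hkt : k * h ≤ t := floor_mul_le hh ht.le
    have hjτ : j * h ≤ τ := floor_mul_le hh hτ.le
    have claim : ∀ i : ℕ, i ≤ j → ∃ y, ‖x - y‖ ≤ c₀ * (i * h) ∧
        (step F h)^[k - i] φ y + inner ℝ p (x - y) - i * h * (F x p u₀ + ε)
          ≤ (step F h)^[k] φ x := by
      intro i
      induction i with
      | zero => intro _; exact ⟨x, by simp⟩
      | succ i ih =>
        intro hi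
        obtain ⟨y, hy, hval⟩ := ih (by omega)
        set l := k - (i + 1) with hl
        have hkl : k - i = l + 1 := by omega
        have hlk : (l : ℝ) * h ≤ t := le_trans
          (mul_le_mul_of_nonneg_right (by exact_mod_cast (by omega : l ≤ k)) hh.le) hkt
        have hbc := iterate_step_bddCont hF hh hle1 hφ l
        obtain ⟨z, hz, -⟩ := exists_stepMinimizer hF hh hle1 hbc y
        have hyz := (HB l hlk).speed y z hz
        have hiR : ((i + 1 : ℕ) : ℝ) * h ≤ τ := le_trans
          (mul_le_mul_of_nonneg_right (by exact_mod_cast hi) hh.le) hjτ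
        have hxz : ‖x - z‖ ≤ c₀ * ((i + 1 : ℕ) * h) := by
          have := norm_sub_le_norm_sub_add_norm_sub x y z
          push_cast
          linarith
        refine ⟨z, hxz, ?_⟩
        have hz' := hz
        rw [IsStepMinimizer, ← Function.iterate_succ_apply' (step F h), Nat.succ_eq_add_one,
          ← hkl] at hz'
        have hact := stepAction_le_stepCost hF hh y z ((step F h)^[l] φ z) hph
        have hxzδ : ‖x - z‖ ≤ c₀ * τ := hxz.trans (mul_le_mul_of_nonneg_left hiR hc₀.le)
        have hnear := abs_iterate_sub_iterate_le HB hh (k := k) (l := l) hkt hlk z x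
        have hn2 : |(l : ℝ) * h - k * h| ≤ τ := by
          have : (k : ℝ) = l + (i + 1 : ℕ) := by rw [hl]; norm_cast; omega
          rw [this, add_mul, sub_add_cancel_left, abs_neg, abs_of_nonneg (by positivity)]
          exact hiR
        have hFz : F z p ((step F h)^[l] φ z) < F x p u₀ + ε / 2 := by
          refine hloc (y := (z, (step F h)^[l] φ z)) ?_
          rw [Prod.dist_eq, dist_eq_norm, Real.dist_eq]
          refine max_lt ?_ ?_
          · rw [norm_sub_rev]; linarith
          · have h3 : c₀ * (‖z - x‖ + h + |(l : ℝ) * h - k * h|)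
                ≤ c₀ * (c₀ * τ + τ) + c₀ * h := by
              rw [← mul_add, norm_sub_rev]
              exact mul_le_mul_of_nonneg_left (by linarith) hc₀.le
            have h4 := abs_sub_le ((step F h)^[l] φ z) ((step F h)^[k] φ x) u₀
            have h5 : |(step F h)^[k] φ x - u₀| < δ / 3 := hh1
            simp only at h4 ⊢
            linarith
        have h6 := mul_le_mul_of_nonneg_left (add_lt_add hFz hh4).le hh.le
        have h7 : inner ℝ p (x - z) = inner ℝ p (x - y) + inner ℝ p (y - z) := by
          rw [← inner_add_right]; congr 1; abel
        rw [stepAction] at hact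
        push_cast
        linarith
    obtain ⟨y, hy, hval⟩ := claim j le_rfl
    exact ⟨y, hy.trans (mul_le_mul_of_nonneg_left hjτ hc₀.le), hval⟩
  -- The discrete end points `g h` lie in a fixed closed ball, so they converge along the
  -- ultrafilter to the required `y`.
  obtain ⟨g, hg⟩ := hev.choice
  obtain ⟨y, hyK, hy⟩ := exists_tendsto_of_eventually_mem stepUltrafilter
    (isCompact_closedBall x (c₀ * τ)) (f := g) (by
      filter_upwards [hg] with h hh
      rw [mem_closedBall, dist_eq_norm, norm_sub_rev]
      exact hh.1)
  refine ⟨y, by rw [← dist_eq_norm, dist_comm]; exact hyK, ?_⟩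
  have hnorm : Tendsto (fun h => ‖y - g h‖) stepUltrafilter (𝓝 0) := by
    have := (tendsto_const_nhds (x := y)).sub hy
    rw [sub_self] at this
    simpa using this.norm
  have hlim : Tendsto (fun h => (schemeValue F φ y (t - τ) h - c₀ * (‖y - g h‖ + 3 * h))
      + inner ℝ p (x - g h) - (τ * (F x p u₀ + ε) + h * |F x p u₀ + ε|)) stepUltrafilter
      (𝓝 ((schemeLimit F φ y (t - τ) - c₀ * (0 + 3 * 0)) + inner ℝ p (x - y)
        - (τ * (F x p u₀ + ε) + 0 * |F x p u₀ + ε|))) := by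
    have hid := tendsto_id_stepUltrafilter
    refine Tendsto.sub (Tendsto.add (Tendsto.sub
      (tendsto_schemeLimit hF hφ hlip y (by linarith : 0 ≤ t - τ))
      ((hnorm.add (hid.const_mul 3)).const_mul c₀)) ?_) ((hid.mul_const _).const_add _)
    exact tendsto_const_nhds.inner (tendsto_const_nhds.sub hy)
  simp only [zero_mul, mul_zero, add_zero, sub_zero] at hlim
  refine le_of_tendsto_of_tendsto hlim (tendsto_schemeLimit hF hφ hlip x ht.le) ?_
  filter_upwards [hg, hev3] with h ⟨hg1, hg2⟩ ⟨hh, hhh₀⟩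
  have HB := H h hh hhh₀ φ hφ hlip
  have hjk : ⌊τ / h⌋₊ ≤ ⌊t / h⌋₊ := Nat.floor_mono (div_le_div_of_nonneg_right hτt.le hh.le)
  have e1 := floor_mul_le hh ht.le
  have e2 := floor_mul_le hh hτ.le
  have e3 := floor_mul_le (t := t - τ) hh (by linarith)
  have e1' := lt_floor_mul_add (t := t) hh
  have e2' := lt_floor_mul_add (t := τ) hh
  have e3' := lt_floor_mul_add (t := t - τ) hh
  have hidx := abs_iterate_sub_iterate_le HB hh (k := ⌊t / h⌋₊ - ⌊τ / h⌋₊)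
    (l := ⌊(t - τ) / h⌋₊) (le_trans (mul_le_mul_of_nonneg_right
      (by exact_mod_cast Nat.sub_le _ _) hh.le) e1) (by linarith) y (g h)
  have hidx2 : |(⌊(t - τ) / h⌋₊ : ℝ) * h - ((⌊t / h⌋₊ - ⌊τ / h⌋₊ : ℕ) : ℝ) * h| ≤ 2 * h := by
    rw [Nat.cast_sub hjk, abs_le]
    constructor <;> linarith
  have hidx4 : c₀ * (‖y - g h‖ + h
      + |(⌊(t - τ) / h⌋₊ : ℝ) * h - ((⌊t / h⌋₊ - ⌊τ / h⌋₊ : ℕ) : ℝ) * h|)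
      ≤ c₀ * (‖y - g h‖ + 3 * h) :=
    mul_le_mul_of_nonneg_left (by linarith) hc₀.le
  have hjc : ⌊τ / h⌋₊ * h * (F x p u₀ + ε) ≤ τ * (F x p u₀ + ε) + h * |F x p u₀ + ε| := by
    have h1 : (⌊τ / h⌋₊ * h - τ) * (F x p u₀ + ε) ≤ h * |F x p u₀ + ε| := by
      refine (le_abs_self _).trans ?_
      rw [abs_mul]
      refine mul_le_mul_of_nonneg_right ?_ (abs_nonneg _)
      rw [abs_le]; constructor <;> linarith
    linarith
  have := (abs_le.1 hidx).2
  rw [schemeValue]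
  linarith

end Limit

end

/-! ### Subgradients and viscosity inequalities. -/

section

variable {n : ℕ} {H F : Eucl n → Eucl n → ℝ → ℝ}

/-- The linear form `(e, τ) ↦ ⟪p, e⟫ + q τ` on space-time. -/
noncomputable def planeForm (p : Eucl n) (q : ℝ) : (Eucl n × ℝ) →L[ℝ] ℝ :=
  (innerSL ℝ p).comp (ContinuousLinearMap.fst ℝ _ _) + q • ContinuousLinearMap.snd ℝ _ _

@[simp] lemma planeForm_apply (p : Eucl n) (q : ℝ) (z : Eucl n × ℝ) :
    planeForm p q z = inner ℝ p z.1 + q * z.2 := by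
  simp [planeForm]

lemma planeForm_neg (p : Eucl n) (q : ℝ) : planeForm (-p) (-q) = -planeForm p q := by
  ext <;> simp

lemma gradient_slice_eq {ψ : Eucl n × ℝ → ℝ} {p x : Eucl n} {q t : ℝ}
    (h : HasFDerivAt ψ (planeForm p q) (x, t)) : gradient (fun y => ψ (y, t)) x = p := by
  have h1 : HasFDerivAt (fun y => ψ (y, t)) (InnerProductSpace.toDual ℝ (Eucl n) p) x := by
    have := HasFDerivAt.comp (f := fun y => (y, t)) x h
      ((hasFDerivAt_id x).prodMk (hasFDerivAt_const t x))
    refine this.congr_fderiv ?_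
    ext e
    simp
  exact (hasGradientAt_iff_hasFDerivAt.2 h1).gradient

lemma deriv_slice_eq {ψ : Eucl n × ℝ → ℝ} {p x : Eucl n} {q t : ℝ}
    (h : HasFDerivAt ψ (planeForm p q) (x, t)) : deriv (fun s => ψ (x, s)) t = q := by
  have := HasFDerivAt.comp_hasDerivAt (f := fun s => (x, s)) t h
    ((hasDerivAt_const t x).prodMk (hasDerivAt_id t))
  have h2 := this.deriv
  simpa [Function.comp_def] using h2

lemma exists_hasFDerivAt_planeForm {ψ : Eucl n × ℝ → ℝ} {z : Eucl n × ℝ}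
    (h : DifferentiableAt ℝ ψ z) : ∃ p q, HasFDerivAt ψ (planeForm p q) z := by
  refine ⟨(InnerProductSpace.toDual ℝ (Eucl n)).symm
    ((fderiv ℝ ψ z).comp (ContinuousLinearMap.inl ℝ _ _)), fderiv ℝ ψ z (0, 1), ?_⟩
  refine h.hasFDerivAt.congr_fderiv ?_
  ext <;> simp

/-- `(p, q)` is a Fréchet subgradient of `u` at `(x, t)`. -/
def HasSubgradient (u : Eucl n → ℝ → ℝ) (x : Eucl n) (t : ℝ) (p : Eucl n) (q : ℝ) : Prop :=
  ∀ ε : ℝ, 0 < ε → ∀ᶠ Y : Eucl n × ℝ in 𝓝 (x, t),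
    u x t + inner ℝ p (Y.1 - x) + q * (Y.2 - t) - ε * (‖Y.1 - x‖ + |Y.2 - t|) ≤ u Y.1 Y.2

/-- `(p, q)` is a proximal subgradient of `u` at `(x, t)`. -/
def HasProxSubgradient (u : Eucl n → ℝ → ℝ) (x : Eucl n) (t : ℝ) (p : Eucl n) (q : ℝ) : Prop :=
  ∃ A : ℝ, 0 < A ∧ ∀ᶠ Y : Eucl n × ℝ in 𝓝 (x, t),
    u x t + inner ℝ p (Y.1 - x) + q * (Y.2 - t) - A * (‖Y.1 - x‖ ^ 2 + (Y.2 - t) ^ 2) ≤ u Y.1 Y.2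

lemma HasProxSubgradient.hasSubgradient {u : Eucl n → ℝ → ℝ} {x p : Eucl n} {t q : ℝ}
    (h : HasProxSubgradient u x t p q) : HasSubgradient u x t p q := by
  obtain ⟨A, hA, h⟩ := h
  intro ε hε
  filter_upwards [h, Metric.ball_mem_nhds (x, t) (ε := ε / A) (by positivity)] with Y hY hY2
  rw [mem_ball, Prod.dist_eq, max_lt_iff, dist_eq_norm, Real.dist_eq, lt_div_iff₀ hA,
    lt_div_iff₀ hA] at hY2
  have h1 := mul_le_mul_of_nonneg_right hY2.1.le (norm_nonneg (Y.1 - x))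
  have h2 := mul_le_mul_of_nonneg_right hY2.2.le (abs_nonneg (Y.2 - t))
  have h3 : (Y.2 - t) ^ 2 = |Y.2 - t| * |Y.2 - t| := by rw [← sq, sq_abs]
  simp only at h1 h2
  rw [h3] at hY
  nlinarith

/-- Viscosity subsolutions on `ℝⁿ × (0, T)` in terms of local test functions. -/
def IsLocalSub (H : Eucl n → Eucl n → ℝ → ℝ) (T : ℝ) (u : Eucl n → ℝ → ℝ) : Prop :=
  ∀ (χ : Eucl n × ℝ → ℝ) (x : Eucl n) (t : ℝ) (p : Eucl n) (q : ℝ), 0 < t → t < T →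
    ContDiffAt ℝ 1 χ (x, t) → HasFDerivAt χ (planeForm p q) (x, t) →
    IsLocalMax (fun Y => u Y.1 Y.2 - χ Y) (x, t) → q + H x p (u x t) ≤ 0

/-- Viscosity supersolutions on `ℝⁿ × (0, T)` in terms of local test functions. -/
def IsLocalSuper (H : Eucl n → Eucl n → ℝ → ℝ) (T : ℝ) (u : Eucl n → ℝ → ℝ) : Prop :=
  ∀ (χ : Eucl n × ℝ → ℝ) (x : Eucl n) (t : ℝ) (p : Eucl n) (q : ℝ), 0 < t → t < T →
    ContDiffAt ℝ 1 χ (x, t) → HasFDerivAt χ (planeForm p q) (x, t) →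
    IsLocalMin (fun Y => u Y.1 Y.2 - χ Y) (x, t) → 0 ≤ q + H x p (u x t)

/-- Move forward with the velocity `v = gradP F x p u₀` dual to `p`. The limit then grows at most at
rate `⟪p, v⟫ - F + ε`, while the subgradient forces growth at least at rate `⟪p, v⟫ + q`, up to an
error proportional to `ε`. -/
theorem schemeLimit_subgradient {φ : Eucl n → ℝ} {K : ℝ} (hF : IsContactHamiltonian F)
    (hφ : BddCont φ) (hlip : ∀ x y, |φ x - φ y| ≤ K * ‖x - y‖) {x p : Eucl n} {t q : ℝ}
    (ht : 0 ≤ t) (h : HasSubgradient (schemeLimit F φ) x t p q) :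
    q + F x p (schemeLimit F φ x t) ≤ 0 := by
  set u₀ := schemeLimit F φ x t
  set v := gradP F x p u₀
  refine le_of_forall_pos_le_add fun η hη => ?_
  have hv : 0 < ‖v‖ + 2 := by positivity
  set ε := η / (‖v‖ + 2) with hεd
  have hε : 0 < ε := by positivity
  have hc : ∀ p', inner ℝ p' v - F x p' u₀ ≤ inner ℝ p v - F x p u₀ := fun p' => by
    have := hF.gradient_inequality x p p' u₀
    rw [inner_sub_right, real_inner_comm, real_inner_comm p] at this
    linarith
  obtain ⟨τ₀, hτ₀, hfwd⟩ := schemeLimit_forward hF hφ hlip ht hc hε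
  have hcurve : Tendsto (fun τ : ℝ => (x + τ • v, t + τ)) (𝓝[>] 0) (𝓝 (x, t)) := by
    have hcont : Continuous (fun τ : ℝ => (x + τ • v, t + τ)) := by fun_prop
    have := hcont.tendsto 0
    simp only [zero_smul, add_zero] at this
    exact this.mono_left nhdsWithin_le_nhds
  obtain ⟨τ, hτ1, hτ2⟩ :=
    ((hcurve.eventually (h ε hε)).and (Ioo_mem_nhdsGT hτ₀)).exists
  have h1 := hfwd τ hτ2.1 hτ2.2
  simp only [add_sub_cancel_left] at hτ1
  rw [real_inner_smul_right, norm_smul, Real.norm_eq_abs, abs_of_pos hτ2.1] at hτ1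
  have h3 : τ * (q + F x p u₀) ≤ τ * (ε * (‖v‖ + 2)) := by linarith
  have h4 := le_of_mul_le_mul_left h3 hτ2.1
  rw [hεd, div_mul_cancel₀ _ hv.ne'] at h4
  linarith

/-- The backward inequality is applied with `p` the gradient of the test function; the pairings with
the unknown displacement `x - y` cancel, leaving only `q + F`. -/
theorem schemeLimit_isLocalSuper {φ : Eucl n → ℝ} {K : ℝ} (hF : IsContactHamiltonian F)
    (hφ : BddCont φ) (hlip : ∀ x y, |φ x - φ y| ≤ K * ‖x - y‖) (T : ℝ) :
    IsLocalSuper F T (schemeLimit F φ) := by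
  intro χ x t p q ht _ _ hχ hmin
  set u₀ := schemeLimit F φ x t
  obtain ⟨V, hV, hback⟩ := schemeLimit_backward hF hφ hlip x ht
  rw [← neg_nonpos]
  refine le_of_forall_pos_le_add fun η hη => ?_
  -- One `ε` is lost in the backward inequality and `(V + 1) * ε` in the expansion of `χ`, because
  -- the displacement in space-time is at most `(V + 1) * τ`.
  set ε := η / (V + 2) with hεd
  have hε : 0 < ε := by positivity
  obtain ⟨τ₀, hτ₀, hback⟩ := hback p ε hε
  have hlo := hχ.isLittleO.def hε
  obtain ⟨r, hr, hloc⟩ := Metric.eventually_nhds_iff.1 (hlo.and hmin)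
  set τ := min (τ₀ / 2) (r / (2 * (V + 1))) with hτd
  have hτ : 0 < τ := by positivity
  have hτr : (V + 1) * τ < r := by
    have : τ ≤ r / (2 * (V + 1)) := min_le_right _ _
    rw [le_div_iff₀ (by positivity)] at this
    linarith
  obtain ⟨y, hy, hval⟩ := hback τ hτ ((min_le_left _ _).trans_lt (by linarith))
  have hdist : dist (y, t - τ) (x, t) ≤ (V + 1) * τ := by
    rw [Prod.dist_eq, dist_eq_norm, Real.dist_eq, norm_sub_rev, sub_sub_cancel_left, abs_neg,
      abs_of_pos hτ]
    exact max_le (by linarith) (by nlinarith)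
  obtain ⟨h1, h2⟩ := hloc (hdist.trans_lt hτr)
  rw [← dist_eq_norm (y, t - τ)] at h1
  have h3 := (abs_le.1 (h1.trans (mul_le_mul_of_nonneg_left hdist hε.le))).1
  simp only [planeForm_apply, Prod.fst_sub, Prod.snd_sub, sub_sub_cancel_left] at h3
  simp only at h2
  have h4 : inner ℝ p (y - x) = -inner ℝ p (x - y) := by rw [← inner_neg_right, neg_sub]
  have h5 : τ * -(q + F x p u₀) ≤ τ * (ε * (V + 2)) := by linarith
  have h6 := le_of_mul_le_mul_left h5 hτ
  rw [hεd, div_mul_cancel₀ _ (by positivity)] at h6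
  linarith

lemma max_le_of_sq_add_sq_le {a b k : ℝ} (ha : 0 ≤ a) (hb : 0 ≤ b) (hk : 0 ≤ k)
    (h : a ^ 2 + b ^ 2 ≤ k * (a + b)) : max a b ≤ 2 * k := by
  by_contra hlt
  push Not at hlt
  rcases le_total a b with h' | h'
  · rw [max_eq_right h'] at hlt
    nlinarith
  · rw [max_eq_left h'] at hlt
    nlinarith

set_option maxHeartbeats 1000000 in
/-- If all proximal subgradients of a Lipschitz function `w` satisfy the inequality of the
equation, then, by convexity of the Hamiltonian, `w` is a viscosity subsolution. -/
theorem isLocalSub_of_proxSubgradient (hH : IsContactHamiltonian H) {w : Eucl n → ℝ → ℝ}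
    {K T : ℝ} (hK : 0 < K)
    (hlip : ∀ x y : Eucl n, ∀ s ∈ Icc 0 T, ∀ t ∈ Icc 0 T,
      |w x t - w y s| ≤ K * (‖x - y‖ + |t - s|))
    (hprox : ∀ x t p q, 0 < t → t < T → HasProxSubgradient w x t p q → q + H x p (w x t) ≤ 0) :
    IsLocalSub H T w := by
  intro χ x₀ t₀ pb qb ht₀ htT hχ hχd hmax
  by_contra hcon
  push Not at hcon
  set w₀ := w x₀ t₀ with hw₀
  set δ := (qb + H x₀ pb w₀) / 3 with hδd
  have hδ : 0 < δ := by positivity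
  set v := gradP H x₀ pb w₀ with hv
  -- By convexity this is the Legendre transform of `H x₀ · w₀` at `v`. If the viscosity inequality
  -- fails by `3 * δ`, the test function has slope `c₀ + 3 * δ` in the direction `(v, 1)`.
  set c₀ := inner ℝ pb v - H x₀ pb w₀ with hc₀
  have hqb : inner ℝ pb v + qb = c₀ + 3 * δ := by rw [hc₀, hδd]; ring
  have hleg : ∀ p, inner ℝ p v - H x₀ p w₀ ≤ c₀ := fun p => by
    have := hH.gradient_inequality x₀ pb p w₀
    rw [inner_sub_right, real_inner_comm, real_inner_comm pb] at this
    linarith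
  have hcontw : ContinuousAt (fun Y : Eucl n × ℝ => (Y.1, w Y.1 Y.2)) (x₀, t₀) := by
    refine continuousAt_fst.prodMk ?_
    rw [Metric.continuousAt_iff]
    intro ε hε
    refine ⟨min (min t₀ (T - t₀)) (ε / (3 * K)), ?_, fun {Y} hY => ?_⟩
    · have : 0 < T - t₀ := by linarith
      positivity
    rw [lt_min_iff, lt_min_iff, lt_div_iff₀ (by positivity)] at hY
    obtain ⟨⟨hY1, hY2⟩, hY3⟩ := hY
    have e1 : ‖Y.1 - x₀‖ ≤ dist Y (x₀, t₀) := by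
      rw [Prod.dist_eq, ← dist_eq_norm]; exact le_max_left _ _
    have e2 : |Y.2 - t₀| ≤ dist Y (x₀, t₀) := by
      rw [Prod.dist_eq, ← Real.dist_eq]; exact le_max_right _ _
    have e3 := abs_le.1 e2
    rw [Real.dist_eq]
    have := hlip Y.1 x₀ t₀ ⟨ht₀.le, htT.le⟩ Y.2 ⟨by linarith, by linarith⟩
    have e4 := mul_le_mul_of_nonneg_left (add_le_add e1 e2) hK.le
    simp only
    nlinarith
  have hev := (hcontw.eventually (eventually_inner_sub_le hH hleg hδ)).and hmax
  obtain ⟨r', hr', hloc⟩ := Metric.eventually_nhds_iff.1 hev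
  obtain ⟨r, hr, hrr', hrt, hrT⟩ : ∃ r : ℝ, 0 < r ∧ r < r' ∧ r < t₀ ∧ r < T - t₀ := by
    have : 0 < T - t₀ := by linarith
    obtain ⟨r, h1, h2⟩ := exists_between (lt_min hr' (lt_min ht₀ this))
    rw [lt_min_iff, lt_min_iff] at h2
    exact ⟨r, h1, h2.1, h2.2.1, h2.2.2⟩
  -- The direction `(v, 1)` along which `w` grows faster than its subgradients allow.
  have hder : HasDerivAt (fun σ : ℝ => χ (x₀ + σ • v, t₀ + σ)) (c₀ + 3 * δ) 0 := by
    have h0 : HasDerivAt (fun σ : ℝ => (x₀ + σ • v, t₀ + σ)) (v, 1) 0 := by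
      refine HasDerivAt.prodMk ?_ ?_
      · simpa using ((hasDerivAt_id (0 : ℝ)).smul_const v).const_add x₀
      · exact (hasDerivAt_id (0 : ℝ)).const_add t₀
    have h1 : HasFDerivAt χ (planeForm pb qb) (x₀ + (0 : ℝ) • v, t₀ + 0) := by simpa using hχd
    have h2 := h1.comp_hasDerivAt (0 : ℝ) h0
    rw [planeForm_apply, mul_one, hqb] at h2
    exact h2
  obtain ⟨τ, hτ, hτr, hτχ⟩ : ∃ τ : ℝ, 0 < τ ∧ τ * (‖v‖ + 1) < r / 2 ∧
      χ (x₀ + (-τ) • v, t₀ + -τ) ≤ χ (x₀, t₀) - τ * (c₀ + 2 * δ) := by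
    have h1 := hder.isLittleO.def hδ
    have h2 : Tendsto (fun τ : ℝ => -τ) (𝓝[>] 0) (𝓝 0) := by
      have := (continuous_neg (G := ℝ)).tendsto 0
      rw [neg_zero] at this
      exact this.mono_left nhdsWithin_le_nhds
    have h3 : ∀ᶠ τ : ℝ in 𝓝[>] 0, τ * (‖v‖ + 1) < r / 2 := by
      have hcont : Continuous (fun τ : ℝ => τ * (‖v‖ + 1)) := by fun_prop
      exact nhdsWithin_le_nhds ((hcont.tendsto 0).eventually (Iio_mem_nhds (by simpa using hr)))
    have h4 : ∀ᶠ τ : ℝ in 𝓝[>] 0, 0 < τ := self_mem_nhdsWithin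
    obtain ⟨τ, h5, h6, h7⟩ := ((h2.eventually h1).and (h3.and h4)).exists
    refine ⟨τ, h7, h6, ?_⟩
    simp only [zero_smul, add_zero, sub_zero, smul_eq_mul, norm_neg, Real.norm_eq_abs] at h5
    rw [abs_of_pos h7] at h5
    have := (abs_le.1 h5).2
    linarith
  -- Strictly between the slope `c₀ + δ`, the most that nearby proximal subgradients can have along
  -- `(v, 1)`, and the slope `c₀ + 2 * δ` that `w` attains on the segment.
  set c' := c₀ + 3 / 2 * δ with hc'
  obtain ⟨ε, hε, hεK, hεr⟩ : ∃ ε : ℝ, 0 < ε ∧ K ^ 2 * ε < τ * δ ∧ 2 * K * ε < r / 2 := by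
    have h1 : 0 < min (τ * δ / K ^ 2) (r / 2 / (2 * K)) := by positivity
    obtain ⟨ε, h2, h3⟩ := exists_between h1
    rw [lt_min_iff, lt_div_iff₀ (by positivity), lt_div_iff₀ (by positivity)] at h3
    exact ⟨ε, h2, by linarith, by linarith⟩
  set Q : Eucl n × ℝ → ℝ → ℝ := fun X σ =>
    ‖X.1 - (x₀ + σ • v)‖ ^ 2 + (X.2 - (t₀ + σ)) ^ 2 with hQ
  -- A nonsmooth mean value inequality: the point `X` is decoupled from the segment by a quadratic
  -- penalty, so that the minimum over `X` supplies a proximal subgradient and the minimum over `σ`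
  -- a bound on its slope.
  set Φ : (Eucl n × ℝ) × ℝ → ℝ := fun Z => w Z.1.1 Z.1.2 + Q Z.1 Z.2 / ε - c' * Z.2 with hΦ
  have hmemT : ∀ X ∈ closedBall (x₀, t₀) r, X.2 ∈ Ioo 0 T := fun X hX => by
    have : |X.2 - t₀| ≤ r := by
      rw [← Real.dist_eq]
      exact le_trans (by rw [Prod.dist_eq]; exact le_max_right _ _) (mem_closedBall.1 hX)
    have := abs_le.1 this
    constructor <;> linarith
  have hwcont : ContinuousOn (fun X : Eucl n × ℝ => w X.1 X.2) (closedBall (x₀, t₀) r) := by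
    refine (LipschitzOnWith.of_dist_le_mul (K := ⟨2 * K, by positivity⟩)
      fun X hX Y hY => ?_).continuousOn
    rw [Real.dist_eq]
    refine (hlip X.1 Y.1 Y.2 (Ioo_subset_Icc_self (hmemT Y hY)) X.2
      (Ioo_subset_Icc_self (hmemT X hX))).trans ?_
    have e1 : ‖X.1 - Y.1‖ ≤ dist X Y := by
      rw [Prod.dist_eq, ← dist_eq_norm]; exact le_max_left _ _
    have e2 : |X.2 - Y.2| ≤ dist X Y := by
      rw [Prod.dist_eq, ← Real.dist_eq]; exact le_max_right _ _
    change _ ≤ 2 * K * _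
    nlinarith
  have hΦcont : ContinuousOn Φ (closedBall (x₀, t₀) r ×ˢ Icc (-τ) 0) := by
    have h1 : ContinuousOn (fun Z : (Eucl n × ℝ) × ℝ => w Z.1.1 Z.1.2)
        (closedBall (x₀, t₀) r ×ˢ Icc (-τ) 0) :=
      hwcont.comp continuous_fst.continuousOn fun Z hZ => hZ.1
    have h2 : Continuous (fun Z : (Eucl n × ℝ) × ℝ => Q Z.1 Z.2 / ε - c' * Z.2) := by
      simp only [hQ]; fun_prop
    refine (h1.add h2.continuousOn).congr fun Z _ => ?_
    change _ = w Z.1.1 Z.1.2 + (Q Z.1 Z.2 / ε - c' * Z.2)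
    simp only [hΦ]; ring
  have hℓ : ∀ σ ∈ Icc (-τ) 0, dist (x₀ + σ • v, t₀ + σ) (x₀, t₀) ≤ r / 2 := fun σ hσ => by
    rw [Prod.dist_eq, dist_eq_norm, Real.dist_eq, add_sub_cancel_left, add_sub_cancel_left,
      norm_smul, Real.norm_eq_abs]
    have : |σ| ≤ τ := abs_le.2 ⟨hσ.1, by linarith [hσ.2]⟩
    refine max_le ?_ ?_ <;> nlinarith [norm_nonneg v]
  have hℓmem : ∀ σ ∈ Icc (-τ) 0, (x₀ + σ • v, t₀ + σ) ∈ closedBall (x₀, t₀) r := fun σ hσ =>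
    mem_closedBall.2 ((hℓ σ hσ).trans (by linarith))
  have hQℓ : ∀ σ, Q (x₀ + σ • v, t₀ + σ) σ = 0 := fun σ => by simp [hQ]
  obtain ⟨⟨X, σ⟩, ⟨hX, hσ⟩, hmin⟩ := ((isCompact_closedBall (x₀, t₀) r).prod
    (isCompact_Icc (a := -τ) (b := 0))).exists_isMinOn
      ⟨((x₀, t₀), 0), mem_closedBall_self hr.le, by simp [hτ.le]⟩ hΦcont
  have hτmem : -τ ∈ Icc (-τ) 0 := ⟨le_rfl, by linarith⟩
  simp only at hX hσ
  -- The minimum is not attained at the end point of the segment.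
  have hstart : Φ ((x₀ + (-τ) • v, t₀ + -τ), -τ) ≤ w₀ - τ * δ / 2 := by
    have h1 := (hloc ((mem_closedBall.1 (hℓmem _ hτmem)).trans_lt hrr')).2
    simp only [hΦ, hQℓ, zero_div]
    simp only at h1
    rw [hc']
    linarith
  have hσ0 : σ < 0 := by
    rcases hσ.2.lt_or_eq with h | h
    · exact h
    exfalso
    subst h
    have h1 := (hmin (show ((x₀ + (-τ) • v, t₀ + -τ), -τ) ∈ _ from ⟨hℓmem _ hτmem, hτmem⟩)).trans
      hstart
    have h2 := (abs_le.1 (hlip x₀ X.1 X.2 (Ioo_subset_Icc_self (hmemT X hX)) t₀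
      ⟨ht₀.le, htT.le⟩)).2
    simp only [hΦ, hQ, zero_smul, add_zero, mul_zero, sub_zero] at h1
    rw [norm_sub_rev, abs_sub_comm] at h2
    set a := ‖X.1 - x₀‖
    set b := |X.2 - t₀| with hb
    rw [← sq_abs (X.2 - t₀), ← hb] at h1
    have h3 : K * (a + b) - (a ^ 2 + b ^ 2) / ε ≤ K ^ 2 * ε / 2 := by
      rw [sub_le_iff_le_add, ← sub_le_iff_le_add', le_div_iff₀ hε]
      nlinarith [sq_nonneg (a - K * ε / 2), sq_nonneg (b - K * ε / 2)]
    linarith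
  have hclose := hmin (show ((x₀ + σ • v, t₀ + σ), σ) ∈ _ from ⟨hℓmem _ hσ, hσ⟩)
  set a := ‖X.1 - (x₀ + σ • v)‖ with ha
  set b := |X.2 - (t₀ + σ)| with hb
  have hab : a ^ 2 + b ^ 2 ≤ K * (a + b) * ε := by
    have h2 := (abs_le.1 (hlip (x₀ + σ • v) X.1 X.2 (Ioo_subset_Icc_self (hmemT X hX)) (t₀ + σ)
      (Ioo_subset_Icc_self (hmemT _ (hℓmem _ hσ))))).2
    rw [norm_sub_rev, abs_sub_comm, ← ha, ← hb] at h2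
    simp only [hΦ, mem_ofPred_eq, hQℓ, zero_div, add_zero] at hclose
    simp only [hQ] at hclose
    rw [← ha, ← sq_abs (X.2 - (t₀ + σ)), ← hb] at hclose
    have h3 : (a ^ 2 + b ^ 2) / ε ≤ K * (a + b) := by linarith
    rwa [div_le_iff₀ hε] at h3
  have ha0 : 0 ≤ a := norm_nonneg _
  have hb0 : 0 ≤ b := abs_nonneg _
  have hmaxab : max a b ≤ 2 * K * ε := by
    refine (max_le_of_sq_add_sq_le ha0 hb0 (k := K * ε) (by positivity) ?_).trans ?_
    · linarith
    · linarith
  have hXdist : dist X (x₀, t₀) < r := by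
    have h1 : dist X (x₀ + σ • v, t₀ + σ) ≤ 2 * K * ε := by
      rw [Prod.dist_eq, dist_eq_norm, Real.dist_eq]; exact hmaxab
    have := dist_triangle X (x₀ + σ • v, t₀ + σ) (x₀, t₀)
    linarith [hℓ σ hσ]
  obtain ⟨x, t⟩ := X
  set p : Eucl n := (-(2 / ε)) • (x - (x₀ + σ • v)) with hp
  set q : ℝ := -(2 / ε) * (t - (t₀ + σ)) with hq
  have hproxX : HasProxSubgradient w x t p q := by
    refine ⟨1 / ε, by positivity, ?_⟩
    filter_upwards [isOpen_ball.mem_nhds (show (x, t) ∈ ball (x₀, t₀) r from hXdist)] with Y hY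
    have h1 := hmin (show (Y, σ) ∈ _ from ⟨ball_subset_closedBall hY, hσ⟩)
    simp only [hΦ, hQ, mem_ofPred_eq] at h1
    have h2 : ‖Y.1 - (x₀ + σ • v)‖ ^ 2 = ‖Y.1 - x‖ ^ 2
        + 2 * inner ℝ (x - (x₀ + σ • v)) (Y.1 - x) + ‖x - (x₀ + σ • v)‖ ^ 2 := by
      rw [show Y.1 - (x₀ + σ • v) = (Y.1 - x) + (x - (x₀ + σ • v)) by abel, norm_add_sq_real,
        real_inner_comm]
    rw [h2] at h1
    rw [hp, hq, real_inner_smul_left]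
    have h3 : (‖Y.1 - x‖ ^ 2 + 2 * inner ℝ (x - (x₀ + σ • v)) (Y.1 - x)
        + ‖x - (x₀ + σ • v)‖ ^ 2 + (Y.2 - (t₀ + σ)) ^ 2) / ε
        = (‖x - (x₀ + σ • v)‖ ^ 2 + (t - (t₀ + σ)) ^ 2) / ε
          + 2 / ε * inner ℝ (x - (x₀ + σ • v)) (Y.1 - x) + 2 / ε * (t - (t₀ + σ)) * (Y.2 - t)
          + 1 / ε * (‖Y.1 - x‖ ^ 2 + (Y.2 - t) ^ 2) := by
      field_simp
      ring
    rw [h3] at h1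
    linarith
  have ht := hmemT _ hX
  have hineq := hprox x t p q ht.1 ht.2 hproxX
  have hupper := (hloc (hXdist.trans hrr')).1 p
  simp only at hupper
  -- Only increments `s > 0` of `σ` are used, so `σ = -τ` is harmless and only the right end of the
  -- segment had to be excluded.
  have hlower : c' ≤ inner ℝ p v + q := by
    by_contra hlt
    push Not at hlt
    set gap := c' - (inner ℝ p v + q) with hgap
    have hgap0 : 0 < gap := by rw [hgap]; linarith
    have hd : 0 < ‖v‖ ^ 2 + 1 := by positivity
    set s := min (-σ) (gap * ε / (2 * (‖v‖ ^ 2 + 1))) with hs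
    have hs0 : 0 < s := lt_min (by linarith) (by positivity)
    have hs1 : s ≤ -σ := min_le_left _ _
    have hs2 : s * (2 * (‖v‖ ^ 2 + 1)) ≤ gap * ε := by
      rw [← le_div_iff₀ (by positivity)]; exact min_le_right _ _
    have h1 := hmin (show ((x, t), σ + s) ∈ _ from
      ⟨hX, by simp only [mem_Icc]; constructor <;> linarith [hσ.1]⟩)
    simp only [hΦ, hQ, mem_ofPred_eq] at h1
    have h2 : ‖x - (x₀ + (σ + s) • v)‖ ^ 2 = ‖x - (x₀ + σ • v)‖ ^ 2
        - 2 * s * inner ℝ (x - (x₀ + σ • v)) v + s ^ 2 * ‖v‖ ^ 2 := by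
      rw [show x - (x₀ + (σ + s) • v) = (x - (x₀ + σ • v)) - s • v by rw [add_smul]; abel,
        norm_sub_sq_real, real_inner_smul_right, norm_smul, Real.norm_eq_abs, mul_pow, sq_abs]
      ring
    rw [h2] at h1
    have h3 : (‖x - (x₀ + σ • v)‖ ^ 2 - 2 * s * inner ℝ (x - (x₀ + σ • v)) v + s ^ 2 * ‖v‖ ^ 2
        + (t - (t₀ + (σ + s))) ^ 2) / ε
        = (‖x - (x₀ + σ • v)‖ ^ 2 + (t - (t₀ + σ)) ^ 2) / ε + s * (inner ℝ p v + q)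
          + s * (s * (‖v‖ ^ 2 + 1) / ε) := by
      rw [hp, hq, real_inner_smul_left]
      field_simp
      ring
    rw [h3] at h1
    have h4 : s * (‖v‖ ^ 2 + 1) / ε ≤ gap / 2 := by
      rw [div_le_iff₀ hε]; linarith
    have h5 := mul_le_mul_of_nonneg_left h4 hs0.le
    have h6 : s * gap = s * c' - s * (inner ℝ p v + q) := by rw [hgap]; ring
    have h7 : 0 < s * gap := by positivity
    linarith
  linarith

end

/-! ### Local test functions versus global strict ones. -/

section

variable {n : ℕ} {H : Eucl n → Eucl n → ℝ → ℝ}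

lemma hasFDerivAt_sq_dist (z : Eucl n × ℝ) :
    HasFDerivAt (fun Y : Eucl n × ℝ => ‖Y.1 - z.1‖ ^ 2 + (Y.2 - z.2) ^ 2)
      (0 : (Eucl n × ℝ) →L[ℝ] ℝ) z := by
  have h1 : HasFDerivAt (fun Y : Eucl n × ℝ => Y.1 - z.1) (ContinuousLinearMap.fst ℝ _ _) z :=
    hasFDerivAt_fst.sub_const _
  have h2 : HasFDerivAt (fun Y : Eucl n × ℝ => Y.2 - z.2) (ContinuousLinearMap.snd ℝ _ _) z :=
    hasFDerivAt_snd.sub_const _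
  refine (h1.norm_sq.add (h2.pow 2)).congr_fderiv ?_
  ext <;> simp

/-- The given notion of solution admits only test functions touching strictly and globally, while
the arguments produce local ones. A quadratic term makes the contact strict, and a partition of
unity glues the result to constants majorizing `f` away from `z`. -/
lemma exists_global_test {f : Eucl n × ℝ → ℝ} {χ : Eucl n × ℝ → ℝ} {z : Eucl n × ℝ}
    (hbdd : ∀ X : Eucl n × ℝ, ∃ c, ∀ᶠ Y in 𝓝 X, 0 < Y.2 → f Y ≤ c)
    (hχ : ContDiffAt ℝ 1 χ z) (hmax : IsLocalMax (fun Y => f Y - χ Y) z)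
    {L : (Eucl n × ℝ) →L[ℝ] ℝ} (hL : HasFDerivAt χ L z) :
    ∃ ψ : Eucl n × ℝ → ℝ, ContDiff ℝ 1 ψ ∧ ψ z = f z ∧ HasFDerivAt ψ L z ∧
      ∀ Y, 0 < Y.2 → Y ≠ z → f Y < ψ Y := by
  set χ' : Eucl n × ℝ → ℝ := fun Y => χ Y + (f z - χ z) + (‖Y.1 - z.1‖ ^ 2 + (Y.2 - z.2) ^ 2)
    with hχ'
  obtain ⟨V, hV, hVχ⟩ := hχ.contDiffOn (m := 1) le_rfl (by simp)
  obtain ⟨r, hr, hball⟩ := Metric.eventually_nhds_iff.1 (hmax.and hV)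
  have hsmooth : ContDiffOn ℝ 1 χ' (ball z r) := by
    have h1 : ContDiff ℝ 1 (fun Y : Eucl n × ℝ => ‖Y.1 - z.1‖ ^ 2 + (Y.2 - z.2) ^ 2) :=
      ((contDiff_fst.sub contDiff_const).norm_sq ℝ).add
        ((contDiff_snd.sub contDiff_const).pow 2)
    have h2 : ContDiffOn ℝ 1 χ (ball z r) :=
      (hVχ.mono fun Y hY => (hball hY).2)
    exact (h2.add contDiffOn_const).add h1.contDiffOn
  have hstrict : ∀ Y ∈ ball z r, Y ≠ z → f Y < χ' Y := fun Y hY hne => by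
    have h1 := (hball hY).1
    have h2 : 0 < ‖Y.1 - z.1‖ ^ 2 + (Y.2 - z.2) ^ 2 := by
      by_cases h3 : Y.1 = z.1
      · have h4 : Y.2 - z.2 ≠ 0 := fun h5 => hne (Prod.ext h3 (sub_eq_zero.1 h5))
        positivity
      · have h4 : 0 < ‖Y.1 - z.1‖ := norm_pos_iff.2 (sub_ne_zero.2 h3)
        positivity
    simp only [hχ']
    simp only at h1
    linarith
  classical
  -- The admissible values at each point form a convex set: prescribed exactly near `z`, an open
  -- upper half-line elsewhere, and unrestricted at nonpositive times, where `f` is not controlled.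
  set S : Eucl n × ℝ → Set ℝ := fun Y =>
    if Y ∈ closedBall z (r / 2) then {χ' Y} else {y | 0 < Y.2 → f Y < y} with hS
  have hconv : ∀ Y, Convex ℝ (S Y) := fun Y => by
    simp only [hS]
    split_ifs
    · exact convex_singleton _
    · by_cases hY : 0 < Y.2
      · simp only [hY, forall_const]; exact convex_Ioi (f Y)
      · simp only [hY, IsEmpty.forall_iff]; exact convex_univ
  obtain ⟨g, hg⟩ := exists_contMDiffMap_forall_mem_convex_of_local (n := 1)
    (modelWithCornersSelf ℝ (Eucl n × ℝ)) hconv (fun X => by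
      by_cases hX : X ∈ ball z r
      · refine ⟨ball z r, isOpen_ball.mem_nhds hX, χ', hsmooth.contMDiffOn, fun Y hY => ?_⟩
        simp only [hS]
        split_ifs with h
        · rfl
        · intro _
          exact hstrict Y hY fun h2 => h (h2 ▸ mem_closedBall_self (by positivity))
      · obtain ⟨c, hc⟩ := hbdd X
        have hout : X ∈ (closedBall z (r / 2))ᶜ := fun h =>
          hX (closedBall_subset_ball (by linarith) h)
        refine ⟨_, inter_mem hc (isClosed_closedBall.isOpen_compl.mem_nhds hout),
          fun _ => c + 1, contMDiffOn_const, fun Y hY => ?_⟩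
        simp only [hS]
        rw [if_neg hY.2]
        intro h0
        linarith [hY.1 h0])
  have hgχ : ∀ Y ∈ closedBall z (r / 2), g Y = χ' Y := fun Y hY => by
    have := hg Y
    simp only [hS, if_pos hY] at this
    exact this
  have hz : z ∈ closedBall z (r / 2) := mem_closedBall_self (by positivity)
  refine ⟨g, g.contMDiff.contDiff, ?_, ?_, fun Y hY hne => ?_⟩
  · rw [hgχ z hz]
    simp [hχ']
  · have h1 : HasFDerivAt χ' L z :=
      ((hL.add_const (f z - χ z)).add (hasFDerivAt_sq_dist z)).congr_fderiv (add_zero L)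
    refine h1.congr_of_eventuallyEq ?_
    filter_upwards [closedBall_mem_nhds z (by positivity : 0 < r / 2)] with Y hY using hgχ Y hY
  · by_cases h : Y ∈ closedBall z (r / 2)
    · rw [hgχ Y h]
      exact hstrict Y (closedBall_subset_ball (by linarith) h) hne
    · have := hg Y
      simp only [hS, if_neg h] at this
      exact this hY

lemma exists_locally_bounded {u : Eucl n → ℝ → ℝ}
    (hlip : ∀ T : ℝ, 0 < T → ∃ K : NNReal,
      LipschitzOnWith K (fun z : Eucl n × ℝ => u z.1 z.2) (univ ×ˢ Icc 0 T)) (X : Eucl n × ℝ) :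
    ∃ c, ∀ᶠ Y in 𝓝 X, 0 < Y.2 → |u Y.1 Y.2| ≤ c := by
  obtain ⟨K, hK⟩ := hlip (|X.2| + 1) (by positivity)
  refine ⟨|u X.1 0| + K * (|X.2| + 1), ?_⟩
  filter_upwards [ball_mem_nhds X one_pos] with Y hY hY0
  rw [mem_ball, Prod.dist_eq, max_lt_iff, Real.dist_eq] at hY
  have hY2 : Y.2 ≤ |X.2| + 1 := by linarith [(abs_lt.1 hY.2).2, le_abs_self X.2]
  have h1 := hK.dist_le_mul Y ⟨mem_univ _, hY0.le, hY2⟩ (X.1, 0)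
    ⟨mem_univ _, le_rfl, by positivity⟩
  rw [Real.dist_eq, Prod.dist_eq, Real.dist_eq] at h1
  have h2 : max (dist Y.1 X.1) |Y.2 - 0| ≤ |X.2| + 1 := by
    refine max_le (by linarith [abs_nonneg X.2, hY.1]) ?_
    rw [sub_zero, abs_of_pos hY0]; exact hY2
  have h3 := h1.trans (mul_le_mul_of_nonneg_left h2 K.2)
  have h4 := abs_sub_abs_le_abs_sub (u Y.1 Y.2) (u X.1 0)
  simp only at h3
  change _ ≤ (K : ℝ) * _ at h3
  linarith

lemma IsLipViscositySolution.isLocalSub {φ : Eucl n → ℝ} {u : Eucl n → ℝ → ℝ}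
    (hu : IsLipViscositySolution H φ u) (T : ℝ) : IsLocalSub H T u := by
  intro χ x t p q ht _ hχ hχd hmax
  obtain ⟨ψ, hψ, hψz, hψd, hstrict⟩ := exists_global_test
    (f := fun Y : Eucl n × ℝ => u Y.1 Y.2) (fun X => by
      obtain ⟨c, hc⟩ := exists_locally_bounded hu.lip X
      exact ⟨c, hc.mono fun Y hY h0 => (le_abs_self _).trans (hY h0)⟩) hχ hmax hχd
  have := hu.sub.1 ψ hψ.contDiffOn x t ht hψz.symm fun y s hs hne => by
    have := hstrict (y, s) hs hne
    simp only at this hψz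
    linarith
  rw [gradient_slice_eq hψd, deriv_slice_eq hψd, hψz] at this
  exact this

lemma IsLipViscositySolution.isLocalSuper {φ : Eucl n → ℝ} {u : Eucl n → ℝ → ℝ}
    (hu : IsLipViscositySolution H φ u) (T : ℝ) : IsLocalSuper H T u := by
  intro χ x t p q ht _ hχ hχd hmin
  have hd : HasFDerivAt (fun Y => -χ Y) (planeForm (-p) (-q)) (x, t) :=
    hχd.neg.congr_fderiv (planeForm_neg p q).symm
  obtain ⟨ψ, hψ, hψz, hψd, hstrict⟩ := exists_global_test
    (f := fun Y : Eucl n × ℝ => -u Y.1 Y.2) (χ := fun Y => -χ Y) (fun X => by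
      obtain ⟨c, hc⟩ := exists_locally_bounded hu.lip X
      exact ⟨c, hc.mono fun Y hY h0 => (neg_le_abs _).trans (hY h0)⟩) hχ.neg
    (by
      filter_upwards [hmin] with Y hY
      linarith) hd
  have hψd' : HasFDerivAt (fun Y => -ψ Y) (planeForm p q) (x, t) := by
    refine hψd.neg.congr_fderiv ?_
    rw [planeForm_neg, neg_neg]
  have := hu.super.1 (fun Y => -ψ Y) hψ.neg.contDiffOn x t ht (by rw [hψz, neg_neg])
    fun y s hs hne => by
      have := hstrict (y, s) hs hne
      simp only at this hψz
      linarith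
  rw [gradient_slice_eq hψd', deriv_slice_eq hψd'] at this
  simp only [hψz, neg_neg] at this
  exact this

lemma IsLocalSub.isViscositySubsolution {φ : Eucl n → ℝ} {u : Eucl n → ℝ → ℝ}
    (hu : ∀ T, IsLocalSub H T u) (h0 : ∀ x, u x 0 ≤ φ x) : IsViscositySubsolution H φ u := by
  refine ⟨fun ψ hψ x t ht hval hmax => ?_, h0⟩
  have hopen : (univ ×ˢ Ioi (0 : ℝ) : Set (Eucl n × ℝ)) ∈ 𝓝 (x, t) :=
    (isOpen_univ.prod isOpen_Ioi).mem_nhds ⟨mem_univ _, ht⟩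
  have hψx := hψ.contDiffAt hopen
  obtain ⟨p, q, hpq⟩ := exists_hasFDerivAt_planeForm (hψx.differentiableAt one_ne_zero)
  rw [gradient_slice_eq hpq, deriv_slice_eq hpq, ← hval]
  refine hu (t + 1) ψ x t p q ht (by linarith) hψx hpq ?_
  filter_upwards [hopen] with Y hY
  by_cases hne : Y = (x, t)
  · rw [hne]
  · exact (hmax Y.1 Y.2 hY.2 hne).le

lemma IsLocalSuper.isViscositySupersolution {φ : Eucl n → ℝ} {u : Eucl n → ℝ → ℝ}
    (hu : ∀ T, IsLocalSuper H T u) (h0 : ∀ x, φ x ≤ u x 0) :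
    IsViscositySupersolution H φ u := by
  refine ⟨fun ψ hψ x t ht hval hmin => ?_, h0⟩
  have hopen : (univ ×ˢ Ioi (0 : ℝ) : Set (Eucl n × ℝ)) ∈ 𝓝 (x, t) :=
    (isOpen_univ.prod isOpen_Ioi).mem_nhds ⟨mem_univ _, ht⟩
  have hψx := hψ.contDiffAt hopen
  obtain ⟨p, q, hpq⟩ := exists_hasFDerivAt_planeForm (hψx.differentiableAt one_ne_zero)
  rw [gradient_slice_eq hpq, deriv_slice_eq hpq, ← hval]
  refine hu (t + 1) ψ x t p q ht (by linarith) hψx hpq ?_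
  filter_upwards [hopen] with Y hY
  by_cases hne : Y = (x, t)
  · rw [hne]
  · exact (hmin Y.1 Y.2 hY.2 hne).le

end

/-! ### Gradient bound and barrier for the comparison principle. -/

section

variable {n : ℕ} {H : Eucl n → Eucl n → ℝ → ℝ}

/-- A test function touching a `K`-Lipschitz function from above has a gradient of norm at most
`K`. -/
lemma norm_le_of_isLocalMax {w : Eucl n → ℝ → ℝ} {χ : Eucl n × ℝ → ℝ} {x p : Eucl n}
    {t q K : ℝ} (hK : 0 < K) (hlip : ∀ y, |w y t - w x t| ≤ K * ‖y - x‖)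
    (hχ : HasFDerivAt χ (planeForm p q) (x, t))
    (hmax : IsLocalMax (fun Y => w Y.1 Y.2 - χ Y) (x, t)) : ‖p‖ ≤ K := by
  refine le_of_forall_pos_le_add fun ε hε => ?_
  have hcurve : Tendsto (fun s : ℝ => (x - s • p, t)) (𝓝[>] 0) (𝓝 (x, t)) := by
    have hcont : Continuous (fun s : ℝ => (x - s • p, t)) := by fun_prop
    have := hcont.tendsto 0
    simp only [zero_smul, sub_zero] at this
    exact this.mono_left nhdsWithin_le_nhds
  have h0 : ∀ᶠ s : ℝ in 𝓝[>] 0, 0 < s := self_mem_nhdsWithin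
  obtain ⟨s, ⟨h1, h2⟩, hs⟩ :=
    ((hcurve.eventually ((hχ.isLittleO.def hε).and hmax)).and h0).exists
  have h3 := (abs_le.1 (hlip (x - s • p))).1
  rw [sub_sub_cancel_left, norm_neg, norm_smul, Real.norm_eq_abs, abs_of_pos hs] at h3
  have h4 : ‖((x - s • p, t) : Eucl n × ℝ) - (x, t)‖ = s * ‖p‖ := by
    rw [Prod.mk_sub_mk, sub_sub_cancel_left, sub_self, Prod.norm_def, norm_neg, norm_smul,
      Real.norm_eq_abs, abs_of_pos hs, norm_zero]
    exact max_eq_left (by positivity)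
  rw [h4] at h1
  have h5 := (abs_le.1 h1).2
  simp only [planeForm_apply, Prod.mk_sub_mk, sub_sub_cancel_left, sub_self, mul_zero, add_zero,
    inner_neg_right, real_inner_smul_right, real_inner_self_eq_norm_sq] at h5
  simp only at h2
  rcases (norm_nonneg p).eq_or_lt with hp | hp
  · rw [← hp]; positivity
  · have h6 : s * ‖p‖ * ‖p‖ ≤ s * ‖p‖ * (K + ε) := by nlinarith
    exact le_of_mul_le_mul_left h6 (by positivity)

/-- The barrier in time used in the comparison principle. -/
noncomputable def timeBarrier (Λ T t : ℝ) : ℝ := Real.exp (Λ * t) / (T - t)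

lemma hasDerivAt_timeBarrier {Λ T t : ℝ} (ht : t < T) :
    HasDerivAt (timeBarrier Λ T) (Λ * timeBarrier Λ T t + timeBarrier Λ T t / (T - t)) t := by
  have hne : T - t ≠ 0 := by linarith
  have h1 : HasDerivAt (fun t : ℝ => Real.exp (Λ * t)) (Real.exp (Λ * t) * (Λ * 1)) t :=
    ((hasDerivAt_id t).const_mul Λ).exp
  have h2 : HasDerivAt (fun t : ℝ => T - t) (-1) t := by
    simpa using (hasDerivAt_id t).const_sub T
  refine (h1.div h2 hne).congr_deriv ?_
  rw [timeBarrier]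
  field_simp
  ring

lemma contDiffAt_timeBarrier {Λ T t : ℝ} (ht : t < T) : ContDiffAt ℝ 1 (timeBarrier Λ T) t := by
  have hne : T - t ≠ 0 := by linarith
  unfold timeBarrier
  exact ContDiffAt.div (by fun_prop) (by fun_prop) hne

lemma inv_le_timeBarrier {Λ T t : ℝ} (hΛ : 0 ≤ Λ) (ht0 : 0 ≤ t) (ht : t < T) :
    (T - t)⁻¹ ≤ timeBarrier Λ T t := by
  rw [timeBarrier, div_eq_mul_inv]
  have h1 : 1 ≤ Real.exp (Λ * t) := Real.one_le_exp (by positivity)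
  have h2 : 0 < (T - t)⁻¹ := by rw [inv_pos]; linarith
  nlinarith

lemma hasFDerivAt_half_sq_dist (x y : Eucl n) (t s ε : ℝ) :
    HasFDerivAt (fun Y : Eucl n × ℝ => (‖Y.1 - y‖ ^ 2 + (Y.2 - s) ^ 2) / (2 * ε))
      (planeForm ((1 / ε) • (x - y)) ((t - s) / ε)) (x, t) := by
  have h1 : HasFDerivAt (fun Y : Eucl n × ℝ => Y.1 - y) (ContinuousLinearMap.fst ℝ _ _) (x, t) :=
    hasFDerivAt_fst.sub_const _
  have h2 : HasFDerivAt (fun Y : Eucl n × ℝ => Y.2 - s) (ContinuousLinearMap.snd ℝ _ _) (x, t) :=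
    hasFDerivAt_snd.sub_const _
  have h3 := (h1.norm_sq.add (h2.pow 2)).mul_const (2 * ε)⁻¹
  simp only [← div_eq_mul_inv] at h3
  refine h3.congr_fderiv ?_
  refine ContinuousLinearMap.ext fun e => ?_
  rcases eq_or_ne ε 0 with rfl | hε
  · simp
  · simp [real_inner_smul_left]
    field_simp
    rw [inner_sub_left]

lemma hasFDerivAt_barrier (δ Λ T : ℝ) {x : Eucl n} {t : ℝ} (ht : t < T) :
    HasFDerivAt (fun Y : Eucl n × ℝ => δ * (timeBarrier Λ T Y.2 * (1 + ‖Y.1‖ ^ 2)))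
      (planeForm ((2 * (δ * timeBarrier Λ T t)) • x) (δ * ((Λ * timeBarrier Λ T t
        + timeBarrier Λ T t / (T - t)) * (1 + ‖x‖ ^ 2)))) (x, t) := by
  have h1 : HasFDerivAt (fun Y : Eucl n × ℝ => Y.1) (ContinuousLinearMap.fst ℝ _ _) (x, t) :=
    hasFDerivAt_fst
  have h2 : HasFDerivAt (fun Y : Eucl n × ℝ => Y.2) (ContinuousLinearMap.snd ℝ _ _) (x, t) :=
    hasFDerivAt_snd
  have h3 := (hasDerivAt_timeBarrier (Λ := Λ) ht).comp_hasFDerivAt (x, t) h2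
  refine ((h3.mul (h1.norm_sq.const_add 1)).const_mul δ).congr_fderiv ?_
  refine ContinuousLinearMap.ext fun e => ?_
  simp [real_inner_smul_left]
  ring

end

/-! ### Doubling of variables. -/

section

variable {n : ℕ} {H : Eucl n → Eucl n → ℝ → ℝ}

/-- The doubled function of the comparison principle. -/
noncomputable def doubled (u v : Eucl n → ℝ → ℝ) (ε δ Λ T : ℝ)
    (Z : (Eucl n × ℝ) × Eucl n × ℝ) : ℝ :=
  u Z.1.1 Z.1.2 - v Z.2.1 Z.2.2
    - (‖Z.1.1 - Z.2.1‖ ^ 2 + (Z.1.2 - Z.2.2) ^ 2) / (2 * ε)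
    - δ * (timeBarrier Λ T Z.1.2 * (1 + ‖Z.1.1‖ ^ 2))

lemma continuousOn_strip {u : Eucl n → ℝ → ℝ} {K T : ℝ} (hK : 0 < K)
    (hu : ∀ x y : Eucl n, ∀ s ∈ Icc 0 T, ∀ t ∈ Icc 0 T,
      |u x t - u y s| ≤ K * (‖x - y‖ + |t - s|)) :
    ContinuousOn (fun X : Eucl n × ℝ => u X.1 X.2) (univ ×ˢ Icc 0 T) := by
  refine (LipschitzOnWith.of_dist_le_mul (K := ⟨2 * K, by positivity⟩)
    fun X hX Y hY => ?_).continuousOn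
  rw [Real.dist_eq]
  refine (hu X.1 Y.1 Y.2 hY.2 X.2 hX.2).trans ?_
  have e1 : ‖X.1 - Y.1‖ ≤ dist X Y := by
    rw [Prod.dist_eq, ← dist_eq_norm]; exact le_max_left _ _
  have e2 : |X.2 - Y.2| ≤ dist X Y := by
    rw [Prod.dist_eq, ← Real.dist_eq]; exact le_max_right _ _
  change _ ≤ 2 * K * _
  nlinarith

/-- The doubled function attains its maximum in a compact set that does not depend on `ε`. -/
lemma exists_max_doubled {u v : Eucl n → ℝ → ℝ} {K T B δ Λ : ℝ} (hK : 0 < K)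
    (hB : 0 < B) (hδ : 0 < δ) (hΛ : 0 ≤ Λ)
    (hu : ∀ x y : Eucl n, ∀ s ∈ Icc 0 T, ∀ t ∈ Icc 0 T,
      |u x t - u y s| ≤ K * (‖x - y‖ + |t - s|))
    (hv : ∀ x y : Eucl n, ∀ s ∈ Icc 0 T, ∀ t ∈ Icc 0 T,
      |v x t - v y s| ≤ K * (‖x - y‖ + |t - s|))
    (huB : ∀ x : Eucl n, ∀ t ∈ Icc 0 T, |u x t| ≤ B)
    (hvB : ∀ x : Eucl n, ∀ t ∈ Icc 0 T, |v x t| ≤ B)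
    {x₁ : Eucl n} {t₁ : ℝ} (ht₁ : t₁ ∈ Ico 0 T)
    (hpos : δ * (timeBarrier Λ T t₁ * (1 + ‖x₁‖ ^ 2)) < u x₁ t₁ - v x₁ t₁) :
    ∃ ρ θ : ℝ, 0 < θ ∧ ∀ ε : ℝ, 0 < ε → ε ≤ 1 → ∃ x t y s, ‖x‖ ≤ ρ ∧ ‖y‖ ≤ ρ ∧
      t ∈ Icc 0 (T - θ) ∧ s ∈ Icc 0 T ∧ 0 < doubled u v ε δ Λ T ((x, t), y, s) ∧
      ∀ x' t' y' s', t' ∈ Ico 0 T → s' ∈ Icc 0 T →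
        doubled u v ε δ Λ T ((x', t'), y', s') ≤ doubled u v ε δ Λ T ((x, t), y, s) := by
  -- Where the doubled function is positive, the barrier is at most `2 * B`, that is `δ * (1 + ‖x‖ ^
  -- 2) ≤ 2 * B * (T - t)`. This gives both the radius `ρ₀` and the distance `θ` from the final
  -- time.
  set ρ₀ := 2 * B * T / δ with hρ₀
  set θ := δ / (2 * B) with hθ
  refine ⟨ρ₀ + 2 + 2 * B, θ, by positivity, fun ε hε hε1 => ?_⟩
  have hbar : ∀ (x : Eucl n) (t : ℝ), t ∈ Ico 0 T →
      δ * (timeBarrier Λ T t * (1 + ‖x‖ ^ 2)) ≤ 2 * B → ‖x‖ ≤ ρ₀ ∧ t ≤ T - θ := by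
    intro x t ht hle
    have h1 := inv_le_timeBarrier hΛ ht.1 ht.2
    have hTt : 0 < T - t := by linarith [ht.2]
    have hinv : 0 < (T - t)⁻¹ := inv_pos.2 hTt
    have h2 : δ * ((T - t)⁻¹ * (1 + ‖x‖ ^ 2)) ≤ 2 * B :=
      le_trans (mul_le_mul_of_nonneg_left (mul_le_mul_of_nonneg_right h1 (by positivity)) hδ.le)
        hle
    have h3 : δ * (1 + ‖x‖ ^ 2) ≤ 2 * B * (T - t) := by
      have h4 := mul_le_mul_of_nonneg_right h2 hTt.le
      have h5 : δ * ((T - t)⁻¹ * (1 + ‖x‖ ^ 2)) * (T - t) = δ * (1 + ‖x‖ ^ 2) := by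
        field_simp
      linarith
    constructor
    · rw [hρ₀, le_div_iff₀ hδ]
      have h6 : ‖x‖ ≤ 1 + ‖x‖ ^ 2 := by nlinarith [sq_nonneg (‖x‖ - 1), norm_nonneg x]
      have h7 := mul_le_mul_of_nonneg_left h6 hδ.le
      have h8 : 2 * B * (T - t) ≤ 2 * B * T :=
        mul_le_mul_of_nonneg_left (by linarith [ht.1]) (by positivity)
      linarith
    · have h9 : θ ≤ T - t := by
        rw [hθ, div_le_iff₀ (by positivity)]
        have : 0 ≤ δ * ‖x‖ ^ 2 := by positivity
        linarith
      linarith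
  have hout : ∀ x t y s, t ∈ Ico 0 T → s ∈ Icc 0 T →
      0 < doubled u v ε δ Λ T ((x, t), y, s) →
      ‖x‖ ≤ ρ₀ ∧ t ≤ T - θ ∧ ‖y‖ ≤ ρ₀ + 2 + 2 * B := by
    intro x t y s ht hs hΦ
    simp only [doubled] at hΦ
    have h1 := (abs_le.1 (huB x t ⟨ht.1, ht.2.le⟩)).2
    have h2 := (abs_le.1 (hvB y s hs)).1
    have h3 : 0 ≤ (‖x - y‖ ^ 2 + (t - s) ^ 2) / (2 * ε) := by positivity
    have h4 : 0 ≤ δ * (timeBarrier Λ T t * (1 + ‖x‖ ^ 2)) := by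
      have h5 := inv_le_timeBarrier hΛ ht.1 ht.2
      have h6 : 0 < (T - t)⁻¹ := by rw [inv_pos]; linarith [ht.2]
      have : 0 ≤ timeBarrier Λ T t := by linarith
      positivity
    obtain ⟨h5, h6⟩ := hbar x t ht (by linarith)
    refine ⟨h5, h6, ?_⟩
    have h7 : (‖x - y‖ ^ 2 + (t - s) ^ 2) / (2 * ε) ≤ 2 * B := by linarith
    rw [div_le_iff₀ (by positivity)] at h7
    have h8 : ‖x - y‖ ≤ 2 + 2 * B := by
      have : 2 * B * (2 * ε) ≤ 4 * B := by nlinarith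
      nlinarith [sq_nonneg (t - s), norm_nonneg (x - y)]
    have h9 := norm_sub_norm_le y x
    rw [norm_sub_rev] at h9
    linarith
  have h₁ : 0 < doubled u v ε δ Λ T ((x₁, t₁), x₁, t₁) := by
    simp only [doubled, sub_self, norm_zero]
    norm_num
    linarith
  have ht₁' : t₁ ∈ Icc 0 T := ⟨ht₁.1, ht₁.2.le⟩
  obtain ⟨k1, k2, k3⟩ := hout x₁ t₁ x₁ t₁ ht₁ ht₁' h₁
  set S : Set ((Eucl n × ℝ) × Eucl n × ℝ) :=
    (closedBall 0 ρ₀ ×ˢ Icc 0 (T - θ)) ×ˢ (closedBall 0 (ρ₀ + 2 + 2 * B) ×ˢ Icc 0 T) with hS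
  have hSc : IsCompact S := ((isCompact_closedBall _ _).prod isCompact_Icc).prod
    ((isCompact_closedBall _ _).prod isCompact_Icc)
  have hθ0 : 0 < θ := by positivity
  have hcont : ContinuousOn (doubled u v ε δ Λ T) S := by
    have c1 : ContinuousOn (fun Z : (Eucl n × ℝ) × Eucl n × ℝ => u Z.1.1 Z.1.2) S :=
      (continuousOn_strip hK hu).comp continuous_fst.continuousOn fun Z hZ =>
        ⟨mem_univ _, hZ.1.2.1, by linarith [hZ.1.2.2]⟩
    have c2 : ContinuousOn (fun Z : (Eucl n × ℝ) × Eucl n × ℝ => v Z.2.1 Z.2.2) S :=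
      (continuousOn_strip hK hv).comp continuous_snd.continuousOn fun Z hZ =>
        ⟨mem_univ _, hZ.2.2⟩
    have c3 : ContinuousOn (fun Z : (Eucl n × ℝ) × Eucl n × ℝ =>
        (‖Z.1.1 - Z.2.1‖ ^ 2 + (Z.1.2 - Z.2.2) ^ 2) / (2 * ε)) S := by fun_prop
    have c4 : ContinuousOn (fun Z : (Eucl n × ℝ) × Eucl n × ℝ => timeBarrier Λ T Z.1.2) S := by
      intro Z hZ
      have : Z.1.2 < T := by linarith [hZ.1.2.2]
      have h5 := (hasDerivAt_timeBarrier (Λ := Λ) this).continuousAt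
      exact (ContinuousAt.comp (f := fun Z : (Eucl n × ℝ) × Eucl n × ℝ => Z.1.2) h5
        (by fun_prop)).continuousWithinAt
    have c5 : ContinuousOn (fun Z : (Eucl n × ℝ) × Eucl n × ℝ => 1 + ‖Z.1.1‖ ^ 2) S := by fun_prop
    exact ((c1.sub c2).sub c3).sub (continuousOn_const.mul (c4.mul c5))
  obtain ⟨⟨⟨x, t⟩, y, s⟩, hZ, hmax⟩ := hSc.exists_isMaxOn
    ⟨((x₁, t₁), x₁, t₁), ⟨by simpa using k1, ht₁.1, k2⟩, by simpa using k3, ht₁'⟩ hcont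
  have hge : ∀ Z ∈ S, doubled u v ε δ Λ T Z ≤ doubled u v ε δ Λ T ((x, t), y, s) :=
    fun Z hZ => hmax hZ
  have hpos' : 0 < doubled u v ε δ Λ T ((x, t), y, s) :=
    h₁.trans_le (hge _ ⟨⟨by simpa using k1, ht₁.1, k2⟩, by simpa using k3, ht₁'⟩)
  have hx : ‖x‖ ≤ ρ₀ := by simpa using hZ.1.1
  refine ⟨x, t, y, s, by linarith, by simpa using hZ.2.1, hZ.1.2, hZ.2.2, hpos', ?_⟩
  intro x' t' y' s' ht' hs'
  rcases le_or_gt (doubled u v ε δ Λ T ((x', t'), y', s')) 0 with h | h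
  · exact h.trans hpos'.le
  · obtain ⟨h1, h2, h3⟩ := hout x' t' y' s' ht' hs' h
    exact hge _ ⟨⟨by simpa using h1, ht'.1, h2⟩, by simpa using h3, hs'⟩

end

/-! ### The comparison principle. -/

section

variable {n : ℕ} {H : Eucl n → Eucl n → ℝ → ℝ}

set_option maxHeartbeats 1000000 in
/-- The key step of the comparison principle: an upper barrier for the difference of a subsolution
and a supersolution can be halved. -/
lemma barrier_halving (hH : IsContactHamiltonian H) {u v : Eucl n → ℝ → ℝ} {K T B : ℝ}
    (hK : 0 < K) (hT : 0 < T) (hB : 0 < B)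
    (hu : ∀ x y : Eucl n, ∀ s ∈ Icc 0 T, ∀ t ∈ Icc 0 T,
      |u x t - u y s| ≤ K * (‖x - y‖ + |t - s|))
    (hv : ∀ x y : Eucl n, ∀ s ∈ Icc 0 T, ∀ t ∈ Icc 0 T,
      |v x t - v y s| ≤ K * (‖x - y‖ + |t - s|))
    (huB : ∀ x : Eucl n, ∀ t ∈ Icc 0 T, |u x t| ≤ B)
    (hvB : ∀ x : Eucl n, ∀ t ∈ Icc 0 T, |v x t| ≤ B)
    (hsub : IsLocalSub H T u) (hsup : IsLocalSuper H T v) (h0 : ∀ x, u x 0 ≤ v x 0) :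
    ∃ Λ : ℝ, 0 < Λ ∧ ∀ δ : ℝ, 0 < δ →
      (∀ x : Eucl n, ∀ t ∈ Ico 0 T,
        u x t - v x t ≤ 2 * δ * (timeBarrier Λ T t * (1 + ‖x‖ ^ 2))) →
      ∀ x : Eucl n, ∀ t ∈ Ico 0 T,
        u x t - v x t ≤ δ * (timeBarrier Λ T t * (1 + ‖x‖ ^ 2)) := by
  obtain ⟨C, hC0, hC⟩ := hH.exists_lipschitz_u
  obtain ⟨KR, hKR0, hKR⟩ := hH.exists_lipschitz_p (4 * K)
  refine ⟨4 * KR + 2 * C + 1, by positivity, fun δ hδ hbound x₁ t₁ ht₁ => ?_⟩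
  -- `4 * KR` pays for the linear growth of the momentum derivative against the gradient of the
  -- barrier, `2 * C` for the dependence on `u`, and the remaining `1` leaves the surplus that
  -- contradicts maximality.
  set Λ := 4 * KR + 2 * C + 1 with hΛd
  have hΛ : 0 < Λ := by positivity
  by_contra hcon
  push Not at hcon
  obtain ⟨ρ, θ, hθ, hmaxs⟩ := exists_max_doubled hK hB hδ hΛ.le hu hv huB hvB ht₁ hcon
  -- Uniform continuity of the Hamiltonian on the relevant compact set.
  obtain ⟨ω, hω, hunif⟩ : ∃ ω > 0, ∀ x y p : Eucl n, ∀ r : ℝ, ‖x‖ ≤ ρ → ‖y‖ ≤ ρ → ‖p‖ ≤ 4 * K →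
      |r| ≤ B → ‖x - y‖ < ω → |H y p r - H x p r| < δ / (4 * T) := by
    have hcomp : IsCompact ((closedBall (0 : Eucl n) ρ) ×ˢ
        ((closedBall (0 : Eucl n) (4 * K)) ×ˢ Icc (-B) B)) :=
      (isCompact_closedBall _ _).prod ((isCompact_closedBall _ _).prod isCompact_Icc)
    have huc := hcomp.uniformContinuousOn_of_continuous hH.continuous.continuousOn
    obtain ⟨ω, hω, h⟩ := Metric.uniformContinuousOn_iff.1 huc (δ / (4 * T)) (by positivity)
    refine ⟨ω, hω, fun x y p r hx hy hp hr hxy => ?_⟩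
    have := h (y, p, r) ⟨by simpa using hy, by simpa using hp, abs_le.1 hr⟩ (x, p, r)
      ⟨by simpa using hx, by simpa using hp, abs_le.1 hr⟩ (by
        rw [Prod.dist_eq, Prod.dist_eq, dist_self, dist_self, max_self, dist_comm, dist_eq_norm]
        exact max_lt hxy hω)
    rwa [Real.dist_eq] at this
  obtain ⟨ε, hε, hε1, hεδ, hεC, hεθ, hεω⟩ : ∃ ε : ℝ, 0 < ε ∧ ε ≤ 1 ∧ 8 * K ^ 2 * ε < δ / T ∧
      C * (8 * K ^ 2 * ε) < δ / (4 * T) ∧ 4 * K * ε < θ ∧ 4 * K * ε < ω := by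
    have hsmall : ∀ a b : ℝ, 0 < b → ∀ᶠ ε : ℝ in 𝓝[>] 0, a * ε < b := fun a b hb => by
      have hcont : Continuous (fun ε : ℝ => a * ε) := by fun_prop
      exact nhdsWithin_le_nhds ((hcont.tendsto 0).eventually (Iio_mem_nhds (by simpa using hb)))
    have e0 : ∀ᶠ ε : ℝ in 𝓝[>] 0, 0 < ε := self_mem_nhdsWithin
    obtain ⟨ε, h1, h2, h3, h4, h5, h6⟩ := (e0.and ((hsmall 1 1 one_pos).and
      ((hsmall (8 * K ^ 2) (δ / T) (by positivity)).and
      ((hsmall (C * (8 * K ^ 2)) (δ / (4 * T)) (by positivity)).and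
      ((hsmall (4 * K) θ hθ).and (hsmall (4 * K) ω hω)))))).exists
    exact ⟨ε, h1, by linarith, h3, by linarith, h5, h6⟩
  obtain ⟨x, t, y, s, hx, hy, ht, hs, hpos, hmax⟩ := hmaxs ε hε hε1
  have htT : t < T := by linarith [ht.2]
  have htI : t ∈ Icc 0 T := ⟨ht.1, htT.le⟩
  set a := ‖x - y‖ with ha
  set b := |t - s| with hb
  have ha0 : 0 ≤ a := norm_nonneg _
  have hb0 : 0 ≤ b := abs_nonneg _
  set g := timeBarrier Λ T t with hg
  have hginv := inv_le_timeBarrier (T := T) hΛ.le ht.1 htT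
  have hTt : 0 < T - t := by linarith
  have hgT : 1 / T ≤ g := by
    refine le_trans ?_ hginv
    rw [one_div]
    exact inv_anti₀ hTt (by linarith [ht.1])
  have hg0 : 0 < g := lt_of_lt_of_le (by positivity) hgT
  set β := δ * (g * (1 + ‖x‖ ^ 2)) with hβ
  have hβT : δ / T ≤ β := by
    have h1 : 1 / T ≤ g * (1 + ‖x‖ ^ 2) := by nlinarith [sq_nonneg ‖x‖]
    have h2 := mul_le_mul_of_nonneg_left h1 hδ.le
    rw [hβ]
    calc δ / T = δ * (1 / T) := by ring
      _ ≤ _ := h2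
  -- The two maximum points are close to each other.
  have hab : a ^ 2 + b ^ 2 ≤ 2 * ε * K * (a + b) := by
    have h1 := hmax x t x t ⟨ht.1, htT⟩ htI
    simp only [doubled, sub_self, norm_zero] at h1
    norm_num at h1
    rw [← ha, ← sq_abs (t - s), ← hb] at h1
    have h2 := (abs_le.1 (hv x y s hs t htI)).2
    have h3 : (a ^ 2 + b ^ 2) / (2 * ε) ≤ K * (a + b) := by linarith
    rw [div_le_iff₀ (by positivity)] at h3
    linarith
  have hmaxab : max a b ≤ 4 * K * ε :=
    (max_le_of_sq_add_sq_le ha0 hb0 (k := 2 * ε * K) (by positivity) hab).trans (by linarith)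
  have haε : a ≤ 4 * K * ε := (le_max_left _ _).trans hmaxab
  have hbε : b ≤ 4 * K * ε := (le_max_right _ _).trans hmaxab
  have hKab : K * (a + b) ≤ 8 * K ^ 2 * ε := by nlinarith
  have huv : β < u x t - v y s := by
    simp only [doubled] at hpos
    have : 0 ≤ (‖x - y‖ ^ 2 + (t - s) ^ 2) / (2 * ε) := by positivity
    linarith
  -- At the initial time the ordering of the data and the closeness of the two points give a
  -- difference of at most `8 * K ^ 2 * ε < δ / T ≤ β`, against `huv`.
  have ht0 : 0 < t := by
    rcases ht.1.lt_or_eq with h | h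
    · exact h
    exfalso
    have h1 := h0 x
    have h2 := (abs_le.1 (hv x y s hs t htI)).2
    rw [← ha, ← hb] at h2
    rw [← h] at huv h2
    linarith
  have hs0 : 0 < s := by
    rcases hs.1.lt_or_eq with h | h
    · exact h
    exfalso
    have h1 := h0 y
    have h2 := (abs_le.1 (hu x y s hs t htI)).2
    rw [← ha, ← hb] at h2
    rw [← h] at huv h2
    linarith
  have hsT : s < T := by
    have := (abs_le.1 (hbε.trans hεθ.le)).1
    have h2 := (abs_le.1 (le_refl b)).1
    linarith [ht.2, neg_abs_le (t - s)]
  -- The equation for the subsolution.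
  set pv : Eucl n := (1 / ε) • (x - y) with hpv
  set pu : Eucl n := pv + (2 * (δ * g)) • x with hpu
  have hdu : HasFDerivAt (fun Y : Eucl n × ℝ => (‖Y.1 - y‖ ^ 2 + (Y.2 - s) ^ 2) / (2 * ε)
      + δ * (timeBarrier Λ T Y.2 * (1 + ‖Y.1‖ ^ 2)))
      (planeForm pu ((t - s) / ε + δ * ((Λ * g + g / (T - t)) * (1 + ‖x‖ ^ 2)))) (x, t) := by
    refine ((hasFDerivAt_half_sq_dist x y t s ε).add
      (hasFDerivAt_barrier δ Λ T htT)).congr_fderiv ?_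
    refine ContinuousLinearMap.ext fun e => ?_
    simp only [add_apply, planeForm_apply, hpu, hpv, inner_add_left]
    ring
  have hmaxu : IsLocalMax (fun Y : Eucl n × ℝ => u Y.1 Y.2
      - ((‖Y.1 - y‖ ^ 2 + (Y.2 - s) ^ 2) / (2 * ε)
      + δ * (timeBarrier Λ T Y.2 * (1 + ‖Y.1‖ ^ 2)))) (x, t) := by
    have hnhds : (univ ×ˢ Ioo 0 T : Set (Eucl n × ℝ)) ∈ 𝓝 (x, t) :=
      (isOpen_univ.prod isOpen_Ioo).mem_nhds ⟨mem_univ _, ht0, htT⟩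
    filter_upwards [hnhds] with Y hY
    have h1 := hmax Y.1 Y.2 y s ⟨hY.2.1.le, hY.2.2⟩ hs
    simp only [doubled] at h1
    linarith
  have hcu : ContDiffAt ℝ 1 (fun Y : Eucl n × ℝ => (‖Y.1 - y‖ ^ 2 + (Y.2 - s) ^ 2) / (2 * ε)
      + δ * (timeBarrier Λ T Y.2 * (1 + ‖Y.1‖ ^ 2))) (x, t) := by
    have c1 : ContDiff ℝ 1 (fun Y : Eucl n × ℝ => (‖Y.1 - y‖ ^ 2 + (Y.2 - s) ^ 2) / (2 * ε)) :=
      (((contDiff_fst.sub contDiff_const).norm_sq ℝ).add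
        ((contDiff_snd.sub contDiff_const).pow 2)).div_const _
    have c2 : ContDiffAt ℝ 1 (fun Y : Eucl n × ℝ => timeBarrier Λ T Y.2) (x, t) :=
      ContDiffAt.comp (f := fun Y : Eucl n × ℝ => Y.2) (x, t) (contDiffAt_timeBarrier htT)
        contDiffAt_snd
    have c3 : ContDiff ℝ 1 (fun Y : Eucl n × ℝ => 1 + ‖Y.1‖ ^ 2) :=
      contDiff_const.add (contDiff_fst.norm_sq ℝ)
    exact c1.contDiffAt.add (contDiffAt_const.mul (c2.mul c3.contDiffAt))
  have hequ := hsub _ x t pu _ ht0 htT hcu hdu hmaxu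
  have hpuK : ‖pu‖ ≤ 4 * K := by
    have := norm_le_of_isLocalMax (w := u) hK (fun y => by
      have := hu y x t htI t htI
      simpa using this) hdu hmaxu
    linarith
  -- The equation for the supersolution.
  have hdv : HasFDerivAt (fun Y : Eucl n × ℝ => -((‖Y.1 - x‖ ^ 2 + (Y.2 - t) ^ 2) / (2 * ε)))
      (planeForm pv ((t - s) / ε)) (y, s) := by
    refine (hasFDerivAt_half_sq_dist y x s t ε).neg.congr_fderiv ?_
    refine ContinuousLinearMap.ext fun e => ?_
    simp only [neg_apply, planeForm_apply, hpv, real_inner_smul_left,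
      inner_sub_left]
    ring
  have hminv : IsLocalMin (fun Y : Eucl n × ℝ => v Y.1 Y.2
      - -((‖Y.1 - x‖ ^ 2 + (Y.2 - t) ^ 2) / (2 * ε))) (y, s) := by
    have hnhds : (univ ×ˢ Ioo 0 T : Set (Eucl n × ℝ)) ∈ 𝓝 (y, s) :=
      (isOpen_univ.prod isOpen_Ioo).mem_nhds ⟨mem_univ _, hs0, hsT⟩
    filter_upwards [hnhds] with Y hY
    have h1 := hmax x t Y.1 Y.2 ⟨ht.1, htT⟩ ⟨hY.2.1.le, hY.2.2.le⟩
    simp only [doubled] at h1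
    rw [norm_sub_rev y x, norm_sub_rev Y.1 x, ← neg_sq (s - t), ← neg_sq (Y.2 - t), neg_sub,
      neg_sub]
    linarith
  have hcv : ContDiffAt ℝ 1
      (fun Y : Eucl n × ℝ => -((‖Y.1 - x‖ ^ 2 + (Y.2 - t) ^ 2) / (2 * ε))) (y, s) := by
    have c1 : ContDiff ℝ 1 (fun Y : Eucl n × ℝ => (‖Y.1 - x‖ ^ 2 + (Y.2 - t) ^ 2) / (2 * ε)) :=
      (((contDiff_fst.sub contDiff_const).norm_sq ℝ).add
        ((contDiff_snd.sub contDiff_const).pow 2)).div_const _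
    exact c1.neg.contDiffAt
  have heqv := hsup _ y s pv _ hs0 hsT hcv hdv hminv
  have hpvK : ‖pv‖ ≤ 4 * K := by
    rw [hpv, norm_smul, Real.norm_eq_abs, abs_of_pos (by positivity), ← ha, one_div,
      inv_mul_le_iff₀ hε]
    linarith
  -- Combine the two inequalities.
  have e1 := (abs_lt.1 (hunif x y pv (v y s) hx hy hpvK (hvB y s hs)
    (haε.trans_lt hεω))).2
  have e2 := (abs_le.1 (hC x pv (v y s) (u x t))).2
  have e3 := (abs_le.1 (hKR x pv pu (u x t) hpvK hpuK)).2
  -- Here the barrier already known, with `2 * δ`, enters: `H` is not monotone in `u`, and the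
  -- difference of the values must be controlled by `β` to be absorbed by `Λ * β`.
  have e4 : |v y s - u x t| ≤ 2 * β + 8 * K ^ 2 * ε := by
    have hβ0 : 0 < β := lt_of_lt_of_le (by positivity) hβT
    rw [abs_sub_comm, abs_of_pos (by linarith)]
    have h1 := hbound x t ⟨ht.1, htT⟩
    have h2 := (abs_le.1 (hv x y s hs t htI)).2
    rw [← ha, ← hb] at h2
    have : 2 * δ * (g * (1 + ‖x‖ ^ 2)) = 2 * β := by rw [hβ]; ring
    rw [← hg] at h1
    linarith
  have e5 : KR * (1 + ‖x‖) * ‖pv - pu‖ ≤ 4 * KR * β := by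
    have h1 : ‖pv - pu‖ = 2 * (δ * g) * ‖x‖ := by
      rw [hpu, sub_add_cancel_left, norm_neg, norm_smul, Real.norm_eq_abs,
        abs_of_pos (by positivity)]
    have h2 : (1 + ‖x‖) * (2 * ‖x‖) ≤ 4 * (1 + ‖x‖ ^ 2) := by
      nlinarith [sq_nonneg (‖x‖ - 1), norm_nonneg x]
    have h3 := mul_le_mul_of_nonneg_left h2 (by positivity : 0 ≤ KR * (δ * g))
    rw [h1, hβ]
    linarith
  have e6 := mul_le_mul_of_nonneg_left e4 hC0.le
  have e7 : δ * ((Λ * g + g / (T - t)) * (1 + ‖x‖ ^ 2)) ≥ Λ * β := by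
    have h1 : 0 ≤ δ * (g / (T - t) * (1 + ‖x‖ ^ 2)) := by positivity
    rw [hβ]
    linarith
  have e8 : Λ * β = (4 * KR + 2 * C) * β + β := by rw [hΛd]; ring
  have e9 : δ / (4 * T) = δ / T / 4 := by field_simp
  have e10 : 0 < δ / T := by positivity
  linarith

/-- Boundedness gives a first barrier, since `timeBarrier` is at least `1 / T`; halving it
indefinitely with the same `Λ` leaves nothing. -/
theorem comparison (hH : IsContactHamiltonian H) {u v : Eucl n → ℝ → ℝ} {K T B : ℝ}
    (hK : 0 < K) (hB : 0 < B)
    (hu : ∀ x y : Eucl n, ∀ s ∈ Icc 0 T, ∀ t ∈ Icc 0 T,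
      |u x t - u y s| ≤ K * (‖x - y‖ + |t - s|))
    (hv : ∀ x y : Eucl n, ∀ s ∈ Icc 0 T, ∀ t ∈ Icc 0 T,
      |v x t - v y s| ≤ K * (‖x - y‖ + |t - s|))
    (huB : ∀ x : Eucl n, ∀ t ∈ Icc 0 T, |u x t| ≤ B)
    (hvB : ∀ x : Eucl n, ∀ t ∈ Icc 0 T, |v x t| ≤ B)
    (hsub : IsLocalSub H T u) (hsup : IsLocalSuper H T v) (h0 : ∀ x, u x 0 ≤ v x 0)
    (x : Eucl n) {t : ℝ} (ht : t ∈ Ico 0 T) : u x t ≤ v x t := by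
  have hT : 0 < T := ht.1.trans_lt ht.2
  obtain ⟨Λ, hΛ, hhalf⟩ := barrier_halving hH hK hT hB hu hv huB hvB hsub hsup h0
  have key : ∀ k : ℕ, ∀ x : Eucl n, ∀ t ∈ Ico 0 T,
      u x t - v x t ≤ 2 * B * T * (1 / 2) ^ k * (timeBarrier Λ T t * (1 + ‖x‖ ^ 2)) := by
    intro k
    induction k with
    | zero =>
      intro x t ht
      have h1 := (abs_le.1 (huB x t ⟨ht.1, ht.2.le⟩)).2
      have h2 := (abs_le.1 (hvB x t ⟨ht.1, ht.2.le⟩)).1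
      have hTt : 0 < T - t := by linarith [ht.2]
      have h3 : 1 / T ≤ timeBarrier Λ T t := by
        refine le_trans ?_ (inv_le_timeBarrier hΛ.le ht.1 ht.2)
        rw [one_div]
        exact inv_anti₀ hTt (by linarith [ht.1])
      have h4 : 1 / T ≤ timeBarrier Λ T t * (1 + ‖x‖ ^ 2) := by
        have : 0 < 1 / T := by positivity
        nlinarith [sq_nonneg ‖x‖]
      have h5 := mul_le_mul_of_nonneg_left h4 (by positivity : 0 ≤ 2 * B * T)
      have h6 : 2 * B * T * (1 / T) = 2 * B := by field_simp
      rw [pow_zero, mul_one]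
      linarith
    | succ k ih =>
      refine hhalf _ (by positivity) fun x t ht => (ih x t ht).trans (le_of_eq ?_)
      rw [pow_succ]
      ring
  have hlim : Tendsto (fun k : ℕ => 2 * B * T * (1 / 2 : ℝ) ^ k
      * (timeBarrier Λ T t * (1 + ‖x‖ ^ 2))) atTop
      (𝓝 (2 * B * T * 0 * (timeBarrier Λ T t * (1 + ‖x‖ ^ 2)))) :=
    ((tendsto_pow_atTop_nhds_zero_of_lt_one (by norm_num) (by norm_num)).const_mul _).mul_const _
  rw [mul_zero, zero_mul] at hlim
  have := ge_of_tendsto' hlim fun k => key k x t ht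
  linarith

end

/-! ### Well-posedness and identification of the semigroup. -/

section

variable {n : ℕ} {H : Eucl n → Eucl n → ℝ → ℝ} {φ : Eucl n → ℝ}

lemma IsLipBUC.bddCont (hφ : IsLipBUC φ) : BddCont φ := ⟨hφ.2.1.continuous, hφ.2.2⟩

lemma IsLipBUC.exists_lipschitz (hφ : IsLipBUC φ) : ∃ K : ℝ, ∀ x y, |φ x - φ y| ≤ K * ‖x - y‖ := by
  obtain ⟨K, hK⟩ := hφ.1
  refine ⟨K, fun x y => ?_⟩
  rw [← Real.dist_eq, ← dist_eq_norm]
  exact hK.dist_le_mul x y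

lemma IsLipBUC.of_lipschitz_of_bounded {K B : ℝ} (hK : 0 ≤ K)
    (h : ∀ x y, |φ x - φ y| ≤ K * ‖x - y‖) (hB : ∀ x, |φ x| ≤ B) : IsLipBUC φ := by
  have hlip : LipschitzWith ⟨K, hK⟩ φ := LipschitzWith.of_dist_le_mul fun x y => by
    rw [Real.dist_eq, dist_eq_norm]; exact h x y
  exact ⟨⟨_, hlip⟩, hlip.uniformContinuous, B, hB⟩

lemma IsLipViscositySolution.initial {u : Eucl n → ℝ → ℝ} (hu : IsLipViscositySolution H φ u)
    (x : Eucl n) : u x 0 = φ x :=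
  le_antisymm (hu.sub.2 x) (hu.super.2 x)

lemma IsLipViscositySolution.strip_bounds {u : Eucl n → ℝ → ℝ}
    (hu : IsLipViscositySolution H φ u) (hφ : IsLipBUC φ) {T : ℝ} (hT : 0 < T) :
    ∃ K B : ℝ, 0 < K ∧ 0 < B ∧
      (∀ x y : Eucl n, ∀ s ∈ Icc 0 T, ∀ t ∈ Icc 0 T,
        |u x t - u y s| ≤ K * (‖x - y‖ + |t - s|)) ∧
      ∀ x : Eucl n, ∀ t ∈ Icc 0 T, |u x t| ≤ B := by
  obtain ⟨K, hK⟩ := hu.lip T hT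
  obtain ⟨B, hB⟩ := hφ.2.2
  have hlip : ∀ x y : Eucl n, ∀ s ∈ Icc 0 T, ∀ t ∈ Icc 0 T,
      |u x t - u y s| ≤ (K + 1) * (‖x - y‖ + |t - s|) := by
    intro x y s hs t ht
    have h1 := hK.dist_le_mul (x, t) ⟨mem_univ _, ht⟩ (y, s) ⟨mem_univ _, hs⟩
    rw [Real.dist_eq, Prod.dist_eq, Real.dist_eq, dist_eq_norm] at h1
    have h2 : max ‖x - y‖ |t - s| ≤ ‖x - y‖ + |t - s| :=
      max_le (by linarith [abs_nonneg (t - s)]) (by linarith [norm_nonneg (x - y)])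
    refine h1.trans (mul_le_mul (by linarith) h2 ?_ (by positivity))
    exact le_max_of_le_left (norm_nonneg _)
  refine ⟨K + 1, |B| + (K + 1) * T, by positivity, by positivity, hlip, fun x t ht => ?_⟩
  have h1 := hlip x x 0 ⟨le_rfl, hT.le⟩ t ht
  rw [sub_self, norm_zero, zero_add, sub_zero, abs_of_nonneg ht.1, hu.initial] at h1
  have h2 := abs_sub_abs_le_abs_sub (u x t) (φ x)
  have h3 := mul_le_mul_of_nonneg_left ht.2 (by positivity : (0 : ℝ) ≤ K + 1)
  linarith [hB x, le_abs_self B]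

theorem IsLipViscositySolution.unique (hH : IsContactHamiltonian H) (hφ : IsLipBUC φ)
    {u v : Eucl n → ℝ → ℝ} (hu : IsLipViscositySolution H φ u)
    (hv : IsLipViscositySolution H φ v) (x : Eucl n) {t : ℝ} (ht : 0 ≤ t) : u x t = v x t := by
  have key : ∀ {u v : Eucl n → ℝ → ℝ}, IsLipViscositySolution H φ u →
      IsLipViscositySolution H φ v → u x t ≤ v x t := fun {u v} hu hv => by
    obtain ⟨K, B, hK, hB, hul, hub⟩ := hu.strip_bounds hφ (by linarith : 0 < t + 1)
    obtain ⟨K', B', hK', hB', hvl, hvb⟩ := hv.strip_bounds hφ (by linarith : 0 < t + 1)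
    exact comparison hH (K := K + K') (B := B + B') (T := t + 1) (by positivity) (by positivity)
      (fun x y s hs t ht => (hul x y s hs t ht).trans
        (mul_le_mul_of_nonneg_right (by linarith) (by positivity)))
      (fun x y s hs t ht => (hvl x y s hs t ht).trans
        (mul_le_mul_of_nonneg_right (by linarith) (by positivity)))
      (fun x t ht => (hub x t ht).trans (by linarith))
      (fun x t ht => (hvb x t ht).trans (by linarith))
      (hu.isLocalSub _) (hv.isLocalSuper _) (fun x => by rw [hu.initial, hv.initial]) x
      ⟨ht, by linarith⟩
  exact le_antisymm (key hu hv) (key hv hu)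

/-- The forward inequality supplies the subgradient condition, which convexity converts into the
subsolution property; the backward inequality gives the supersolution property directly. -/
theorem isLipViscositySolution_schemeLimit (hH : IsContactHamiltonian H) (hφ : IsLipBUC φ) :
    IsLipViscositySolution H φ (schemeLimit H φ) := by
  obtain ⟨K, hK⟩ := hφ.exists_lipschitz
  refine ⟨IsLocalSub.isViscositySubsolution (fun T => ?_) fun x => (schemeLimit_zero H φ x).le,
    IsLocalSuper.isViscositySupersolution (schemeLimit_isLocalSuper hH hφ.bddCont hK)
      fun x => (schemeLimit_zero H φ x).ge, fun T hT => ?_⟩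
  · obtain ⟨c, hc, hlip⟩ := exists_schemeLimit_lipschitz hH K T
    exact isLocalSub_of_proxSubgradient hH hc (hlip φ hφ.bddCont hK) fun x t p q ht _ hprox =>
      schemeLimit_subgradient hH hφ.bddCont hK ht.le hprox.hasSubgradient
  · obtain ⟨c, hc, hlip⟩ := exists_schemeLimit_lipschitz hH K T
    refine ⟨⟨2 * c, by positivity⟩, LipschitzOnWith.of_dist_le_mul fun X hX Y hY => ?_⟩
    rw [Real.dist_eq]
    refine (hlip φ hφ.bddCont hK X.1 Y.1 Y.2 hY.2 X.2 hX.2).trans ?_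
    have e1 : ‖X.1 - Y.1‖ ≤ dist X Y := by
      rw [Prod.dist_eq, ← dist_eq_norm]; exact le_max_left _ _
    have e2 : |X.2 - Y.2| ≤ dist X Y := by
      rw [Prod.dist_eq, ← Real.dist_eq]; exact le_max_right _ _
    change _ ≤ 2 * c * _
    nlinarith

theorem IsContactHamiltonian.wellPosed (hH : IsContactHamiltonian H) : WellPosed H :=
  fun _ hφ => ⟨⟨_, isLipViscositySolution_schemeLimit hH hφ⟩,
    fun _ _ hu hv x _ ht => hu.unique hH hφ hv x ht⟩

lemma laxOleinik_eq_schemeLimit (hH : IsContactHamiltonian H) (hφ : IsLipBUC φ) {t : ℝ}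
    (ht : 0 ≤ t) (x : Eucl n) : laxOleinik H t φ x = schemeLimit H φ x t := by
  have hex : ∃ u, IsLipViscositySolution H φ u := ⟨_, isLipViscositySolution_schemeLimit hH hφ⟩
  rw [laxOleinik, dif_pos hex]
  exact hex.choose_spec.unique hH hφ (isLipViscositySolution_schemeLimit hH hφ) x ht

lemma isLipBUC_schemeLimit (hH : IsContactHamiltonian H) (hφ : IsLipBUC φ) {t : ℝ}
    (ht : 0 ≤ t) : IsLipBUC (fun x => schemeLimit H φ x t) := by
  obtain ⟨K, B, hK, hB, hlip, hbd⟩ := (isLipViscositySolution_schemeLimit hH hφ).strip_bounds hφ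
    (by linarith : 0 < t + 1)
  have htI : t ∈ Icc 0 (t + 1) := ⟨ht, by linarith⟩
  refine IsLipBUC.of_lipschitz_of_bounded hK.le (fun x y => ?_) fun x => hbd x t htI
  simpa using hlip x y t htI t htI

lemma isLipBUC_laxOleinik (hH : IsContactHamiltonian H) (hφ : IsLipBUC φ) {t : ℝ}
    (ht : 0 ≤ t) : IsLipBUC (laxOleinik H t φ) := by
  have : laxOleinik H t φ = fun x => schemeLimit H φ x t :=
    funext (laxOleinik_eq_schemeLimit hH hφ ht)
  rw [this]
  exact isLipBUC_schemeLimit hH hφ ht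

end

/-! ### Propagation of subgradients through one step. -/

section

variable {n : ℕ} {F : Eucl n → Eucl n → ℝ → ℝ}

/-- The regularizing quadratic makes the action strictly concave in `p`, since `F` itself is convex:
the midpoint of two distinct maximizers would do better. -/
lemma IsCostMaximizer.unique (hF : IsContactHamiltonian F) {h : ℝ} (hh : 0 < h) {x y : Eucl n}
    {u : ℝ} {p p' : Eucl n} (hp : IsCostMaximizer F h x y u p)
    (hp' : IsCostMaximizer F h x y u p') : p = p' := by
  set m : Eucl n := (1 / 2 : ℝ) • p + (1 / 2 : ℝ) • p' with hm
  have hmn : ‖m‖ ≤ h⁻¹ := by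
    refine (norm_add_le _ _).trans ?_
    rw [norm_smul, norm_smul, Real.norm_of_nonneg (by norm_num)]
    linarith [hp.1, hp'.1]
  have h1 := hp.2 m hmn
  have h2 := hp'.2 m hmn
  have hconv := (hF.convex y u).2 (mem_univ p) (mem_univ p') (by norm_num : (0 : ℝ) ≤ 1 / 2)
    (by norm_num : (0 : ℝ) ≤ 1 / 2) (by norm_num)
  have hsq : ‖m‖ ^ 2 = 1 / 2 * ‖p‖ ^ 2 + 1 / 2 * ‖p'‖ ^ 2 - 1 / 4 * ‖p - p'‖ ^ 2 := by
    rw [hm, norm_add_sq_real, norm_sub_sq_real, norm_smul, norm_smul, real_inner_smul_left,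
      real_inner_smul_right, Real.norm_of_nonneg (by norm_num)]
    ring
  have hin : inner ℝ m (x - y) = 1 / 2 * inner ℝ p (x - y) + 1 / 2 * inner ℝ p' (x - y) := by
    rw [hm, inner_add_left, real_inner_smul_left, real_inner_smul_left]
  simp only [smul_eq_mul, ← hm] at hconv
  simp only [stepAction, hsq, hin] at h1 h2
  have h3 := mul_le_mul_of_nonneg_left hconv hh.le
  have h4 : h * (h / 2 * (1 / 4 * ‖p - p'‖ ^ 2)) ≤ 0 := by linarith
  have h5 : ‖p - p'‖ ^ 2 ≤ 0 := by
    by_contra hlt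
    push Not at hlt
    have : 0 < h * (h / 2 * (1 / 4 * ‖p - p'‖ ^ 2)) := by positivity
    linarith
  have h6 : ‖p - p'‖ = 0 := by
    have := sq_nonneg ‖p - p'‖
    exact pow_eq_zero_iff two_ne_zero |>.1 (le_antisymm h5 this)
  exact sub_eq_zero.1 (norm_eq_zero.1 h6)

/-- The covector realizing the cost of a step depends continuously on the step. -/
lemma IsCostMaximizer.eventually_near (hF : IsContactHamiltonian F) {h : ℝ} (hh : 0 < h)
    {x y : Eucl n} {u : ℝ} {p : Eucl n} (hp : IsCostMaximizer F h x y u p) {ε : ℝ} (hε : 0 < ε) :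
    ∀ᶠ θ : Eucl n × Eucl n × ℝ in 𝓝 (x, y, u),
      ∀ p', IsCostMaximizer F h θ.1 θ.2.1 θ.2.2 p' → ‖p' - p‖ < ε := by
  have hcomp : IsCompact (closedBall (0 : Eucl n) h⁻¹ \ ball p ε) :=
    (isCompact_closedBall _ _).diff isOpen_ball
  have hcont := continuous_stepAction hF h
  have hev : ∀ᶠ θ : Eucl n × Eucl n × ℝ in 𝓝 (x, y, u),
      ∀ p' ∈ closedBall (0 : Eucl n) h⁻¹ \ ball p ε,
        stepAction F h θ.1 θ.2.1 θ.2.2 p' < stepAction F h θ.1 θ.2.1 θ.2.2 p := by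
    refine hcomp.eventually_forall_of_forall_eventually fun p' hp' => ?_
    have h1 : stepAction F h x y u p' < stepAction F h x y u p := by
      refine lt_of_le_of_ne (hp.2 p' (by simpa using hp'.1)) fun heq => hp'.2 ?_
      have hmax' : IsCostMaximizer F h x y u p' :=
        ⟨by simpa using hp'.1, fun q hq => heq ▸ hp.2 q hq⟩
      rw [hmax'.unique hF hh hp]
      exact mem_ball_self hε
    have c1 : Continuous (fun w : (Eucl n × Eucl n × ℝ) × Eucl n => (w.1, p)) := by fun_prop
    have c2 := hcont.comp c1
    simp only [Function.comp_def] at c2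
    exact ((hcont.tendsto ((x, y, u), p')).eventually_lt (c2.tendsto ((x, y, u), p')) h1)
  filter_upwards [hev] with θ hθ p' hp'
  by_contra hlt
  have h2 := hθ p' ⟨by simpa using hp'.1, fun hb => hlt (by simpa [dist_eq_norm] using hb)⟩
  have h3 := hp'.2 p hp.1
  linarith

/-- A subgradient of one step of the scheme is the covector realizing the cost. -/
lemma isCostMaximizer_of_subgradient (hF : IsContactHamiltonian F) {h : ℝ} (hh : 0 < h)
    (hh1 : h ≤ 1) {φ : Eucl n → ℝ} (hφ : BddCont φ) {x y p : Eucl n}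
    (hy : IsStepMinimizer F h φ x y)
    (hp : ∀ ε : ℝ, 0 < ε → ∀ᶠ x' in 𝓝 x,
      step F h φ x + inner ℝ p (x' - x) - ε * ‖x' - x‖ ≤ step F h φ x') :
    IsCostMaximizer F h x y (φ y) p := by
  obtain ⟨p₁, hp₁⟩ := exists_costMaximizer hF hh x y (φ y)
  suffices hpp : p = p₁ by rw [hpp]; exact hp₁
  by_contra hne
  set d := p - p₁ with hd
  have hd0 : 0 < ‖d‖ := norm_pos_iff.2 (sub_ne_zero.2 hne)
  -- Moving `x` along `d` raises the step at rate at least `⟪p, d⟫ - ε * ‖d‖` by the subgradient,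
  -- and at most `⟪p₂, d⟫` with `p₂` within `ε` of `p₁`. Hence `‖d‖ ^ 2 ≤ 2 * ε * ‖d‖`, which this
  -- choice contradicts.
  set ε := ‖d‖ / 4 with hε
  have hε0 : 0 < ε := by positivity
  have hcurve : Tendsto (fun s : ℝ => x + s • d) (𝓝[>] 0) (𝓝 x) := by
    have hcont : Continuous (fun s : ℝ => x + s • d) := by fun_prop
    have := hcont.tendsto 0
    simp only [zero_smul, add_zero] at this
    exact this.mono_left nhdsWithin_le_nhds
  have hnear : ∀ᶠ x' in 𝓝 x, ∀ p', IsCostMaximizer F h x' y (φ y) p' → ‖p' - p₁‖ < ε := by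
    have hcont : Continuous (fun x' : Eucl n => (x', y, φ y)) := by fun_prop
    exact (hcont.tendsto x).eventually (hp₁.eventually_near hF hh hε0)
  have h0 : ∀ᶠ s : ℝ in 𝓝[>] 0, 0 < s := self_mem_nhdsWithin
  obtain ⟨s, ⟨h1, h2⟩, hs⟩ := ((hcurve.eventually ((hp ε hε0).and hnear)).and h0).exists
  obtain ⟨p₂, hp₂⟩ := exists_costMaximizer hF hh (x + s • d) y (φ y)
  have h3 := h2 p₂ hp₂
  have h4 := step_le hF hh hh1 hφ (x + s • d) y
  have h5 := hp₁.2 p₂ hp₂.1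
  rw [hp₂.stepCost_eq] at h4
  rw [IsStepMinimizer, hp₁.stepCost_eq] at hy
  rw [add_sub_cancel_left, real_inner_smul_right, norm_smul, Real.norm_eq_abs, abs_of_pos hs]
    at h1
  have h6 : inner ℝ p₂ (x + s • d - y) = inner ℝ p₂ (x - y) + s * inner ℝ p₂ d := by
    rw [← real_inner_smul_right, ← inner_add_right]; congr 1; abel
  simp only [stepAction] at h4 h5 hy
  rw [h6] at h4
  have h7 : s * (inner ℝ p d - inner ℝ p₂ d) ≤ s * (ε * ‖d‖) := by linarith
  have h8 := le_of_mul_le_mul_left h7 hs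
  have h9 : inner ℝ p d - inner ℝ p₂ d = ‖d‖ ^ 2 - inner ℝ (p₂ - p₁) d := by
    rw [← real_inner_self_eq_norm_sq, ← inner_sub_left, ← inner_sub_left]
    congr 1
    rw [hd]; abel
  have h10 := (real_inner_le_norm (p₂ - p₁) d).trans
    (mul_le_mul_of_nonneg_right h3.le (norm_nonneg d))
  rw [h9, hε] at h8
  rw [hε] at h10
  nlinarith

/-- The discrete velocity of an optimal step is given by the Hamiltonian. -/
lemma IsCostMaximizer.velocity_eq (hF : IsContactHamiltonian F) {h : ℝ} {x y : Eucl n}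
    {u : ℝ} {p : Eucl n} (hp : IsCostMaximizer F h x y u p) (hpn : ‖p‖ < h⁻¹) :
    x = y + h • (gradP F y p u + h • p) := by
  have hd : HasFDerivAt (stepAction F h x y u)
      (innerSL ℝ (x - y) - h • (innerSL ℝ (gradP F y p u) + (h / 2) • (2 • innerSL ℝ p))) p := by
    have h1 : HasFDerivAt (fun q : Eucl n => inner ℝ q (x - y)) (innerSL ℝ (x - y)) p := by
      have := (innerSL ℝ (x - y)).hasFDerivAt (x := p)
      refine this.congr_of_eventuallyEq (Eventually.of_forall fun q => ?_)
      exact real_inner_comm _ _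
    have h2 : HasFDerivAt (fun q : Eucl n => F y q u) (innerSL ℝ (gradP F y p u)) p :=
      (hF.hasGradientAt_p y p u).hasFDerivAt
    have h3 : HasFDerivAt (fun q : Eucl n => ‖q‖ ^ 2) (2 • innerSL ℝ p) p :=
      (hasStrictFDerivAt_norm_sq p).hasFDerivAt
    exact h1.sub ((h2.add (h3.const_mul (h / 2))).const_mul h)
  -- The strict bound `‖p‖ < h⁻¹` makes the maximizer interior, so the truncation is inactive and
  -- the first-order condition holds.
  have hmax : IsLocalMax (stepAction F h x y u) p := by
    filter_upwards [isOpen_ball.mem_nhds (show p ∈ ball (0 : Eucl n) h⁻¹ by simpa using hpn)]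
      with q hq
    exact hp.2 q (by simpa using (mem_ball.1 hq).le)
  have hzero := hmax.hasFDerivAt_eq_zero hd
  have hvec : x - y - h • (gradP F y p u + h • p) = 0 := by
    refine ext_inner_right ℝ fun e => ?_
    have := DFunLike.congr_fun hzero e
    simp only [sub_apply, smul_apply, add_apply, innerSL_apply_apply,
      zero_apply, smul_eq_mul, nsmul_eq_mul] at this
    rw [inner_sub_left, real_inner_smul_left, inner_add_left, real_inner_smul_left, inner_zero_left]
    push_cast at this
    linarith
  have := sub_eq_zero.1 hvec
  rw [← this]; abel

set_option maxHeartbeats 400000 in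
/-- Exact backward propagation of subgradients along one step of the scheme. -/
theorem subgradient_step (hF : IsContactHamiltonian F) {h K : ℝ} (hh : 0 < h) (hh1 : h ≤ 1)
    (hK : 0 ≤ K) {φ : Eucl n → ℝ → ℝ} (hφ : ∀ t, BddCont fun y => φ y t)
    (hlip : ∀ x y s t, |φ x t - φ y s| ≤ K * (‖x - y‖ + |t - s|)) {x y p : Eucl n} {t q : ℝ}
    (hy : IsStepMinimizer F h (fun y => φ y t) x y)
    (hsub : HasSubgradient (fun x t => step F h (fun y => φ y t) x) x t p q)
    (ha : 0 < 1 - h * derivU F y p (φ y t)) :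
    IsCostMaximizer F h x y (φ y t) p ∧
      HasSubgradient φ y t ((1 - h * derivU F y p (φ y t))⁻¹ • (p + h • gradX F y p (φ y t)))
        ((1 - h * derivU F y p (φ y t))⁻¹ * q) := by
  have hmax : IsCostMaximizer F h x y (φ y t) p := by
    refine isCostMaximizer_of_subgradient hF hh hh1 (hφ t) hy fun ε hε => ?_
    have hcont : Continuous (fun x' : Eucl n => (x', t)) := by fun_prop
    filter_upwards [(hcont.tendsto x).eventually (hsub ε hε)] with x' hx'
    simpa using hx'
  refine ⟨hmax, fun η hη => ?_⟩
  set u₀ := φ y t with hu₀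
  set a := 1 - h * derivU F y p u₀ with had
  set ε := a * η / (4 + K) with hεd
  have hε : 0 < ε := by positivity
  have hφc : Tendsto (fun Y : Eucl n × ℝ => φ Y.1 Y.2) (𝓝 (y, t)) (𝓝 u₀) := by
    rw [tendsto_iff_norm_sub_tendsto_zero]
    have hcont : Continuous (fun Y : Eucl n × ℝ => K * (‖Y.1 - y‖ + |Y.2 - t|)) := by fun_prop
    have h1 := hcont.tendsto (y, t)
    simp only [sub_self, norm_zero, abs_zero, add_zero, mul_zero] at h1
    exact squeeze_zero (fun _ => norm_nonneg _) (fun Y => hlip Y.1 y t Y.2) h1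
  -- Time variation of the step at the fixed point `x`.
  have hev1 : ∀ᶠ Y : Eucl n × ℝ in 𝓝 (y, t), step F h (fun y => φ y t) x + q * (Y.2 - t)
      - ε * |Y.2 - t| ≤ step F h (fun y => φ y Y.2) x := by
    have hcont : Continuous (fun Y : Eucl n × ℝ => (x, Y.2)) := by fun_prop
    filter_upwards [(hcont.tendsto (y, t)).eventually (hsub ε hε)] with Y hY
    simpa using hY
  -- Strict differentiability is needed: `F` is compared at two points sharing the covector `p'`
  -- optimal for the displaced data, which is only close to `p`.
  have hstrict := (hF.hasStrictFDerivAt y p u₀).isLittleO.def hε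
  have hclose : ∀ᶠ Z : (Eucl n × Eucl n × ℝ) × (Eucl n × Eucl n × ℝ) in
      𝓝 ((y, p, u₀), (y, p, u₀)), ‖F Z.1.1 Z.1.2.1 Z.1.2.2 - F Z.2.1 Z.2.2.1 Z.2.2.2
        - jetForm (gradX F y p u₀) (gradP F y p u₀) (derivU F y p u₀) (Z.1 - Z.2)‖
        ≤ ε * ‖Z.1 - Z.2‖ := hstrict
  obtain ⟨r, hr, hball⟩ := Metric.eventually_nhds_iff.1 hclose
  have hr' : 0 < min r ε := lt_min hr hε
  have hev2 : ∀ᶠ Y : Eucl n × ℝ in 𝓝 (y, t),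
      ∀ p', IsCostMaximizer F h x Y.1 (φ Y.1 Y.2) p' → ‖p' - p‖ < min r ε := by
    have hten : Tendsto (fun Y : Eucl n × ℝ => (x, Y.1, φ Y.1 Y.2)) (𝓝 (y, t))
        (𝓝 (x, y, u₀)) :=
      tendsto_const_nhds.prodMk_nhds ((continuous_fst.tendsto (y, t)).prodMk_nhds hφc)
    exact hten.eventually (hmax.eventually_near hF hh hr')
  have hev3 : ∀ᶠ Y : Eucl n × ℝ in 𝓝 (y, t), ‖Y.1 - y‖ < r := by
    have hcont : Continuous (fun Y : Eucl n × ℝ => ‖Y.1 - y‖) := by fun_prop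
    exact (hcont.tendsto (y, t)).eventually (Iio_mem_nhds (by simpa using hr))
  have hev4 : ∀ᶠ Y : Eucl n × ℝ in 𝓝 (y, t), |φ Y.1 Y.2 - u₀| < r := by
    have := Metric.tendsto_nhds.1 hφc r hr
    simpa only [Real.dist_eq] using this
  filter_upwards [hev1, hev2, hev3, hev4] with Y h1 h2 h3 h4
  obtain ⟨p', hp'⟩ := exists_costMaximizer hF hh x Y.1 (φ Y.1 Y.2)
  have h5 := h2 p' hp'
  have h6 := step_le hF hh hh1 (hφ Y.2) x Y.1
  rw [hp'.stepCost_eq] at h6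
  have h7 := hmax.2 p' hp'.1
  have hy' := hy
  rw [IsStepMinimizer, hmax.stepCost_eq] at hy'
  have h8 : inner ℝ p' (x - Y.1) = inner ℝ p' (x - y) - inner ℝ p' (Y.1 - y) := by
    rw [← inner_sub_right]; congr 1; abel
  have h9 := hball (y := ((Y.1, p', φ Y.1 Y.2), (y, p', u₀))) (by
    have := h5.trans_le (min_le_left r ε)
    rw [dist_eq_norm]
    simp [h3, h4, this])
  simp only [jetForm_apply, Prod.mk_sub_mk, sub_self, inner_zero_right, add_zero] at h9
  set N := ‖Y.1 - y‖ with hN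
  set D := φ Y.1 Y.2 - u₀ with hD
  set τ := Y.2 - t with hτ
  have hnorm : ‖((Y.1 - y, (0 : Eucl n), D) : Eucl n × Eucl n × ℝ)‖ ≤ N + |D| := by
    rw [Prod.norm_def, Prod.norm_def, norm_zero, Real.norm_eq_abs]
    refine max_le (by linarith [abs_nonneg D]) (max_le (by positivity) ?_)
    linarith [norm_nonneg (Y.1 - y)]
  have h10 := (abs_le.1 (h9.trans (mul_le_mul_of_nonneg_left hnorm hε.le))).1
  have hDK : |D| ≤ K * (N + |τ|) := hlip Y.1 y t Y.2
  have h11 : inner ℝ p' (Y.1 - y) ≥ inner ℝ p (Y.1 - y) - ε * N := by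
    have e1 : inner ℝ p (Y.1 - y) = inner ℝ p' (Y.1 - y) - inner ℝ (p' - p) (Y.1 - y) := by
      rw [← inner_sub_left]; congr 1; abel
    have e2 := (abs_le.1 (abs_real_inner_le_norm (p' - p) (Y.1 - y))).1
    have e3 := mul_le_mul_of_nonneg_right (h5.le.trans (min_le_right r ε)) (norm_nonneg (Y.1 - y))
    rw [e1]
    linarith
  have hN0 : 0 ≤ N := norm_nonneg _
  have hτ0 : 0 ≤ |τ| := abs_nonneg _
  have hD0 : 0 ≤ |D| := abs_nonneg _
  have h12 := mul_le_mul_of_nonneg_left h10 hh.le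
  have h13 : h * (ε * (N + |D|)) ≤ ε * (N + |D|) := by
    have : 0 ≤ ε * (N + |D|) := by positivity
    nlinarith
  have h14 : ε * |D| ≤ ε * (K * (N + |τ|)) := mul_le_mul_of_nonneg_left hDK hε.le
  simp only [stepAction] at h6 h7 hy'
  rw [h8] at h6
  -- The end point `x` is kept fixed and only its time varies; `Y.1` competes in the infimum. Moving
  -- the `u`-variation of the cost to the left turns the coefficient of `D` into `a`.
  have hmain : inner ℝ p (Y.1 - y) + h * inner ℝ (gradX F y p u₀) (Y.1 - y) + q * τ
      - a * η * (N + |τ|) ≤ a * D := by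
    have e1 : a * D = D - h * (derivU F y p u₀ * D) := by rw [had]; ring
    have e2 : ε * (2 * N + |τ| + K * (N + |τ|)) ≤ a * η * (N + |τ|) := by
      have e3 : a * η = ε * (4 + K) := by rw [hεd]; field_simp
      rw [e3, mul_assoc]
      refine mul_le_mul_of_nonneg_left ?_ hε.le
      nlinarith
    have e4 : φ Y.1 Y.2 = u₀ + D := by rw [hD]; ring
    rw [e1]
    rw [e4] at h6 h12
    linarith
  have hfin : a⁻¹ * (inner ℝ p (Y.1 - y) + h * inner ℝ (gradX F y p u₀) (Y.1 - y) + q * τ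
      - a * η * (N + |τ|)) ≤ D := by
    rw [inv_mul_le_iff₀ ha]
    exact hmain
  rw [real_inner_smul_left, inner_add_left, real_inner_smul_left]
  have e5 : a⁻¹ * (inner ℝ p (Y.1 - y) + h * inner ℝ (gradX F y p u₀) (Y.1 - y) + q * τ
      - a * η * (N + |τ|)) = a⁻¹ * (inner ℝ p (Y.1 - y)
        + h * inner ℝ (gradX F y p u₀) (Y.1 - y)) + a⁻¹ * q * τ - η * (N + |τ|) := by
    field_simp
  rw [e5] at hfin
  rw [hD] at hfin
  linarith

end

/-! ### The Jacobi identity along one discrete step. -/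

section

variable {n : ℕ} {H F : Eucl n → Eucl n → ℝ → ℝ}

lemma JacobiCommute.symm (h : JacobiCommute H F) : JacobiCommute F H := by
  intro x p u
  have := h x p u
  rw [real_inner_comm (gradP F x p u), real_inner_comm (gradX F x p u)] at this
  linarith

/-- Infinitesimal form of the commutation: along one step of the discrete flow of `F`, the
Hamiltonian `H` changes by a multiple of itself up to a small error. -/
lemma eventually_hamiltonian_step (hH : IsContactHamiltonian H) (hF : IsContactHamiltonian F)
    (hHF : JacobiCommute H F) (ζ : Eucl n × Eucl n × ℝ) {η : ℝ} (hη : 0 < η) :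
    ∀ᶠ z : ℝ × Eucl n × Eucl n × ℝ in 𝓝 (0, ζ), 0 < z.1 →
      H (z.2.1 + z.1 • (gradP F z.2.1 z.2.2.1 z.2.2.2 + z.1 • z.2.2.1)) z.2.2.1
        (z.2.2.2 + inner ℝ z.2.2.1 (z.1 • (gradP F z.2.1 z.2.2.1 z.2.2.2 + z.1 • z.2.2.1))
          - z.1 * (F z.2.1 z.2.2.1 z.2.2.2 + z.1 / 2 * ‖z.2.2.1‖ ^ 2))
      - (1 - z.1 * derivU F z.2.1 z.2.2.1 z.2.2.2) * H z.2.1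
        ((1 - z.1 * derivU F z.2.1 z.2.2.1 z.2.2.2)⁻¹ •
          (z.2.2.1 + z.1 • gradX F z.2.1 z.2.2.1 z.2.2.2)) z.2.2.2 ≤ η * z.1 := by
  set fp : ℝ × Eucl n × Eucl n × ℝ → Eucl n := fun z => gradP F z.2.1 z.2.2.1 z.2.2.2 with hfp
  set fx : ℝ × Eucl n × Eucl n × ℝ → Eucl n := fun z => gradX F z.2.1 z.2.2.1 z.2.2.2 with hfx
  set fu : ℝ × Eucl n × Eucl n × ℝ → ℝ := fun z => derivU F z.2.1 z.2.2.1 z.2.2.2 with hfu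
  set f : ℝ × Eucl n × Eucl n × ℝ → ℝ := fun z => F z.2.1 z.2.2.1 z.2.2.2 with hf
  have cfp : Continuous fp := by
    have := hF.continuous_gradP.comp (continuous_snd (X := ℝ)); simpa only [Function.comp_def]
  have cfx : Continuous fx := by
    have := hF.continuous_gradX.comp (continuous_snd (X := ℝ)); simpa only [Function.comp_def]
  have cfu : Continuous fu := by
    have := hF.continuous_derivU.comp (continuous_snd (X := ℝ)); simpa only [Function.comp_def]
  have cf : Continuous f := by
    have := hF.continuous.comp (continuous_snd (X := ℝ)); simpa only [Function.comp_def]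
  have cp : Continuous (fun z : ℝ × Eucl n × Eucl n × ℝ => z.2.2.1) := by fun_prop
  set z₀ : ℝ × Eucl n × Eucl n × ℝ := (0, ζ) with hz₀
  set a : ℝ × Eucl n × Eucl n × ℝ → ℝ := fun z => 1 - z.1 * fu z with ha
  have ca : Continuous a := continuous_const.sub (continuous_fst.mul cfu)
  have ha₀ : a z₀ = 1 := by simp [ha, hz₀]
  have cainv : ContinuousAt (fun z => (a z)⁻¹) z₀ :=
    ca.continuousAt.inv₀ (by rw [ha₀]; exact one_ne_zero)
  set P : ℝ × Eucl n × Eucl n × ℝ → Eucl n := fun z => (a z)⁻¹ • (z.2.2.1 + z.1 • fx z) with hP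
  have cP : ContinuousAt P z₀ :=
    cainv.smul (cp.add (continuous_fst.smul cfx)).continuousAt
  set V : ℝ × Eucl n × Eucl n × ℝ → Eucl n := fun z => fp z + z.1 • z.2.2.1 with hV
  have cV : Continuous V := cfp.add (continuous_fst.smul cp)
  set W : ℝ × Eucl n × Eucl n × ℝ → ℝ :=
    fun z => inner ℝ z.2.2.1 (V z) - (f z + z.1 / 2 * ‖z.2.2.1‖ ^ 2) with hW
  have cW : Continuous W :=
    (cp.inner cV).sub (cf.add ((continuous_fst.div_const 2).mul (cp.norm.pow 2)))
  -- The difference quotient of the discrete flow.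
  set D : ℝ × Eucl n × Eucl n × ℝ → Eucl n × Eucl n × ℝ :=
    fun z => (V z, -((a z)⁻¹ • (fx z + fu z • z.2.2.1)), W z) with hD
  have cD : ContinuousAt D z₀ := by
    refine cV.continuousAt.prodMk (ContinuousAt.prodMk ?_ cW.continuousAt)
    exact (cainv.smul (cfx.add (cfu.smul cp)).continuousAt).neg
  set A : ℝ × Eucl n × Eucl n × ℝ → Eucl n × Eucl n × ℝ :=
    fun z => (z.2.1 + z.1 • V z, z.2.2.1, z.2.2.2 + z.1 * W z) with hA
  set B : ℝ × Eucl n × Eucl n × ℝ → Eucl n × Eucl n × ℝ :=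
    fun z => (z.2.1, P z, z.2.2.2) with hB
  have cA : Continuous A := by
    have c1 : Continuous (fun z : ℝ × Eucl n × Eucl n × ℝ => z.2.1) := by fun_prop
    have c2 : Continuous (fun z : ℝ × Eucl n × Eucl n × ℝ => z.2.2.2) := by fun_prop
    exact (c1.add (continuous_fst.smul cV)).prodMk
      (cp.prodMk (c2.add (continuous_fst.mul cW)))
  have cB : ContinuousAt B z₀ := by
    have c1 : Continuous (fun z : ℝ × Eucl n × Eucl n × ℝ => z.2.1) := by fun_prop
    have c2 : Continuous (fun z : ℝ × Eucl n × Eucl n × ℝ => z.2.2.2) := by fun_prop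
    exact c1.continuousAt.prodMk (cP.prodMk c2.continuousAt)
  obtain ⟨x, p, u⟩ := ζ
  have hA₀ : A z₀ = (x, p, u) := by simp [hA, hz₀]
  have hP₀ : P z₀ = p := by simp [hP, ha₀]; simp [hz₀]
  have hB₀ : B z₀ = (x, p, u) := by
    have : B z₀ = (z₀.2.1, P z₀, z₀.2.2.2) := rfl
    rw [this, hP₀]
  have hAB : Tendsto (fun z => (A z, B z)) (𝓝 z₀) (𝓝 ((x, p, u), (x, p, u))) := by
    have h1 := cA.tendsto z₀
    have h2 := cB.tendsto
    rw [hA₀] at h1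
    rw [hB₀] at h2
    exact h1.prodMk_nhds h2
  set L := jetForm (gradX H x p u) (gradP H x p u) (derivU H x p u) with hL
  set M := ‖D z₀‖ + 1 with hM
  have hM0 : 0 < M := by positivity
  have hεM : 0 < η / (2 * M) := by positivity
  have hev1 := hAB.eventually ((hH.hasStrictFDerivAt x p u).isLittleO.def hεM)
  have hev2 : ∀ᶠ z in 𝓝 z₀, ‖D z‖ < M := cD.norm.eventually (Iio_mem_nhds (by rw [hM]; linarith))
  have hE : ContinuousAt (fun z => L (D z) + fu z * H (B z).1 (B z).2.1 (B z).2.2) z₀ := by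
    have c1 : ContinuousAt (fun z => H (B z).1 (B z).2.1 (B z).2.2) z₀ := by
      have := ContinuousAt.comp (f := B) (hH.continuous.continuousAt (x := B z₀)) cB
      simpa only [Function.comp_def] using this
    exact (L.continuous.continuousAt.comp cD).add (cfu.continuousAt.mul c1)
  -- At `h = 0` the quotient `D` is the difference quotient of the contact flow of `F`, and this
  -- expression is exactly the left-hand side of the Jacobi identity.
  have hE₀ : L (D z₀) + fu z₀ * H (B z₀).1 (B z₀).2.1 (B z₀).2.2 = 0 := by
    have hV₀ : V z₀ = gradP F x p u := by simp [hV, hz₀, hfp]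
    have hW₀ : W z₀ = inner ℝ p (gradP F x p u) - F x p u := by
      simp only [hW, hV₀]; simp [hz₀, hf]
    have hD₀ : D z₀ = (gradP F x p u, -(gradX F x p u + derivU F x p u • p),
        inner ℝ p (gradP F x p u) - F x p u) := by
      simp only [hD, hV₀, hW₀, ha₀]; simp [hz₀, hfx, hfu]
    have hj := hHF x p u
    rw [hB₀, hD₀, hL, jetForm_apply]
    simp only [inner_neg_right, inner_add_right, real_inner_smul_right]
    have hfu₀ : fu z₀ = derivU F x p u := by simp [hfu, hz₀]
    rw [hfu₀, real_inner_comm p (gradP H x p u)]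
    linarith
  have hev3 : ∀ᶠ z in 𝓝 z₀, L (D z) + fu z * H (B z).1 (B z).2.1 (B z).2.2 < η / 2 :=
    hE.eventually (Iio_mem_nhds (by dsimp only; rw [hE₀]; positivity))
  have hev4 : ∀ᶠ z in 𝓝 z₀, 0 < a z :=
    ca.continuousAt.eventually (Ioi_mem_nhds (by rw [ha₀]; exact one_pos))
  filter_upwards [hev1, hev2, hev3, hev4] with z h1 h2 h3 h4 hz
  -- An exact identity, not an expansion. All of the error therefore sits in the differentiability
  -- of `H` and in the continuity of `D`.
  have hdiff : A z - B z = z.1 • D z := by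
    have e1 : z.2.2.1 - P z = z.1 • -((a z)⁻¹ • (fx z + fu z • z.2.2.1)) := by
      have e2 : z.2.2.1 = (a z)⁻¹ • (a z • z.2.2.1) := by rw [smul_smul, inv_mul_cancel₀ h4.ne',
        one_smul]
      rw [smul_neg, smul_comm z.1, ← smul_neg]
      conv_lhs => rw [e2]
      simp only [hP]
      rw [← smul_sub]
      congr 1
      simp only [ha, sub_smul, one_smul, mul_smul, smul_add]
      abel
    simp only [hA, hB, hD, Prod.mk_sub_mk, Prod.smul_mk, add_sub_cancel_left, e1, smul_eq_mul]
  rw [hdiff, map_smul, norm_smul, Real.norm_eq_abs z.1, abs_of_pos hz, smul_eq_mul] at h1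
  have h5 := (abs_le.1 h1).2
  have h6 : η / (2 * M) * (z.1 * ‖D z‖) ≤ z.1 * (η / 2) := by
    have e1 : η / (2 * M) * (z.1 * ‖D z‖) ≤ η / (2 * M) * (z.1 * M) := by gcongr
    have e2 : η / (2 * M) * (z.1 * M) = z.1 * (η / 2) := by field_simp
    linarith
  have h7 := mul_le_mul_of_nonneg_left h3.le hz.le
  have hW' : z.2.2.2 + inner ℝ z.2.2.1 (z.1 • V z) - z.1 * (f z + z.1 / 2 * ‖z.2.2.1‖ ^ 2)
      = z.2.2.2 + z.1 * W z := by
    simp only [hW, real_inner_smul_right]; ring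
  change H (z.2.1 + z.1 • V z) z.2.2.1
    (z.2.2.2 + inner ℝ z.2.2.1 (z.1 • V z) - z.1 * (f z + z.1 / 2 * ‖z.2.2.1‖ ^ 2))
    - a z * H z.2.1 (P z) z.2.2.2 ≤ η * z.1
  rw [hW']
  have h8 : a z * H z.2.1 (P z) z.2.2.2
      = H z.2.1 (P z) z.2.2.2 - z.1 * (fu z * H z.2.1 (P z) z.2.2.2) := by
    simp only [ha]; ring
  rw [h8]
  simp only [hA, hB] at h5 h7
  linarith

end

/-! ### Propagation of the subsolution inequality through the iterates. -/

section

variable {n : ℕ} {H F : Eucl n → Eucl n → ℝ → ℝ}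

/-- Compactness makes the threshold on `h` uniform; it is only uniform on bounded sets, so the
iteration has to be confined to one. -/
lemma exists_hamiltonian_step (hH : IsContactHamiltonian H) (hF : IsContactHamiltonian F)
    (hHF : JacobiCommute H F) (X c B : ℝ) {η : ℝ} (hη : 0 < η) :
    ∃ h₁ : ℝ, 0 < h₁ ∧ ∀ h, 0 < h → h ≤ h₁ → ∀ (y p : Eucl n) (u : ℝ),
      ‖y‖ ≤ X → ‖p‖ ≤ c → |u| ≤ B →
      H (y + h • (gradP F y p u + h • p)) p
        (u + inner ℝ p (h • (gradP F y p u + h • p)) - h * (F y p u + h / 2 * ‖p‖ ^ 2))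
      - (1 - h * derivU F y p u) * H y
        ((1 - h * derivU F y p u)⁻¹ • (p + h • gradX F y p u)) u ≤ η * h := by
  have hcpt : IsCompact (closedBall (0 : Eucl n) X ×ˢ closedBall (0 : Eucl n) c ×ˢ
      closedBall (0 : ℝ) B) :=
    (isCompact_closedBall _ _).prod ((isCompact_closedBall _ _).prod (isCompact_closedBall _ _))
  have : ∀ᶠ h : ℝ in 𝓝 0, ∀ ζ ∈ closedBall (0 : Eucl n) X ×ˢ closedBall (0 : Eucl n) c ×ˢ
      closedBall (0 : ℝ) B, 0 < h →
      H (ζ.1 + h • (gradP F ζ.1 ζ.2.1 ζ.2.2 + h • ζ.2.1)) ζ.2.1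
        (ζ.2.2 + inner ℝ ζ.2.1 (h • (gradP F ζ.1 ζ.2.1 ζ.2.2 + h • ζ.2.1))
          - h * (F ζ.1 ζ.2.1 ζ.2.2 + h / 2 * ‖ζ.2.1‖ ^ 2))
      - (1 - h * derivU F ζ.1 ζ.2.1 ζ.2.2) * H ζ.1
        ((1 - h * derivU F ζ.1 ζ.2.1 ζ.2.2)⁻¹ • (ζ.2.1 + h • gradX F ζ.1 ζ.2.1 ζ.2.2)) ζ.2.2
        ≤ η * h :=
    hcpt.eventually_forall_of_forall_eventually
      fun ζ _ => eventually_hamiltonian_step hH hF hHF ζ hη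
  obtain ⟨ε, hε, hball⟩ := Metric.eventually_nhds_iff.1 this
  refine ⟨ε / 2, by positivity, fun h hh hle y p u hy hp hu => ?_⟩
  refine hball (y := h) ?_ (y, p, u) ⟨by simpa using hy, by simpa using hp, by simpa using hu⟩ hh
  rw [Real.dist_eq, sub_zero, abs_of_pos hh]
  linarith

section Parameter

variable {w : Eucl n → ℝ → ℝ} {K : ℝ}

lemma bddCont_slice {B : ℝ} (hK : 0 ≤ K)
    (hw : ∀ x y s t, |w x t - w y s| ≤ K * (‖x - y‖ + |t - s|)) (hB : ∀ x t, |w x t| ≤ B)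
    (t : ℝ) : BddCont fun y => w y t := by
  refine ⟨(LipschitzWith.of_dist_le_mul (K := ⟨K, hK⟩) fun x y => ?_).continuous, B,
    fun x => hB x t⟩
  have h1 := hw x y t t
  rw [sub_self, abs_zero, add_zero] at h1
  rw [Real.dist_eq, dist_eq_norm]
  exact h1

lemma abs_iterate_param_sub_le (hF : IsContactHamiltonian F) {h c C : ℝ} (hh : 0 < h)
    (hh1 : h ≤ 1) (hC : ∀ (x p : Eucl n) (u v : ℝ), |F x p u - F x p v| ≤ C * |u - v|)
    (hC0 : 0 ≤ C) (hK : 0 ≤ K) (hb : ∀ t, BddCont fun y => w y t)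
    (hw : ∀ x y s t, |w x t - w y s| ≤ K * (‖x - y‖ + |t - s|)) {k : ℕ}
    (hS : ∀ t, SchemeBounds F h c (fun y => w y t) k) (x y : Eucl n) (s t : ℝ) :
    |(step F h)^[k] (fun y => w y t) x - (step F h)^[k] (fun y => w y s) y|
      ≤ c * (‖x - y‖ + h) + Real.exp (C * (k * h)) * (K * |t - s|) := by
  have h1 := (hS t).space x y
  have h2 := iterate_step_nonexpansive hF hh hh1 hC hC0 (hb t) (hb s) (D := K * |t - s|)
    (by positivity) (fun x => by simpa using hw x x s t) k y
  exact (abs_sub_le _ _ _).trans (add_le_add h1 h2)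

/-- Here `L` may depend on `h`. It serves only as a qualitative hypothesis at a fixed step, so the
crude constant `h⁻¹` from the truncation is enough. -/
lemma exists_iterate_param_lipschitz (hF : IsContactHamiltonian F) {h : ℝ} (hh : 0 < h)
    (hh1 : h ≤ 1) (hK : 0 ≤ K) (hb : ∀ t, BddCont fun y => w y t)
    (hw : ∀ x y s t, |w x t - w y s| ≤ K * (‖x - y‖ + |t - s|)) (k : ℕ) :
    ∃ L : ℝ, 0 ≤ L ∧ ∀ x y s t,
      |(step F h)^[k] (fun y => w y t) x - (step F h)^[k] (fun y => w y s) y|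
        ≤ L * (‖x - y‖ + |t - s|) := by
  obtain ⟨C, hC0, hC⟩ := hF.exists_lipschitz_u
  have key : ∃ L₀ : ℝ, 0 ≤ L₀ ∧ ∀ x y t,
      |(step F h)^[k] (fun y => w y t) x - (step F h)^[k] (fun y => w y t) y| ≤ L₀ * ‖x - y‖ := by
    cases k with
    | zero => exact ⟨K, hK, fun x y t => by simpa using hw x y t t⟩
    | succ k =>
      refine ⟨h⁻¹, by positivity, fun x y t => ?_⟩
      rw [Function.iterate_succ_apply']
      exact step_lipschitz hF hh hh1 (iterate_step_bddCont hF hh hh1 (hb t) k) x y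
  obtain ⟨L₀, hL₀, hL⟩ := key
  refine ⟨L₀ + Real.exp (C * (k * h)) * K, by positivity, fun x y s t => ?_⟩
  have h1 := hL x y t
  have h2 := iterate_step_nonexpansive hF hh hh1 hC hC0.le (hb t) (hb s) (D := K * |t - s|)
    (by positivity) (fun x => by simpa using hw x x s t) k y
  refine (abs_sub_le _ _ _).trans ((add_le_add h1 h2).trans ?_)
  have h3 : 0 ≤ L₀ * |t - s| := by positivity
  have h4 : 0 ≤ Real.exp (C * (k * h)) * K * ‖x - y‖ := by positivity
  linarith

/-- If all subgradients of `w` satisfy the inequality of the equation for `H`, then so do, up to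
a small error, the subgradients of the iterates of the scheme for `F` started from the slices
of `w`. -/
theorem iterate_subgradient (hH : IsContactHamiltonian H) (hF : IsContactHamiltonian F)
    (hHF : JacobiCommute H F) {B T : ℝ} (hK : 0 ≤ K)
    (hw : ∀ x y s t, |w x t - w y s| ≤ K * (‖x - y‖ + |t - s|)) (hB : ∀ x t, |w x t| ≤ B)
    (hsub : ∀ x t p q, 0 < t → t < T → HasSubgradient w x t p q → q + H x p (w x t) ≤ 0)
    (S X : ℝ) {η : ℝ} (hη : 0 < η) :
    ∃ h₁ : ℝ, 0 < h₁ ∧ ∀ h, 0 < h → h ≤ h₁ → ∀ k : ℕ, k * h ≤ S → ∀ x t p q, ‖x‖ ≤ X →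
      0 < t → t < T →
      HasSubgradient (fun x t => (step F h)^[k] (fun y => w y t) x) x t p q →
      q + H x p ((step F h)^[k] (fun y => w y t) x) ≤ η := by
  obtain ⟨c, h₀, hc, hh₀, hh₀1, hSB⟩ := exists_schemeBounds hF K S
  obtain ⟨C, hC0, hC⟩ := hF.lipU
  set η₀ := η / ((|S| + 1) * Real.exp (C * |S|)) with hη₀d
  have hη₀ : 0 < η₀ := by positivity
  -- Going back from the ball of radius `X` at speed at most `c` for a time `S` never leaves the
  -- radius `X + c * S`; momenta and values are bounded by `exists_schemeBounds`.
  obtain ⟨h₂, hh₂, hstep⟩ := exists_hamiltonian_step hH hF hHF (X + c * S) c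
    (B + c * (1 + |S|)) hη₀
  have hb := bddCont_slice hK hw hB
  -- The last bound gives `h * C < 1`, so that `1 - h * derivU F` is positive, and `c < h⁻¹`, so
  -- that the maximizing covectors are interior.
  refine ⟨min h₀ (min h₂ (1 / (2 * (C + c)))), by positivity, fun h hh hle => ?_⟩
  have hle0 : h ≤ h₀ := hle.trans (min_le_left _ _)
  have hle2 : h ≤ h₂ := hle.trans ((min_le_right _ _).trans (min_le_left _ _))
  have hle3 : h * (2 * (C + c)) ≤ 1 := by
    rw [← le_div_iff₀ (by positivity)]
    exact hle.trans ((min_le_right _ _).trans (min_le_right _ _))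
  have hh1 : h ≤ 1 := hle0.trans hh₀1
  have hhC : h * C < 1 := by nlinarith
  have hhc : c < h⁻¹ := by
    rw [lt_inv_comm₀ hc hh, ← one_div, lt_div_iff₀ hc]
    nlinarith
  have hbounds : ∀ t, ∀ k : ℕ, k * h ≤ S → SchemeBounds F h c (fun y => w y t) k := fun t =>
    hSB h hh hle0 _ (hb t) fun x y => by simpa using hw x y t t
  -- The admissible ball grows as `k` decreases, to make room for the backward motion. Each step
  -- adds an error `η₀ * h` and amplifies the previous one by at most `exp (h * C)`.
  have claim : ∀ k : ℕ, k * h ≤ S → ∀ x t p q, ‖x‖ + c * (k * h) ≤ X + c * S → 0 < t → t < T →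
      HasSubgradient (fun x t => (step F h)^[k] (fun y => w y t) x) x t p q →
      q + H x p ((step F h)^[k] (fun y => w y t) x)
        ≤ η₀ * (k * h) * Real.exp (C * (k * h)) := by
    intro k
    induction k with
    | zero =>
      intro _ x t p q _ ht0 htT hs
      simpa using hsub x t p q ht0 htT hs
    | succ k ih =>
      intro hk x t p q hx ht0 htT hs
      have hk' : k * h ≤ S := by push_cast at hk; linarith
      have hfun : (fun x t => (step F h)^[k + 1] (fun y => w y t) x)
          = fun x t => step F h (fun y => (step F h)^[k] (fun y => w y t) y) x := by
        funext x t
        rw [Function.iterate_succ_apply']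
      rw [hfun] at hs
      have hbk : ∀ t, BddCont fun y => (step F h)^[k] (fun y => w y t) y :=
        fun t => iterate_step_bddCont hF hh hh1 (hb t) k
      obtain ⟨L, hL0, hL⟩ := exists_iterate_param_lipschitz hF hh hh1 hK hb hw k
      obtain ⟨y, hy, -⟩ := exists_stepMinimizer hF hh hh1 (hbk t) x
      set u := (step F h)^[k] (fun y => w y t) y with hu
      have hd := abs_le.1 (hC y p u)
      have ha : 0 < 1 - h * derivU F y p u := by
        have := mul_le_mul_of_nonneg_left hd.2 hh.le
        linarith
      have ha' : 1 - h * derivU F y p u ≤ Real.exp (h * C) := by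
        have := mul_le_mul_of_nonneg_left hd.1 hh.le
        have := Real.add_one_le_exp (h * C)
        linarith
      obtain ⟨hmax, hs'⟩ := subgradient_step hF hh hh1 hL0 hbk hL hy hs ha
      have hpc : ‖p‖ ≤ c := (hbounds t k hk').momentum x y p hy hmax
      have hxy : ‖x - y‖ ≤ c * h := (hbounds t k hk').speed x y hy
      have hyx : ‖y‖ ≤ ‖x‖ + ‖x - y‖ := by
        have := norm_sub_le x (x - y)
        rwa [sub_sub_cancel] at this
      push_cast at hx
      have hyX : ‖y‖ + c * (k * h) ≤ X + c * S := by linarith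
      have hkh : 0 ≤ (k : ℝ) * h := by positivity
      have hub : |u| ≤ B + c * (1 + |S|) := by
        have e1 := abs_iterate_sub_iterate_le (hbounds t) hh (k := 0) (l := k)
          (by simpa using hkh.trans hk') hk' y y
        simp only [sub_self, norm_zero, zero_add, Nat.cast_zero, zero_mul, sub_zero,
          Function.iterate_zero, id] at e1
        rw [abs_of_nonneg hkh] at e1
        have e2 := abs_sub_abs_le_abs_sub u (w y t)
        have e3 : c * (h + k * h) ≤ c * (1 + |S|) :=
          mul_le_mul_of_nonneg_left (add_le_add hh1 (hk'.trans (le_abs_self S))) hc.le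
        linarith [hB y t]
      have hIH := ih hk' y t _ _ hyX ht0 htT hs'
      have hmain := hstep h hh hle2 y p u
        (by have : 0 ≤ c * (k * h) := by positivity
            linarith) hpc hub
      -- Position and value after the step are now exactly the arguments of `H` in `hmain`.
      have hvel := hmax.velocity_eq hF (hpc.trans_lt hhc)
      have hval : step F h (fun y => (step F h)^[k] (fun y => w y t) y) x
          = u + inner ℝ p (h • (gradP F y p u + h • p)) - h * (F y p u + h / 2 * ‖p‖ ^ 2) := by
        rw [IsStepMinimizer, hmax.stepCost_eq, stepAction] at hy
        rw [hy, ← sub_eq_iff_eq_add'.2 hvel]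
        ring
      rw [← hvel, ← hval] at hmain
      rw [Function.iterate_succ_apply']
      set a := 1 - h * derivU F y p u with had
      have e1 := mul_le_mul_of_nonneg_left hIH ha.le
      rw [mul_add, mul_inv_cancel_left₀ ha.ne'] at e1
      set E := Real.exp (C * (k * h)) with hE
      have e2 : a * (η₀ * (k * h) * E) ≤ Real.exp (h * C) * (η₀ * (k * h) * E) :=
        mul_le_mul_of_nonneg_right ha' (by positivity)
      have e3 : Real.exp (C * ((k + 1 : ℕ) * h)) = Real.exp (h * C) * E := by
        rw [hE, ← Real.exp_add]; push_cast; ring_nf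
      have e4 : 1 ≤ Real.exp (h * C) * E := by
        rw [← e3]
        exact Real.one_le_exp (by positivity)
      have e5 : η₀ * h * 1 ≤ η₀ * h * (Real.exp (h * C) * E) :=
        mul_le_mul_of_nonneg_left e4 (by positivity)
      rw [e3]
      push_cast
      have e6 : η₀ * ((k + 1) * h) * (Real.exp (h * C) * E)
          = Real.exp (h * C) * (η₀ * (k * h) * E) + η₀ * h * (Real.exp (h * C) * E) := by ring
      rw [e6]
      linarith
  intro k hk x t p q hx ht0 htT hs
  have hkh : 0 ≤ (k : ℝ) * h := by positivity
  have hkS : k * h ≤ |S| := hk.trans (le_abs_self S)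
  refine (claim k hk x t p q ?_ ht0 htT hs).trans ?_
  · exact add_le_add hx (mul_le_mul_of_nonneg_left hk hc.le)
  · have e1 : η₀ * (k * h) * Real.exp (C * (k * h)) ≤ η₀ * (|S| + 1) * Real.exp (C * |S|) := by
      gcongr
      linarith
    have e2 : η₀ * (|S| + 1) * Real.exp (C * |S|) = η := by rw [hη₀d]; field_simp
    linarith

/-- In contrast with `exists_iterate_param_lipschitz`, the constant does not depend on `h`, at the
price of an additive error of order `h`; it thus survives in the limit and gives equicontinuity. -/
lemma exists_schemeLimit_param_lipschitz (hF : IsContactHamiltonian F) (hK : 0 ≤ K)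
    (hb : ∀ t, BddCont fun y => w y t)
    (hw : ∀ x y s t, |w x t - w y s| ≤ K * (‖x - y‖ + |t - s|)) {σ : ℝ} (hσ : 0 ≤ σ) :
    ∃ L : ℝ, 0 < L ∧ ∃ h₀ : ℝ, 0 < h₀ ∧ h₀ ≤ 1 ∧
      (∀ h, 0 < h → h ≤ h₀ → ∀ x y s t, |schemeValue F (fun y => w y t) x σ h
        - schemeValue F (fun y => w y s) y σ h| ≤ L * (‖x - y‖ + |t - s| + h)) ∧
      ∀ x y s t, |schemeLimit F (fun y => w y t) x σ - schemeLimit F (fun y => w y s) y σ|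
        ≤ L * (‖x - y‖ + |t - s|) := by
  obtain ⟨c, h₀, hc, hh₀, hh₀1, hSB⟩ := exists_schemeBounds hF K σ
  obtain ⟨C, hC0, hC⟩ := hF.exists_lipschitz_u
  have hlip : ∀ t, ∀ x y, |w x t - w y t| ≤ K * ‖x - y‖ := fun t x y => by simpa using hw x y t t
  have hval : ∀ h, 0 < h → h ≤ h₀ → ∀ x y s t, |schemeValue F (fun y => w y t) x σ h
      - schemeValue F (fun y => w y s) y σ h|
        ≤ (c + Real.exp (C * σ) * K) * (‖x - y‖ + |t - s| + h) := by
    intro h hh hle x y s t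
    have hk := floor_mul_le hh hσ
    refine (abs_iterate_param_sub_le hF hh (hle.trans hh₀1) hC hC0.le hK hb hw
      (fun t => hSB h hh hle _ (hb t) (hlip t) _ hk) x y s t).trans ?_
    have e1 : Real.exp (C * (⌊σ / h⌋₊ * h)) * (K * |t - s|) ≤ Real.exp (C * σ) * (K * |t - s|) := by
      gcongr
    have e2 : 0 ≤ Real.exp (C * σ) * K * (‖x - y‖ + h) := by positivity
    have e3 : 0 ≤ c * |t - s| := by positivity
    linarith
  refine ⟨c + Real.exp (C * σ) * K, by positivity, h₀, hh₀, hh₀1, hval, fun x y s t => ?_⟩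
  have h1 := ((tendsto_schemeLimit hF (hb t) (hlip t) x hσ).sub
    (tendsto_schemeLimit hF (hb s) (hlip s) y hσ)).abs
  have h2 := (tendsto_id_stepUltrafilter.const_add (‖x - y‖ + |t - s|)).const_mul
    (c + Real.exp (C * σ) * K)
  rw [add_zero] at h2
  exact le_of_tendsto_of_tendsto h1 h2 (eventually_stepUltrafilter hh₀ fun h hh hhh =>
    hval h hh hhh x y s t)

end Parameter

end

/-! ### Passage to the limit and commutation of the semigroups. -/

section

variable {n : ℕ} {H F : Eucl n → Eucl n → ℝ → ℝ}

/-- A minimum of `f` minus an affine function plus a quadratic one is a proximal subgradient. -/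
lemma hasProxSubgradient_of_isMin {f : Eucl n → ℝ → ℝ} {x y p : Eucl n} {t s q A : ℝ}
    (hA : 0 < A) (hmin : ∀ᶠ Z : Eucl n × ℝ in 𝓝 (y, s),
      f y s - inner ℝ p (y - x) - q * (s - t) + A * (‖y - x‖ ^ 2 + (s - t) ^ 2)
        ≤ f Z.1 Z.2 - inner ℝ p (Z.1 - x) - q * (Z.2 - t)
          + A * (‖Z.1 - x‖ ^ 2 + (Z.2 - t) ^ 2)) :
    HasProxSubgradient f y s (p - (2 * A) • (y - x)) (q - 2 * A * (s - t)) := by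
  refine ⟨A, hA, hmin.mono fun Z hZ => ?_⟩
  have e1 : Z.1 - x = (y - x) + (Z.1 - y) := by abel
  have e2 : ‖Z.1 - x‖ ^ 2 = ‖y - x‖ ^ 2 + 2 * inner ℝ (y - x) (Z.1 - y) + ‖Z.1 - y‖ ^ 2 := by
    rw [e1, norm_add_sq_real]
  rw [e2] at hZ
  rw [e1, inner_add_right] at hZ
  rw [inner_sub_left, real_inner_smul_left]
  linear_combination hZ

/-- Evolving the slices of a subsolution of the equation for `H` by the semigroup of `F` yields
a subsolution of the equation for `H`. -/
theorem schemeLimit_param_proxSubgradient (hH : IsContactHamiltonian H)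
    (hF : IsContactHamiltonian F) (hHF : JacobiCommute H F) {w : Eucl n → ℝ → ℝ} {K B T : ℝ}
    (hK : 0 ≤ K) (hw : ∀ x y s t, |w x t - w y s| ≤ K * (‖x - y‖ + |t - s|))
    (hB : ∀ x t, |w x t| ≤ B)
    (hsub : ∀ x t p q, 0 < t → t < T → HasSubgradient w x t p q → q + H x p (w x t) ≤ 0)
    {σ : ℝ} (hσ : 0 ≤ σ) {x p : Eucl n} {t q : ℝ} (ht0 : 0 < t) (htT : t < T)
    (hprox : HasProxSubgradient (fun x t => schemeLimit F (fun y => w y t) x σ) x t p q) :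
    q + H x p (schemeLimit F (fun y => w y t) x σ) ≤ 0 := by
  refine le_of_forall_pos_le_add fun η hη => ?_
  rw [zero_add]
  have hb := bddCont_slice hK hw hB
  obtain ⟨L, hL, h₀, hh₀, hh₀1, hval, -⟩ := exists_schemeLimit_param_lipschitz hF hK hb hw hσ
  obtain ⟨A, hA, hprox⟩ := hprox
  have hev : ∀ᶠ Y : Eucl n × ℝ in 𝓝 (x, t), 0 < Y.2 ∧ Y.2 < T :=
    (continuous_snd.tendsto (x, t)).eventually (Ioo_mem_nhds ht0 htT)
  obtain ⟨r, hr, hball⟩ := Metric.nhds_basis_closedBall.eventually_iff.1 (hprox.and hev)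
  set ψ : ℝ → Eucl n × ℝ → ℝ := fun h Y => schemeValue F (fun y => w y Y.2) Y.1 σ h with hψ
  set W : Eucl n × ℝ → ℝ := fun Y => schemeLimit F (fun y => w y Y.2) Y.1 σ with hW
  set Q : Eucl n × ℝ → ℝ := fun Y => - inner ℝ p (Y.1 - x) - q * (Y.2 - t)
    + 2 * A * (‖Y.1 - x‖ ^ 2 + (Y.2 - t) ^ 2) with hQ
  have hQc : Continuous Q := by
    refine ((continuous_const.inner (by fun_prop)).neg.sub (by fun_prop)).add (by fun_prop)
  have hψc : ∀ h, 0 < h → h ≤ h₀ → Continuous (ψ h) := by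
    intro h hh hle
    obtain ⟨L', hL'0, hL'⟩ := exists_iterate_param_lipschitz hF hh (hle.trans hh₀1) hK hb hw
      ⌊σ / h⌋₊
    refine (LipschitzWith.of_dist_le_mul (K := ⟨2 * L', by positivity⟩) fun Y Z => ?_).continuous
    rw [Real.dist_eq]
    refine (hL' Y.1 Z.1 Z.2 Y.2).trans ?_
    have e1 : ‖Y.1 - Z.1‖ ≤ dist Y Z := by
      rw [Prod.dist_eq, ← dist_eq_norm]; exact le_max_left _ _
    have e2 : |Y.2 - Z.2| ≤ dist Y Z := by
      rw [Prod.dist_eq, ← Real.dist_eq]; exact le_max_right _ _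
    change _ ≤ 2 * L' * _
    nlinarith
  have hex : ∀ h, ∃ Y ∈ closedBall (x, t) r, 0 < h → h ≤ h₀ →
      ∀ Z ∈ closedBall (x, t) r, ψ h Y + Q Y ≤ ψ h Z + Q Z := by
    intro h
    by_cases hh : 0 < h ∧ h ≤ h₀
    · obtain ⟨Y, hY, hmin⟩ := (isCompact_closedBall (x, t) r).exists_isMinOn
        (nonempty_closedBall.2 hr.le) ((hψc h hh.1 hh.2).add hQc).continuousOn
      exact ⟨Y, hY, fun _ _ Z hZ => hmin hZ⟩
    · exact ⟨(x, t), mem_closedBall_self hr.le, fun h1 h2 => absurd ⟨h1, h2⟩ hh⟩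
  choose Y hYmem hYmin using hex
  obtain ⟨Ys, hYs, hYlim⟩ := exists_tendsto_of_eventually_mem stepUltrafilter
    (isCompact_closedBall (x, t) r) (Eventually.of_forall hYmem)
  have hlim : ∀ Z, Tendsto (fun h => ψ h Z) stepUltrafilter (𝓝 (W Z)) := fun Z =>
    tendsto_schemeLimit hF (hb Z.2) (K := K) (fun x y => by simpa using hw x y Z.2 Z.2) Z.1 hσ
  have hψY : Tendsto (fun h => ψ h (Y h)) stepUltrafilter (𝓝 (W Ys)) := by
    have hn : Tendsto (fun h => L * (‖(Y h).1 - Ys.1‖ + |(Y h).2 - Ys.2| + h)) stepUltrafilter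
        (𝓝 0) := by
      have hcont : Continuous (fun Z : Eucl n × ℝ => ‖Z.1 - Ys.1‖ + |Z.2 - Ys.2|) := by fun_prop
      have h1 := (((hcont.tendsto Ys).comp hYlim).add tendsto_id_stepUltrafilter).const_mul L
      simpa using h1
    have h2 : Tendsto (fun h => ψ h (Y h) - ψ h Ys) stepUltrafilter (𝓝 0) :=
      squeeze_zero_norm' (eventually_stepUltrafilter hh₀ fun h hh hle =>
        hval h hh hle (Y h).1 Ys.1 Ys.2 (Y h).2) hn
    have h3 := h2.add (hlim Ys)
    simpa using h3
  have hYsX : Ys = (x, t) := by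
    have h1 : W Ys + Q Ys ≤ W (x, t) + Q (x, t) :=
      le_of_tendsto_of_tendsto (hψY.add ((hQc.tendsto Ys).comp hYlim))
        ((hlim (x, t)).add_const _)
        (eventually_stepUltrafilter hh₀ fun h hh hle =>
          hYmin h hh hle _ (mem_closedBall_self hr.le))
    have h2 := (hball hYs).1
    have h3 : Q (x, t) = 0 := by simp [hQ]
    rw [h3] at h1
    simp only [hQ, hW] at h1
    have h4 : A * (‖Ys.1 - x‖ ^ 2 + (Ys.2 - t) ^ 2) ≤ 0 := by linarith
    have h5 : ‖Ys.1 - x‖ ^ 2 + (Ys.2 - t) ^ 2 ≤ 0 := nonpos_of_mul_nonpos_right h4 hA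
    have h6 : ‖Ys.1 - x‖ ^ 2 = 0 := by nlinarith [sq_nonneg ‖Ys.1 - x‖, sq_nonneg (Ys.2 - t)]
    have h7 : (Ys.2 - t) ^ 2 = 0 := by nlinarith [sq_nonneg ‖Ys.1 - x‖, sq_nonneg (Ys.2 - t)]
    refine Prod.ext ?_ ?_
    · exact sub_eq_zero.1 (norm_eq_zero.1 (pow_eq_zero_iff two_ne_zero |>.1 h6))
    · exact sub_eq_zero.1 (pow_eq_zero_iff two_ne_zero |>.1 h7)
  subst hYsX
  obtain ⟨h₁, hh₁, hiter⟩ := iterate_subgradient hH hF hHF hK hw hB hsub σ (‖x‖ + r) hη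
  set P : Eucl n × ℝ → Eucl n := fun Z => p - (2 * (2 * A)) • (Z.1 - x) with hP
  set R : Eucl n × ℝ → ℝ := fun Z => q - 2 * (2 * A) * (Z.2 - t) with hR
  have hPc : Continuous P := by fun_prop
  have hRc : Continuous R := by fun_prop
  have hfin : Tendsto (fun h => R (Y h) + H (Y h).1 (P (Y h)) (ψ h (Y h))) stepUltrafilter
      (𝓝 (R (x, t) + H x (P (x, t)) (W (x, t)))) := by
    have h1 : Tendsto (fun h => ((Y h).1, P (Y h), ψ h (Y h))) stepUltrafilter
        (𝓝 (x, P (x, t), W (x, t))) :=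
      ((continuous_fst.tendsto (x, t)).comp hYlim).prodMk_nhds
        (((hPc.tendsto (x, t)).comp hYlim).prodMk_nhds hψY)
    have h2 := (hH.continuous.tendsto (x, P (x, t), W (x, t))).comp h1
    exact ((hRc.tendsto (x, t)).comp hYlim).add h2
  have hPx : P (x, t) = p := by simp [hP]
  have hRx : R (x, t) = q := by simp [hR]
  rw [hPx, hRx] at hfin
  refine le_of_tendsto hfin ?_
  have hev1 : ∀ᶠ h in (stepUltrafilter : Filter ℝ), Y h ∈ ball (x, t) r :=
    hYlim (ball_mem_nhds _ hr)
  have hev2 : ∀ᶠ h in (stepUltrafilter : Filter ℝ), 0 < h ∧ h ≤ min h₀ h₁ :=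
    eventually_stepUltrafilter (lt_min hh₀ hh₁) fun h h1 h2 => ⟨h1, h2⟩
  filter_upwards [hev1, hev2] with h hY ⟨hh, hle⟩
  have hps : HasProxSubgradient (fun x t => (step F h)^[⌊σ / h⌋₊] (fun y => w y t) x)
      (Y h).1 (Y h).2 (P (Y h)) (R (Y h)) := by
    refine hasProxSubgradient_of_isMin (by positivity) ?_
    filter_upwards [isOpen_ball.mem_nhds hY] with Z hZ
    have h1 := hYmin h hh (hle.trans (min_le_left _ _)) Z (ball_subset_closedBall hZ)
    simp only [hQ, hψ, schemeValue] at h1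
    linarith
  have hYr := mem_closedBall.1 (hYmem h)
  rw [Prod.dist_eq, max_le_iff, dist_eq_norm] at hYr
  have hnorm : ‖(Y h).1‖ ≤ ‖x‖ + r := by
    have := norm_add_le x ((Y h).1 - x)
    rw [add_sub_cancel] at this
    linarith [hYr.1]
  have htime := (hball (hYmem h)).2
  exact hiter h hh (hle.trans (min_le_right _ _)) _ (floor_mul_le hh hσ) _ _ _ _ hnorm
    htime.1 htime.2 hps.hasSubgradient

theorem schemeLimit_comm_le (hH : IsContactHamiltonian H) (hF : IsContactHamiltonian F)
    (hHF : JacobiCommute H F) {φ : Eucl n → ℝ} (hφ : IsLipBUC φ) {t σ : ℝ} (ht : 0 ≤ t)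
    (hσ : 0 ≤ σ) (x : Eucl n) :
    schemeLimit F (fun y => schemeLimit H φ y t) x σ
      ≤ schemeLimit H (fun y => schemeLimit F φ y σ) x t := by
  set T := t + 1 with hT
  have hT0 : 0 < T := by linarith
  obtain ⟨K, B, hK, hB, hlip, hbd⟩ :=
    (isLipViscositySolution_schemeLimit hH hφ).strip_bounds hφ hT0
  have hφσ := isLipBUC_schemeLimit hF hφ hσ
  obtain ⟨K', B', hK', hB', hlip', hbd'⟩ :=
    (isLipViscositySolution_schemeLimit hH hφσ).strip_bounds hφσ hT0
  -- The solution for `H`, extended to all times by its values at the ends of `[0, T]`.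
  set w : Eucl n → ℝ → ℝ := fun y τ => schemeLimit H φ y (projIcc 0 T hT0.le τ) with hw
  have hwe : ∀ τ ∈ Icc 0 T, ∀ y, w y τ = schemeLimit H φ y τ := fun τ hτ y => by
    simp only [hw, projIcc_of_mem hT0.le hτ]
  have hwlip : ∀ x y s t, |w x t - w y s| ≤ K * (‖x - y‖ + |t - s|) := fun x y s t =>
    (hlip x y _ (projIcc 0 T hT0.le s).2 _ (projIcc 0 T hT0.le t).2).trans
      (mul_le_mul_of_nonneg_left (add_le_add le_rfl (abs_projIcc_sub_projIcc hT0.le)) hK.le)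
  have hwB : ∀ x t, |w x t| ≤ B := fun x t => hbd x _ (projIcc 0 T hT0.le t).2
  have hb := bddCont_slice hK.le hwlip hwB
  obtain ⟨Kφ, hKφ⟩ := hφ.exists_lipschitz
  have hwsub : ∀ x t p q, 0 < t → t < T → HasSubgradient w x t p q →
      q + H x p (w x t) ≤ 0 := by
    intro x t p q h0 hlt hs
    rw [hwe t ⟨h0.le, hlt.le⟩]
    refine schemeLimit_subgradient hH hφ.bddCont hKφ h0.le fun ε hε => ?_
    have hev : ∀ᶠ Y : Eucl n × ℝ in 𝓝 (x, t), Y.2 ∈ Ioo 0 T :=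
      (continuous_snd.tendsto (x, t)).eventually (Ioo_mem_nhds h0 hlt)
    filter_upwards [hs ε hε, hev] with Y hY hY2
    rwa [hwe t ⟨h0.le, hlt.le⟩, hwe Y.2 ⟨hY2.1.le, hY2.2.le⟩] at hY
  obtain ⟨L, hL, -, -, -, -, hWlip⟩ := exists_schemeLimit_param_lipschitz hF hK.le hb hwlip hσ
  obtain ⟨c, hc, hclip⟩ := exists_schemeLimit_lipschitz hF K σ
  have hWB : ∀ x t, |schemeLimit F (fun y => w y t) x σ| ≤ B + c * σ := fun x t => by
    have h1 := hclip _ (hb t) (fun x y => by simpa using hwlip x y t t) x x 0 ⟨le_rfl, hσ⟩ σ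
      ⟨hσ, le_rfl⟩
    rw [schemeLimit_zero, sub_self, norm_zero, zero_add, sub_zero, abs_of_nonneg hσ] at h1
    have h2 := abs_sub_abs_le_abs_sub (schemeLimit F (fun y => w y t) x σ) (w x t)
    linarith [hwB x t]
  have hsubW : IsLocalSub H T fun x t => schemeLimit F (fun y => w y t) x σ :=
    isLocalSub_of_proxSubgradient hH hL (fun x y s _ t _ => hWlip x y s t)
      fun x t p q h0 hlt hprox =>
        schemeLimit_param_proxSubgradient hH hF hHF hK.le hwlip hwB hwsub hσ h0 hlt hprox
  have hmain := comparison hH (u := fun x t => schemeLimit F (fun y => w y t) x σ)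
    (v := schemeLimit H fun y => schemeLimit F φ y σ) (K := L + K') (B := B + c * σ + B') (T := T)
    (by positivity) (by positivity)
    (fun x y s _ t _ => (hWlip x y s t).trans
      (mul_le_mul_of_nonneg_right (by linarith) (by positivity)))
    (fun x y s hs t ht => (hlip' x y s hs t ht).trans
      (mul_le_mul_of_nonneg_right (by linarith) (by positivity)))
    (fun x t _ => (hWB x t).trans (by linarith))
    (fun x t ht => (hbd' x t ht).trans (by
      have : 0 ≤ c * σ := by positivity
      linarith))
    hsubW ((isLipViscositySolution_schemeLimit hH hφσ).isLocalSuper _)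
    (fun x => by
      have h1 : (fun y => w y 0) = φ := funext fun y => by
        rw [hwe 0 ⟨le_rfl, hT0.le⟩, schemeLimit_zero]
      simp only [h1, schemeLimit_zero, le_refl])
    x (t := t) ⟨ht, by linarith⟩
  have h1 : (fun y => w y t) = fun y => schemeLimit H φ y t :=
    funext fun y => hwe t ⟨ht, by linarith⟩ y
  simpa only [h1] using hmain

theorem laxOleinik_comm (hH : IsContactHamiltonian H) (hF : IsContactHamiltonian F)
    (hHF : JacobiCommute H F) {φ : Eucl n → ℝ} (hφ : IsLipBUC φ) {t σ : ℝ} (ht : 0 ≤ t)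
    (hσ : 0 ≤ σ) (x : Eucl n) :
    laxOleinik H t (laxOleinik F σ φ) x = laxOleinik F σ (laxOleinik H t φ) x := by
  rw [laxOleinik_eq_schemeLimit hH (isLipBUC_laxOleinik hF hφ hσ) ht,
    laxOleinik_eq_schemeLimit hF (isLipBUC_laxOleinik hH hφ ht) hσ,
    funext (laxOleinik_eq_schemeLimit hH hφ ht), funext (laxOleinik_eq_schemeLimit hF hφ hσ)]
  exact le_antisymm (schemeLimit_comm_le hF hH hHF.symm hφ hσ ht x)
    (schemeLimit_comm_le hH hF hHF hφ ht hσ x)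

end

end ContactHJ

theorem theorem2 {n : ℕ}
    (H F : EuclideanSpace ℝ (Fin n) → EuclideanSpace ℝ (Fin n) → ℝ → ℝ)
    (hH : ContactHJ.IsContactHamiltonian H) (hF : ContactHJ.IsContactHamiltonian F)
    (hHF : ContactHJ.JacobiCommute H F) :
    ContactHJ.WellPosed H ∧ ContactHJ.WellPosed F ∧
    ∀ φ : EuclideanSpace ℝ (Fin n) → ℝ, ContactHJ.IsLipBUC φ →
      ∀ lam mu : ℝ, 0 ≤ lam → 0 ≤ mu →
        ContactHJ.IsLipBUC (ContactHJ.laxOleinik F mu φ) ∧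
        ContactHJ.IsLipBUC (ContactHJ.laxOleinik H lam φ) ∧
        ∀ x : EuclideanSpace ℝ (Fin n),
          ContactHJ.laxOleinik H lam (ContactHJ.laxOleinik F mu φ) x =
            ContactHJ.laxOleinik F mu (ContactHJ.laxOleinik H lam φ) x :=
  ⟨hH.wellPosed, hF.wellPosed, fun _ hφ _ _ hlam hmu =>
    ⟨ContactHJ.isLipBUC_laxOleinik hF hφ hmu, ContactHJ.isLipBUC_laxOleinik hH hφ hlam,
      ContactHJ.laxOleinik_comm hH hF hHF hφ hlam hmu⟩⟩
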